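/- Let $d\ge 1$ and $G\in L^1(\mathbb R^d,dx)$ be real-valued. Let $r$ be a symmetric probability measure on $\mathbb R$ with support in some $[-c,c]$ and $r\{0\}=0$ (the Lévy measure), and let $\nu$ be a symmetric probability measure on $\mathbb R$ with support in some $[-c',c']$ (the interaction measure). Put $$v(t)=\int_{\mathbb R}(1-e^{i\alpha t})\,d\nu(\alpha),$$ $$C_1=\sup_{y\in\mathbb R^d,\,s\in\operatorname{supp} r}\int_{\mathbb R^d}\int_{\mathbb R}\bigl|e^{is\alpha G(y-y')}-1\bigr|\,d\nu(\alpha)\,dy',\qquad C_2=\sup_{y\in\mathbb R^d,\,\alpha\in\operatorname{supp}\nu}\int_{\mathbb R^d}\int_{\mathbb R}\bigl|e^{is\alpha G(y-y')}-1\bigr|\,dr(s)\,dy'.$$ For compact $\Lambda\subset\mathbb R^d$ and activity $z\ge 0$ let $F_\Lambda=\sum_{j=1}^{N}S_j\delta_{Y_j}$ be the Poisson noise in $\Lambda$: $N$ is Poisson with mean $z|\Lambda|$ and, given $N$, the $Y_j$ are i.i.d. uniform in $\Lambda$ and the $S_j$ are i.i.d. with law $r$, independent of the $Y_j$. Let $X_\Lambda(x)=\sum_{j=1}^{N}S_j\,G(x-Y_j)$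 be the convoluted Poisson noise (CPN) and, for $\beta\in\mathbb R$, let $V_\Lambda=\int_\Lambda v(X_\Lambda(x))\,dx$ and $\Xi_\Lambda=\mathbb E[e^{-\beta V_\Lambda}]$. The interacting CPN $\tilde X_\Lambda$ is the field $X_\Lambda$ under the probability measure with density $e^{-\beta V_\Lambda}/\Xi_\Lambda$. For $\eta=\sum_{l=1}^n\alpha_l\delta_{x_l}$ in the space $\Gamma_0$ of real signed measures of finite support on $\mathbb R^d$, its characteristic functional is $$\mathcal C_{\tilde X_\Lambda}(\eta)=\frac1{\Xi_\Lambda}\,\mathbb E\Bigl[e^{i\sum_{l}\alpha_lX_\Lambda(x_l)}\,e^{-\beta V_\Lambda}\Bigr].$$ **Corollary 6.1.** Let $z\ge 0$ and $\beta\in\mathbb R$ with $|\beta|<1/(eC_1)$ and $|z|<1/(eC_2)$ (where $1/0=\infty$). Then: (i) For every $\eta\in\Gamma_0$ the limit $\mathcal C_{\tilde X}(\eta)=\lim_{\Lambda\uparrow\mathbb R^d}\mathcal C_{\tilde X_\Lambda}(\eta)$ along the compact sets directed by inclusion exists. It is analytic in $z$ and $\beta$: for each $\eta$ it is, on these $(z,\beta)$,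 the restriction of an analytic function on the complex polydisc $\{(z,\beta)\in\mathbb C^2:|z|<1/(eC_2),\ |\beta|<1/(eC_1)\}$. (ii) $\mathcal C_{\tilde X}$ is continuous at zero: for all $n$ and $x_1,\dots,x_n\in\mathbb R^d$, $\mathcal C_{\tilde X}\bigl(\sum_{l=1}^n\alpha_l\delta_{x_l}\bigr)\to 1$ as $\alpha_1,\dots,\alpha_n\to 0$. (iii) There is a unique projective family of probability measures $P^{\tilde X}_J$ on $\mathbb R^J$, $J\subset\mathbb R^d$ finite, with $\int e^{i\sum_{x\in J}\alpha_x\omega_x}\,dP^{\tilde X}_J(\omega)=\mathcal C_{\tilde X}\bigl(\sum_{x\in J}\alpha_x\delta_x\bigr)$ for all $J$ and all $\alpha\in\mathbb R^J$. (iv) There is a unique probability measure $P^{\tilde X}_{\rm can}$ on the space of all functions $\omega:\mathbb R^d\to\mathbb R$, with the $\sigma$-algebra generated by the evaluations $\omega\mapsto\omega(x)$, whose finite-dimensional marginals are the $P^{\tilde X}_J$. Its canonical process $\tilde X(x)(\omega)=\omega(x)$ is the infinite-volume interacting CPN: its characteristic functional on $\Gamma_0$ is $\mathcal C_{\tilde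 X}$. -/

import Mathlib

open MeasureTheory Filter Topology

/-- A finite marked configuration `(y₁, s₁), …, (yₙ, sₙ)` of particles with positions `yⱼ ∈ ℝᵈ` and
charges `sⱼ ∈ ℝ`; it represents the signed measure `∑ⱼ sⱼ δ_{yⱼ}`. -/
abbrev MarkedConfig (d : ℕ) : Type :=
  Σ n : ℕ, (Fin n → EuclideanSpace ℝ (Fin d) × ℝ)

/-- A real signed measure `∑ₗ αₗ δ_{xₗ}` of finite support on `ℝᵈ`, given by its point masses. -/
abbrev FiniteConfig (d : ℕ) : Type := EuclideanSpace ℝ (Fin d) →₀ ℝ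

/-- The law of the Poisson noise `F_Λ` restricted to the finite volume `Λ`, with activity `z` and
Lévy measure `r`: the number of particles is Poisson distributed with intensity `z |Λ|` and, given
this number, positions are independent and uniform in `Λ` and charges are independent with law `r`.
On the `n`-particle sector this is `exp (-z |Λ|) (z ^ n / n!) dy₁ ⋯ dyₙ dr(s₁) ⋯ dr(sₙ)` with
`y₁, …, yₙ ∈ Λ`. -/
noncomputable def poissonNoiseLaw {d : ℕ} (z : ℝ) (r : Measure ℝ)
    (Λ : TopologicalSpace.Compacts (EuclideanSpace ℝ (Fin d))) : Measure (MarkedConfig d) :=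
  Measure.sum fun n : ℕ =>
    ENNReal.ofReal
        (Real.exp (-(z * (volume (Λ : Set (EuclideanSpace ℝ (Fin d)))).toReal)) *
          (z ^ n / (n.factorial : ℝ))) •
      (Measure.pi fun _ : Fin n =>
        (volume.restrict (Λ : Set (EuclideanSpace ℝ (Fin d)))).prod r).map (Sigma.mk n)

/-- The static field `(G * γ)(x) = ∑ⱼ sⱼ G(x - yⱼ)` of the configuration `γ = ∑ⱼ sⱼ δ_{yⱼ}`. With
`γ` distributed as the Poisson noise `F_Λ`, this is the convoluted Poisson noise `X_Λ = G * F_Λ`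
at the point `x`. -/
noncomputable def staticField {d : ℕ} (G : EuclideanSpace ℝ (Fin d) → ℝ) (γ : MarkedConfig d)
    (x : EuclideanSpace ℝ (Fin d)) : ℝ :=
  ∑ j : Fin γ.1, (γ.2 j).2 * G (x - (γ.2 j).1)

/-- The trigonometric energy density `v(t) = ∫ (1 - exp (iαt)) dν(α)`. The real part only serves
to have a real number: `v` is real-valued for symmetric `ν`, see `coe_trigEnergy`. -/
noncomputable def trigEnergy (ν : Measure ℝ) (t : ℝ) : ℝ :=
  (∫ α : ℝ, (1 - Complex.exp (Complex.I * α * t)) ∂ν).re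

theorem coe_trigEnergy (ν : Measure ℝ) (hν : ν.map (fun α => -α) = ν) (t : ℝ) :
    (trigEnergy ν t : ℂ) = ∫ α : ℝ, (1 - Complex.exp (Complex.I * α * t)) ∂ν := by
  have h : (starRingEnd ℂ) (∫ α : ℝ, (1 - Complex.exp (Complex.I * α * t)) ∂ν)
      = ∫ α : ℝ, (1 - Complex.exp (Complex.I * α * t)) ∂ν := by
    rw [← integral_conj]
    conv_rhs => rw [← hν]
    rw [integral_map (by fun_prop) (by fun_prop)]
    congr 1
    funext α
    simp [← Complex.exp_conj]
  exact Complex.conj_eq_iff_re.mp h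

/-- The interaction `V_Λ = ∫_Λ v(X_Λ(x)) dx` with infra-red cut-off `Λ`. -/
noncomputable def interaction {d : ℕ} (G : EuclideanSpace ℝ (Fin d) → ℝ) (ν : Measure ℝ)
    (Λ : TopologicalSpace.Compacts (EuclideanSpace ℝ (Fin d))) (γ : MarkedConfig d) : ℝ :=
  ∫ x in (Λ : Set (EuclideanSpace ℝ (Fin d))), trigEnergy ν (staticField G γ x)

/-- The law of the interacting particles `F̃_Λ` with finite volume and infra-red cut-off `Λ`, that
is `exp (-β V_Λ) / Ξ_Λ` times the law of the Poisson noise `F_Λ`, where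
`Ξ_Λ = E[exp (-β V_Λ)]`. The interacting CPN is `X̃_Λ = G * F̃_Λ`. -/
noncomputable def interactingLaw {d : ℕ} (z β : ℝ) (r ν : Measure ℝ)
    (G : EuclideanSpace ℝ (Fin d) → ℝ)
    (Λ : TopologicalSpace.Compacts (EuclideanSpace ℝ (Fin d))) : Measure (MarkedConfig d) :=
  (poissonNoiseLaw z r Λ).tilted fun γ => -β * interaction G ν Λ γ

/-- The characteristic functional `E[exp (i ⟨X̃_Λ, η⟩)]` of the interacting CPN `X̃_Λ` in finite
volume, where `⟨X̃_Λ, η⟩ = ∑ₗ αₗ X̃_Λ(xₗ)` for `η = ∑ₗ αₗ δ_{xₗ}`. -/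
noncomputable def charFunctional {d : ℕ} (z β : ℝ) (r ν : Measure ℝ)
    (G : EuclideanSpace ℝ (Fin d) → ℝ)
    (Λ : TopologicalSpace.Compacts (EuclideanSpace ℝ (Fin d))) (η : FiniteConfig d) : ℂ :=
  ∫ γ, Complex.exp (Complex.I * ((η.sum fun x a => a * staticField G γ x : ℝ) : ℂ))
    ∂(interactingLaw z β r ν G Λ)

/-- The infinite-volume characteristic functional, the limit `Λ ↑ ℝᵈ` of the finite-volume ones
along the compact sets directed by inclusion (an arbitrary value if this limit does not exist). -/
noncomputable def charFunctionalLimit {d : ℕ} (z β : ℝ) (r ν : Measure ℝ)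
    (G : EuclideanSpace ℝ (Fin d) → ℝ) (η : FiniteConfig d) : ℂ :=
  limUnder atTop
    fun Λ : TopologicalSpace.Compacts (EuclideanSpace ℝ (Fin d)) => charFunctional z β r ν G Λ η

/-- For measures `ρ`, `μ` on `ℝ`, the constant
`sup_{y, s ∈ supp ρ} ∫_{ℝᵈ} ∫_ℝ |exp (i s α G(y - y')) - 1| dμ(α) dy'` in `[0, ∞]`. -/
noncomputable def mayerConst {d : ℕ} (G : EuclideanSpace ℝ (Fin d) → ℝ) (ρ μ : Measure ℝ) :
    ENNReal :=
  ⨆ (y : EuclideanSpace ℝ (Fin d)) (s ∈ ρ.support),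
    ∫⁻ y' : EuclideanSpace ℝ (Fin d), ∫⁻ α : ℝ,
      ‖Complex.exp (Complex.I * ((s * α * G (y - y') : ℝ) : ℂ)) - 1‖ₑ ∂μ

/-- The radius `1 / (e C)`, equal to `∞` if `C = 0`. -/
noncomputable def convRadius (C : ENNReal) : ENNReal := 1 / (ENNReal.ofReal (Real.exp 1) * C)

/-- `P` is a projective family of probability measures on the spaces `ℝ^J`, `J ⊆ ℝᵈ` finite, whose
characteristic functions are given by the functional `C`:
`∫ exp (i ∑_{x ∈ J} α_x ω_x) dP_J(ω) = C (∑_{x ∈ J} α_x δ_x)`. -/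
structure IsFiniteDimLaws {d : ℕ} (C : FiniteConfig d → ℂ)
    (P : (J : Finset (EuclideanSpace ℝ (Fin d))) → Measure (J → ℝ)) : Prop where
  isProbabilityMeasure : ∀ J, IsProbabilityMeasure (P J)
  charFun_eq : ∀ (J : Finset (EuclideanSpace ℝ (Fin d))) (α : J → ℝ),
    ∫ ω : J → ℝ, Complex.exp (Complex.I * ((∑ j, α j * ω j : ℝ) : ℂ)) ∂(P J) =
      C (∑ j : J, Finsupp.single (j : EuclideanSpace ℝ (Fin d)) (α j))
  projective : IsProjectiveMeasureFamily (ι := EuclideanSpace ℝ (Fin d)) (α := fun _ => ℝ) P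

/-! Since `v` is one minus the Fourier transform of `ν`, expanding `exp (-β V_Λ)` in `β` produces a
gas of two species: the charges of the Poisson noise, with activity `z`, and dual particles
distributed by `dx dν(α)`, with activity `β`. A charge `(y, s)` and a dual particle `(x, α)`
contribute the phase `exp (i s α G(x - y))`; equal species do not interact
(`integral_exp_interaction_eq`). The test measure `η` enters as a product of one-particle factors
equal to one on dual particles. In finite volume the characteristic functional is thus a quotient of
two entire power series in `(z, β)`, in which the prefactors `exp (-(z + β)|Λ|)` cancel.

The partition series has constant term one, so the division can be done on formal series. Write
`ρ_n(A)` for the resulting Taylor coefficients of the correlation functions and `f_p` for the phase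
factor of `p` with another particle. Removing `p` from the configuration and writing `f_p = (f_p -
1) + 1` gives the Kirkwood–Salsburg equations, in which `ρ(p ∪ A)` is, up to phases, the sum over
`k` of `k`-fold integrals of `f_p - 1` against `ρ(A ∪ {q₁, …, q_k})`, divided by factorials. As all
phases have modulus one, induction on order plus particle number gives `|ρ_n(A)| ≤ e^|A| R₀^(-n₁)
R₁^(-n₂)` once `e (R₀ ∫ |f_p - 1| dμ₀ + R₁ ∫ |f_p - 1| dμ₁) ≤ 1` (`norm_corrCoeff_le`). Each
particle interacts only with the other species, so one integral vanishes and the other is at most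
`C₁` or `C₂`: the conditions become `e R₀ C₂ ≤ 1` and `e R₁ C₁ ≤ 1`
(`kirkwoodSalsburgCondition_isAdmissible`).

The bound does not depend on `Λ`, and the same recursion with dominated convergence gives
convergence of every coefficient (`corrCoeff_sectorConvergent`). Dominated convergence of the series
then yields the limit as a power series on the polydisc, whence analyticity
(`analyticAt_bivariate`). Keeping the factor that vanishes with `g - 1` bounds the distance of the
functional from 1 by a multiple of `exp (const · ∑ |αₗ| ‖G‖₁) - 1`, whence continuity at zero.

The limits are limits of characteristic functions, so Lévy's theorem gives the finite-dimensional
laws, uniqueness of characteristic functions their consistency, and Kolmogorov's theorem the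
canonical measure. -/

/-! ### Kolmogorov extension -/

/-- Along nonempty finite intersections, cylinders over compact sets have a common point. -/
theorem exists_mem_cylinder_of_isCompact {ι : Type*} (s : ℕ → Finset ι)
    (K : ∀ n, Set (s n → ℝ)) (hK : ∀ n, IsCompact (K n)) (x : ℕ → ι → ℝ)
    (hx : ∀ n, ∀ k ≤ n, (s k).restrict (x n) ∈ K k) :
    ∃ y : ι → ℝ, ∀ k, (s k).restrict y ∈ K k := by
  classical
  have hev : ∀ k, ∀ᶠ n in (hyperfilter ℕ : Filter ℕ), (s k).restrict (x n) ∈ K k := fun k =>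
    ((eventually_ge_atTop k).mono fun n hn => hx n k hn).filter_mono
      (Nat.cofinite_eq_atTop ▸ hyperfilter_le_cofinite)
  -- One ultrafilter serves all coordinates at once, so no diagonal sequence is needed. Coordinates
  -- outside every `s k` do not matter and get the value 0.
  have hlim : ∀ i : ι, ∃ c : ℝ, (∃ k, i ∈ s k) →
      Tendsto (fun n => x n i) (hyperfilter ℕ : Filter ℕ) (𝓝 c) := by
    intro i
    by_cases h : ∃ k, i ∈ s k
    · obtain ⟨k, hk⟩ := h
      have hc : IsCompact ((fun f : s k → ℝ => f ⟨i, hk⟩) '' K k) :=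
        (hK k).image (continuous_apply _)
      obtain ⟨c, -, hc⟩ := hc.ultrafilter_le_nhds ((hyperfilter ℕ).map fun n => x n i) (by
        rw [Ultrafilter.coe_map, le_principal_iff, mem_map]
        exact (hev k).mono fun n hn => ⟨_, hn, rfl⟩)
      exact ⟨c, fun _ => hc⟩
    · exact ⟨0, fun h' => absurd h' h⟩
  choose y hy using hlim
  refine ⟨y, fun k => (hK k).isClosed.mem_of_tendsto (b := (hyperfilter ℕ : Filter ℕ))
    (f := fun n => (s k).restrict (x n)) ?_ (hev k)⟩
  exact tendsto_pi_nhds.2 fun i => hy i ⟨k, i.2⟩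

/-- The content of a projective family of probability measures on the spaces `ℝ^J` is continuous at
the empty set. -/
theorem projectiveFamilyContent_tendsto_zero {ι : Type*} {P : ∀ J : Finset ι, Measure (J → ℝ)}
    [∀ J, IsProbabilityMeasure (P J)] (hP : IsProjectiveMeasureFamily (α := fun _ : ι => ℝ) P)
    {A : ℕ → Set (ι → ℝ)} (hA : ∀ n, A n ∈ measurableCylinders fun _ : ι => ℝ)
    (hanti : Antitone A) (hempty : ⋂ n, A n = ∅) :
    Tendsto (fun n => projectiveFamilyContent hP (A n)) atTop (𝓝 0) := by
  classical
  have hring := isSetRing_measurableCylinders (α := fun _ : ι => ℝ) (mα := fun _ => inferInstance)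
  rw [ENNReal.tendsto_atTop_zero]
  intro ε hε
  by_contra! hcon
  have hlt : ∀ n, ε < projectiveFamilyContent hP (A n) := by
    intro n
    obtain ⟨m, hm, hm'⟩ := hcon n
    exact hm'.trans_le (addContent_mono hring.isSetSemiring (hA m) (hA n) (hanti hm))
  obtain ⟨δ, hδ, hδsum⟩ := ENNReal.exists_pos_sum_of_countable hε.ne' ℕ
  choose s T hT hAT using fun n => (mem_measurableCylinders (A n)).1 (hA n)
  -- Inner regularity: the total loss in passing from the bases to compact subsets stays below `ε`,
  -- hence below the content of every `A n`.
  have hKex : ∀ n, ∃ K ⊆ T n, IsCompact K ∧ P (s n) (T n \ K) < δ n := fun n =>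
    (hT n).exists_isCompact_sdiff_lt (measure_ne_top _ _) (by simpa using (hδ n).ne')
  choose K hKT hK hKδ using hKex
  have hne : ∀ n, ∃ x : ι → ℝ, ∀ k ≤ n, (s k).restrict x ∈ K k := by
    intro n
    by_contra! hno
    have hcyl : ∀ k, cylinder (s k) (T k \ K k) ∈ measurableCylinders fun _ : ι => ℝ := fun k =>
      cylinder_mem_measurableCylinders _ _ ((hT k).diff (hK k).measurableSet)
    -- A point of `A n` lies over every `T k` with `k ≤ n`; if it is not over all the `K k`, it lies
    -- over some `T k \ K k`.
    have hsub : A n ⊆ ⋃ k ∈ Finset.range (n + 1), cylinder (s k) (T k \ K k) := by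
      intro x hx
      obtain ⟨k, hk, hxk⟩ := hno x
      have hxT : x ∈ A k := hanti hk hx
      rw [hAT k] at hxT
      exact Set.mem_biUnion (Finset.mem_coe.2 (Finset.mem_range.2 (Nat.lt_succ_of_le hk)))
        ⟨hxT, hxk⟩
    have hle := (addContent_mono (m := projectiveFamilyContent hP) hring.isSetSemiring (hA n)
      (hring.biUnion_mem _ fun k _ => hcyl k) hsub).trans
      (addContent_biUnion_le hring fun k _ => hcyl k)
    refine absurd (hlt n) (not_lt.2 (hle.trans ?_))
    calc ∑ k ∈ Finset.range (n + 1), projectiveFamilyContent hP (cylinder (s k) (T k \ K k))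
        ≤ ∑ k ∈ Finset.range (n + 1), (δ k : ENNReal) := by
          refine Finset.sum_le_sum fun k _ => ?_
          rw [projectiveFamilyContent_cylinder hP ((hT k).diff (hK k).measurableSet)]
          exact (hKδ k).le
      _ ≤ ∑' k, (δ k : ENNReal) := ENNReal.sum_le_tsum _
      _ ≤ ε := hδsum.le
  choose x hx using hne
  obtain ⟨y, hy⟩ := exists_mem_cylinder_of_isCompact s K hK x hx
  have : y ∈ ⋂ n, A n := Set.mem_iInter.2 fun n => by
    rw [hAT n]; exact hKT n (hy n)
  simp [hempty] at this

/-- **Kolmogorov's extension theorem** for real-valued processes. -/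
theorem exists_isProjectiveLimit {ι : Type*} {P : ∀ J : Finset ι, Measure (J → ℝ)}
    [∀ J, IsProbabilityMeasure (P J)] (hP : IsProjectiveMeasureFamily (α := fun _ : ι => ℝ) P) :
    ∃ μ : Measure (ι → ℝ), IsProjectiveLimit (α := fun _ : ι => ℝ) μ P := by
  have hring := isSetRing_measurableCylinders (α := fun _ : ι => ℝ) (mα := fun _ => inferInstance)
  have hsub : (projectiveFamilyContent hP).IsSigmaSubadditive :=
    isSigmaSubadditive_of_addContent_iUnion_eq_tsum hring fun f hf hfU hd =>
      addContent_iUnion_eq_sum_of_tendsto_zero hring _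
        (fun _ _ => projectiveFamilyContent_ne_top hP)
        (fun _ hs hanti he => projectiveFamilyContent_tendsto_zero hP hs hanti he) hf hfU hd
  refine ⟨(projectiveFamilyContent hP).measure isSetSemiring_measurableCylinders
    generateFrom_measurableCylinders.ge hsub, fun I => ?_⟩
  ext t ht
  rw [Measure.map_apply (Finset.measurable_restrict I) ht, AddContent.measure_eq,
    ← cylinder, projectiveFamilyContent_cylinder hP ht]
  · exact generateFrom_measurableCylinders.symm
  · exact cylinder_mem_measurableCylinders _ _ ht

/-! ### Lévy continuity -/

/-- **Lévy's continuity theorem**: a pointwise limit of characteristic functions of probability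
measures that is continuous at zero is the characteristic function of a probability measure. -/
theorem exists_charFun_eq_of_tendsto {E : Type*} [NormedAddCommGroup E] [InnerProductSpace ℝ E]
    [FiniteDimensional ℝ E] [MeasurableSpace E] [BorelSpace E] (μ : ℕ → ProbabilityMeasure E)
    {f : E → ℂ} (hf : ContinuousAt f 0)
    (h : ∀ t, Tendsto (fun n => charFun (μ n : Measure E) t) atTop (𝓝 (f t))) :
    ∃ μ₀ : ProbabilityMeasure E, charFun (μ₀ : Measure E) = f := by
  -- Tightness makes the closure of the sequence compact. A limit along one ultrafilter is enough,
  -- because the characteristic functions converge along the full sequence.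
  have htight := isTightMeasureSet_of_tendsto_charFun hf h
  have hcomp : IsCompact (closure (Set.range μ)) :=
    isCompact_closure_of_isTightMeasureSet (by convert htight using 1; ext; simp)
  obtain ⟨μ₀, -, hμ₀⟩ := hcomp.ultrafilter_le_nhds ((hyperfilter ℕ).map μ) (by
    rw [le_principal_iff]
    exact Ultrafilter.mem_map.2 (Filter.univ_mem' fun n => subset_closure ⟨n, rfl⟩))
  refine ⟨μ₀, funext fun t => ?_⟩
  have h1 : Tendsto μ (hyperfilter ℕ : Filter ℕ) (𝓝 μ₀) := hμ₀
  rw [ProbabilityMeasure.tendsto_iff_forall_integral_rclike_tendsto ℂ] at h1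
  have h2 := h1 (BoundedContinuousFunction.innerProbChar t)
  simp_rw [← charFun_eq_integral_innerProbChar] at h2
  exact tendsto_nhds_unique h2 ((h t).mono_left (Nat.cofinite_eq_atTop ▸ hyperfilter_le_cofinite))

/-! ### Convolution of double sequences and formal inverses -/

/-- The antidiagonal of a product of monoids, componentwise. -/
instance Prod.instHasAntidiagonalProd {A B : Type*} [AddMonoid A] [AddMonoid B]
    [Finset.HasAntidiagonal A] [Finset.HasAntidiagonal B] : Finset.HasAntidiagonal (A × B) where
  antidiagonal n := (Finset.HasAntidiagonal.antidiagonal n.1 ×ˢ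
    Finset.HasAntidiagonal.antidiagonal n.2).map
    (Equiv.prodProdProdComm A A B B).toEmbedding
  mem_antidiagonal := by
    rintro ⟨a, b⟩ ⟨⟨a₁, b₁⟩, ⟨a₂, b₂⟩⟩
    simp only [Finset.mem_map_equiv, Equiv.prodProdProdComm_symm,
      Equiv.prodProdProdComm_apply, Finset.mem_product, Finset.HasAntidiagonal.mem_antidiagonal,
      Prod.mk_add_mk,
      Prod.mk.injEq]

theorem sum_antidiagonal_prod {M : Type*} [AddCommMonoid M] (n : ℕ × ℕ)
    (f : (ℕ × ℕ) × (ℕ × ℕ) → M) :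
    ∑ x ∈ Finset.HasAntidiagonal.antidiagonal n, f x =
      ∑ x ∈ Finset.HasAntidiagonal.antidiagonal n.1, ∑ y ∈ Finset.HasAntidiagonal.antidiagonal n.2,
        f ((x.1, y.1), (x.2, y.2)) := by
  change ∑ x ∈ Finset.map _ _, f x = _
  rw [Finset.sum_map, Finset.sum_product]
  rfl

/-- Both sides run over all decompositions of `n` into three summands. This moves the formal factor
`U` past the binomial expansion in the Kirkwood–Salsburg equations. -/
theorem sum_antidiagonal_left_comm {A M : Type*} [AddCommMonoid A] [AddCommMonoid M]
    [Finset.HasAntidiagonal A] (n : A) (f : A → A → A → M) :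
    ∑ x ∈ Finset.HasAntidiagonal.antidiagonal n,
      ∑ y ∈ Finset.HasAntidiagonal.antidiagonal x.2, f x.1 y.1 y.2 =
    ∑ x ∈ Finset.HasAntidiagonal.antidiagonal n,
      ∑ y ∈ Finset.HasAntidiagonal.antidiagonal x.2, f y.1 x.1 y.2 := by
  rw [Finset.sum_sigma', Finset.sum_sigma']
  refine Finset.sum_nbij' (fun z => ⟨(z.2.1, z.1.1 + z.2.2), (z.1.1, z.2.2)⟩)
    (fun z => ⟨(z.2.1, z.1.1 + z.2.2), (z.1.1, z.2.2)⟩) ?_ ?_ ?_ ?_ ?_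
  · rintro ⟨⟨a, b⟩, ⟨c, d⟩⟩ h
    simp only [Finset.mem_sigma, Finset.HasAntidiagonal.mem_antidiagonal] at h ⊢
    exact ⟨by rw [← h.1, ← h.2, add_left_comm], trivial⟩
  · rintro ⟨⟨a, b⟩, ⟨c, d⟩⟩ h
    simp only [Finset.mem_sigma, Finset.HasAntidiagonal.mem_antidiagonal] at h ⊢
    exact ⟨by rw [← h.1, ← h.2, add_left_comm], trivial⟩
  · rintro ⟨⟨a, b⟩, ⟨c, d⟩⟩ h
    simp only [Finset.mem_sigma, Finset.HasAntidiagonal.mem_antidiagonal] at h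
    simp [h.2]
  · rintro ⟨⟨a, b⟩, ⟨c, d⟩⟩ h
    simp only [Finset.mem_sigma, Finset.HasAntidiagonal.mem_antidiagonal] at h
    simp [h.2]
  · rintro ⟨⟨a, b⟩, ⟨c, d⟩⟩ h
    rfl

/-- Inverse of a formal power series in two variables with constant coefficient one. -/
theorem exists_antidiagonal_inverse (a : ℕ × ℕ → ℂ) (ha : a 0 = 1) :
    ∃ U : ℕ × ℕ → ℂ, ∀ n, ∑ x ∈ Finset.HasAntidiagonal.antidiagonal n,
      U x.1 * a x.2 = if n = 0 then 1 else 0 := by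
  -- A series in the first variable whose coefficients are series in the second; it is a unit as
  -- soon as its doubly constant coefficient is.
  let s : PowerSeries (PowerSeries ℂ) := PowerSeries.mk fun i => PowerSeries.mk fun j => a (i, j)
  have hs : IsUnit s := by
    rw [PowerSeries.isUnit_iff_constantCoeff, PowerSeries.isUnit_iff_constantCoeff]
    have : PowerSeries.constantCoeff (PowerSeries.constantCoeff s) = a 0 := by
      simp [s, ← PowerSeries.coeff_zero_eq_constantCoeff_apply]
      rfl
    rw [this, ha]
    exact isUnit_one
  obtain ⟨u, hu⟩ := hs.exists_left_inv
  refine ⟨fun n => PowerSeries.coeff n.2 (PowerSeries.coeff n.1 u), fun n => ?_⟩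
  have h := congrArg (fun t => PowerSeries.coeff n.2 (PowerSeries.coeff n.1 t)) hu
  simp only [PowerSeries.coeff_mul, map_sum] at h
  rw [sum_antidiagonal_prod]
  refine Eq.trans ?_ (h.trans ?_)
  · refine Finset.sum_congr rfl fun x _ => Finset.sum_congr rfl fun y _ => ?_
    simp [s]
  · obtain ⟨i, j⟩ := n
    by_cases hi : i = 0 <;> by_cases hj : j = 0 <;> simp [PowerSeries.coeff_one, hi, hj]

/-! ### Divided powers of commuting operators -/

section DividedPower

variable {R : Type*} [Ring R] [Algebra ℂ R]

/-- The divided power `T ^ n / n!`. -/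
noncomputable def divPow (T : R) (n : ℕ) : R := ((n.factorial : ℂ)⁻¹) • T ^ n

@[simp] theorem divPow_zero (T : R) : divPow T 0 = 1 := by simp [divPow]

/-- The binomial theorem: the factorials absorb the binomial coefficients and leave a plain
convolution. -/
theorem divPow_add {T U : R} (h : Commute T U) (n : ℕ) :
    divPow (T + U) n =
      ∑ x ∈ Finset.HasAntidiagonal.antidiagonal n, divPow T x.1 * divPow U x.2 := by
  simp only [divPow]
  rw [h.add_pow', Finset.smul_sum]
  refine Finset.sum_congr rfl fun x hx => ?_
  obtain rfl := Finset.HasAntidiagonal.mem_antidiagonal.1 hx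
  rw [smul_mul_smul_comm, ← Nat.cast_smul_eq_nsmul ℂ, smul_smul]
  congr 1
  have := Nat.add_choose_mul_factorial_mul_factorial x.1 x.2
  have h' : ((x.1 + x.2).choose x.1 : ℂ) * x.1.factorial * x.2.factorial =
      (x.1 + x.2).factorial := by
    rw [Nat.choose_symm_add]; exact_mod_cast this
  have h1 : (x.1.factorial : ℂ) ≠ 0 := by exact_mod_cast x.1.factorial_ne_zero
  have h2 : (x.2.factorial : ℂ) ≠ 0 := by exact_mod_cast x.2.factorial_ne_zero
  have h3 : ((x.1 + x.2).factorial : ℂ) ≠ 0 := by exact_mod_cast (x.1 + x.2).factorial_ne_zero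
  field_simp
  linear_combination h'

theorem Commute.divPow_divPow {T U : R} (h : Commute T U) (m n : ℕ) :
    Commute (divPow T m) (divPow U n) :=
  ((h.pow_pow m n).smul_left _).smul_right _

theorem SemiconjBy.divPow_right {M T U : R} (h : SemiconjBy M T U) (n : ℕ) :
    SemiconjBy M (divPow T n) (divPow U n) := by
  have := h.pow_right n
  simp only [SemiconjBy, divPow] at this ⊢
  rw [mul_smul_comm, this, smul_mul_assoc]

end DividedPower

theorem coe_ofFn_cons {S : Type*} {n : ℕ} (q : S) (v : Fin n → S) :
    ((List.ofFn (Fin.cons q v : Fin (n + 1) → S) : List S) : Multiset S) =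
      q ::ₘ (List.ofFn v : List S) := by
  rw [List.ofFn_succ]; simp

theorem Multiset.exists_ofFn {S : Type*} (A : Multiset S) :
    ∃ (n : ℕ) (v : Fin n → S), A = (List.ofFn v : List S) := by
  induction A using Quotient.inductionOn with
  | h l => exact ⟨l.length, l.get, by simp⟩

/-! ### Operators on functions of finite configurations -/

section ConfigurationSpace

variable {S : Type*} [MeasurableSpace S]

/-- Bounded measurable functions on the one-particle space. -/
def bddMeas (S : Type*) [MeasurableSpace S] : Subalgebra ℂ (S → ℂ) where
  carrier := {w | Measurable w ∧ ∃ C, ∀ q, ‖w q‖ ≤ C}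
  mul_mem' := by
    rintro w w' ⟨hw, C, hC⟩ ⟨hw', C', hC'⟩
    refine ⟨hw.mul hw', C * C', fun q => ?_⟩
    rw [Pi.mul_apply, norm_mul]
    exact mul_le_mul (hC q) (hC' q) (norm_nonneg _) ((norm_nonneg _).trans (hC q))
  add_mem' := by
    rintro w w' ⟨hw, C, hC⟩ ⟨hw', C', hC'⟩
    exact ⟨hw.add hw', C + C', fun q => (norm_add_le _ _).trans (add_le_add (hC q) (hC' q))⟩
  algebraMap_mem' c := ⟨measurable_const, ‖c‖, fun q => le_rfl⟩

/-- Functions of finite configurations that are measurable and bounded for each particle number. -/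
def configFun (S : Type*) [MeasurableSpace S] : Submodule ℂ (Multiset S → ℂ) where
  carrier := {F | (∀ n, Measurable fun v : Fin n → S => F (List.ofFn v)) ∧
    ∀ n, ∃ C, ∀ A, Multiset.card A = n → ‖F A‖ ≤ C}
  add_mem' := by
    rintro F F' ⟨hF, hC⟩ ⟨hF', hC'⟩
    refine ⟨fun n => (hF n).add (hF' n), fun n => ?_⟩
    obtain ⟨C, hC⟩ := hC n
    obtain ⟨C', hC'⟩ := hC' n
    exact ⟨C + C', fun A hA => (norm_add_le _ _).trans (add_le_add (hC A hA) (hC' A hA))⟩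
  zero_mem' := ⟨fun n => measurable_const, fun n => ⟨0, fun A _ => by simp⟩⟩
  smul_mem' := by
    rintro c F ⟨hF, hC⟩
    refine ⟨fun n => (hF n).const_mul c, fun n => ?_⟩
    obtain ⟨C, hC⟩ := hC n
    refine ⟨‖c‖ * C, fun A hA => ?_⟩
    rw [Pi.smul_apply, norm_smul]
    exact mul_le_mul_of_nonneg_left (hC A hA) (norm_nonneg _)

theorem measurable_finCons {α : Type*} [MeasurableSpace α] {n : ℕ} {f : α → S}
    {g : α → Fin n → S} (hf : Measurable f) (hg : Measurable g) :
    Measurable fun x => (Fin.cons (f x) (g x) : Fin (n + 1) → S) := by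
  refine measurable_pi_lambda _ fun i => ?_
  refine Fin.cases ?_ (fun j => ?_) i
  · simpa using hf
  · simpa using (measurable_pi_iff.1 hg) j

theorem configFun.measurable_cons (F : configFun S) {α : Type*} [MeasurableSpace α] {n : ℕ}
    {f : α → S} {g : α → Fin n → S} (hf : Measurable f) (hg : Measurable g) :
    Measurable fun x => F.1 (f x ::ₘ (List.ofFn (g x) : List S)) := by
  have h := (F.2.1 (n + 1)).comp (measurable_finCons hf hg)
  simpa only [Function.comp_def, coe_ofFn_cons] using h

theorem configFun.integrable (F : configFun S) (μ : Measure S) [IsFiniteMeasure μ]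
    (w : bddMeas S) (A : Multiset S) : Integrable (fun q => w.1 q * F.1 (q ::ₘ A)) μ := by
  obtain ⟨n, v, rfl⟩ := A.exists_ofFn
  obtain ⟨C, hC⟩ := F.2.2 (n + 1)
  obtain ⟨C', hC'⟩ := w.2.2
  refine Integrable.of_bound (C := C' * C)
    (w.2.1.mul (configFun.measurable_cons F measurable_id measurable_const)).aestronglyMeasurable
    (.of_forall fun q => ?_)
  rw [norm_mul]
  exact mul_le_mul (hC' q) (hC _ (by simp)) (norm_nonneg _) ((norm_nonneg _).trans (hC' q))

/-- The annihilation operator `(J F)(A) = ∫ w(q) F(A ∪ {q}) dμ(q)`. -/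
noncomputable def annihilation (μ : Measure S) [IsFiniteMeasure μ] (w : bddMeas S) :
    Module.End ℂ (configFun S) where
  toFun F := ⟨fun A => ∫ q, w.1 q * F.1 (q ::ₘ A) ∂μ, by
    constructor
    · intro n
      have hm : Measurable fun x : (Fin n → S) × S =>
          w.1 x.2 * F.1 (x.2 ::ₘ (List.ofFn x.1 : List S)) :=
        (w.2.1.comp measurable_snd).mul (configFun.measurable_cons F measurable_snd measurable_fst)
      exact hm.stronglyMeasurable.integral_prod_right'.measurable
    · intro n
      obtain ⟨C, hC⟩ := F.2.2 (n + 1)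
      obtain ⟨C', hC'⟩ := w.2.2
      refine ⟨(C' * C) * μ.real Set.univ, fun A hA => norm_integral_le_of_norm_le_const
        (.of_forall fun q => ?_)⟩
      rw [norm_mul]
      exact mul_le_mul (hC' q) (hC _ (by simp [hA])) (norm_nonneg _)
        ((norm_nonneg _).trans (hC' q))⟩
  map_add' F F' := by
    ext A
    simp only [Submodule.coe_add, Pi.add_apply, mul_add]
    exact integral_add (configFun.integrable F μ w A) (configFun.integrable F' μ w A)
  map_smul' c F := by
    ext A
    simp only [SetLike.val_smul, Pi.smul_apply, smul_eq_mul, RingHom.id_apply]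
    rw [← integral_const_mul]
    congr 1; ext q; ring

theorem annihilation_apply (μ : Measure S) [IsFiniteMeasure μ] (w : bddMeas S) (F : configFun S)
    (A : Multiset S) : (annihilation μ w F).1 A = ∫ q, w.1 q * F.1 (q ::ₘ A) ∂μ := rfl

theorem annihilation_add (μ : Measure S) [IsFiniteMeasure μ] (w w' : bddMeas S) :
    annihilation μ (w + w') = annihilation μ w + annihilation μ w' := by
  ext F A
  simp only [annihilation_apply, LinearMap.add_apply, Submodule.coe_add, Pi.add_apply]
  rw [← integral_add (configFun.integrable F μ w A) (configFun.integrable F μ w' A)]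
  congr 1; ext q; simp [add_mul]

/-- Fubini for the two added particles and the symmetry of functions of multisets. Boundedness on
the sector with two more particles supplies integrability. -/
theorem annihilation_commute (μ μ' : Measure S) [IsFiniteMeasure μ] [IsFiniteMeasure μ']
    (w w' : bddMeas S) : Commute (annihilation μ w) (annihilation μ' w') := by
  refine LinearMap.ext fun F => Subtype.ext (funext fun A => ?_)
  simp only [Module.End.mul_apply, annihilation_apply, ← integral_const_mul]
  obtain ⟨n, v, rfl⟩ := A.exists_ofFn
  rw [integral_integral_swap]
  · congr 1; ext q; congr 1; ext q'
    rw [Multiset.cons_swap]; ring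
  · obtain ⟨C, hC⟩ := F.2.2 (n + 2)
    obtain ⟨C', hC'⟩ := w.2.2
    obtain ⟨C'', hC''⟩ := w'.2.2
    refine Integrable.of_bound (C := C' * (C'' * C)) ?_ (.of_forall fun x => ?_)
    · refine Measurable.aestronglyMeasurable ?_
      have h := configFun.measurable_cons F (f := fun x : S × S => x.2)
        (g := fun x : S × S => (Fin.cons x.1 v : Fin (n + 1) → S)) measurable_snd
        (measurable_finCons measurable_fst measurable_const)
      simp only [coe_ofFn_cons] at h
      exact (w.2.1.comp measurable_fst).mul ((w'.2.1.comp measurable_snd).mul h)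
    · have h0 : 0 ≤ C'' := (norm_nonneg _).trans (hC'' x.2)
      simp only [Function.uncurry, norm_mul]
      refine mul_le_mul (hC' _) (mul_le_mul (hC'' _) (hC _ (by simp)) (norm_nonneg _) h0)
        (by positivity) ((norm_nonneg _).trans (hC' x.1))

/-- Multiplication by the multiplicative functional `A ↦ ∏_{q ∈ A} g(q)`. -/
noncomputable def mulProd (g : bddMeas S) : Module.End ℂ (configFun S) where
  toFun F := ⟨fun A => (A.map g.1).prod * F.1 A, by
    constructor
    · intro n
      refine Measurable.mul ?_ (F.2.1 n)
      simp only [Multiset.map_coe, Multiset.prod_coe, List.map_ofFn, List.prod_ofFn]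
      exact Finset.measurable_fun_prod _ fun i _ => g.2.1.comp (measurable_pi_apply i)
    · intro n
      obtain ⟨C, hC⟩ := F.2.2 n
      obtain ⟨C', hC'⟩ := g.2.2
      have hp : ∀ A : Multiset S, ‖(A.map g.1).prod‖ ≤ (max C' 0) ^ Multiset.card A := by
        intro A
        induction A using Multiset.induction with
        | empty => simp
        | cons q A ih =>
          rw [Multiset.map_cons, Multiset.prod_cons, norm_mul, Multiset.card_cons, pow_succ']
          exact mul_le_mul ((hC' q).trans (le_max_left _ _)) ih (norm_nonneg _)
            (le_max_right _ _)
      refine ⟨(max C' 0) ^ n * C, fun A hA => ?_⟩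
      rw [norm_mul]
      exact mul_le_mul (hA ▸ hp A) (hC A hA) (norm_nonneg _) (by positivity)⟩
  map_add' F F' := by ext A; simp [mul_add]
  map_smul' c F := by ext A; simp [mul_left_comm]

theorem mulProd_apply (g : bddMeas S) (F : configFun S) (A : Multiset S) :
    (mulProd g F).1 A = (A.map g.1).prod * F.1 A := rfl

/-- The product over the enlarged configuration has the extra factor `g q`, which is absorbed into
the weight of the integrated particle. -/
theorem mulProd_semiconjBy (μ : Measure S) [IsFiniteMeasure μ] (g w : bddMeas S) :
    SemiconjBy (mulProd g) (annihilation μ (w * g)) (annihilation μ w) := by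
  refine LinearMap.ext fun F => Subtype.ext (funext fun A => ?_)
  simp only [Module.End.mul_apply, annihilation_apply, mulProd_apply, ← integral_const_mul]
  congr 1; ext q
  simp only [Multiset.map_cons, Multiset.prod_cons, MulMemClass.coe_mul, Pi.mul_apply]
  ring

/-- Adding a fixed particle to the configuration. -/
def addParticle (p : S) : Module.End ℂ (configFun S) where
  toFun F := ⟨fun A => F.1 (p ::ₘ A), by
    refine ⟨fun n => configFun.measurable_cons F measurable_const measurable_id, fun n => ?_⟩
    obtain ⟨C, hC⟩ := F.2.2 (n + 1)
    exact ⟨C, fun A hA => hC _ (by simp [hA])⟩⟩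
  map_add' F F' := rfl
  map_smul' c F := rfl

theorem addParticle_apply (p : S) (F : configFun S) (A : Multiset S) :
    (addParticle p F).1 A = F.1 (p ::ₘ A) := rfl

theorem addParticle_commute (μ : Measure S) [IsFiniteMeasure μ] (w : bddMeas S) (p : S) :
    Commute (addParticle p) (annihilation μ w) := by
  refine LinearMap.ext fun F => Subtype.ext (funext fun A => ?_)
  simp only [Module.End.mul_apply, annihilation_apply, addParticle_apply]
  congr 1; ext q
  rw [Multiset.cons_swap]

/-- The product of divided powers of annihilation operators for two particle species. -/
noncomputable def annPow (μ₀ μ₁ : Measure S) [IsFiniteMeasure μ₀] [IsFiniteMeasure μ₁]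
    (w : bddMeas S) (n : ℕ × ℕ) : Module.End ℂ (configFun S) :=
  divPow (annihilation μ₀ w) n.1 * divPow (annihilation μ₁ w) n.2

variable (μ₀ μ₁ : Measure S) [IsFiniteMeasure μ₀] [IsFiniteMeasure μ₁]

@[simp] theorem annPow_zero (w : bddMeas S) : annPow μ₀ μ₁ w 0 = 1 := by simp [annPow]

theorem annPow_add (w w' : bddMeas S) (n : ℕ × ℕ) :
    annPow μ₀ μ₁ (w + w') n =
      ∑ x ∈ Finset.HasAntidiagonal.antidiagonal n, annPow μ₀ μ₁ w x.1 * annPow μ₀ μ₁ w' x.2 := by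
  rw [sum_antidiagonal_prod]
  simp only [annPow]
  rw [annihilation_add, annihilation_add, divPow_add (annihilation_commute _ _ _ _),
    divPow_add (annihilation_commute _ _ _ _), Finset.sum_mul_sum]
  refine Finset.sum_congr rfl fun x _ => Finset.sum_congr rfl fun y _ => ?_
  exact ((annihilation_commute μ₁ μ₀ w w').divPow_divPow y.1 x.2).symm.mul_mul_mul_comm _ _

/-- After the product has passed the integrations, each integrated particle carries `g = (g - 1) +
1`. The splitting isolates `g - 1`, the part that can be integrable over infinite volume. -/
theorem annPow_mul_mulProd (g : bddMeas S) (n : ℕ × ℕ) :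
    annPow μ₀ μ₁ 1 n * mulProd g = mulProd g *
      ∑ x ∈ Finset.HasAntidiagonal.antidiagonal n,
        annPow μ₀ μ₁ (g - 1) x.1 * annPow μ₀ μ₁ 1 x.2 := by
  rw [← annPow_add, sub_add_cancel]
  have h : ∀ (μ : Measure S) [IsFiniteMeasure μ],
      SemiconjBy (mulProd g) (annihilation μ g) (annihilation μ 1) := fun μ _ => by
    simpa using mulProd_semiconjBy μ g 1
  exact (((h μ₀).divPow_right n.1).mul_right ((h μ₁).divPow_right n.2)).eq.symm

theorem addParticle_commute_annPow (w : bddMeas S) (p : S) (n : ℕ × ℕ) :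
    Commute (addParticle p) (annPow μ₀ μ₁ w n) := by
  have h : ∀ (μ : Measure S) [IsFiniteMeasure μ] (n : ℕ),
      Commute (addParticle p) (divPow (annihilation μ w) n) := fun μ _ n =>
    ((addParticle_commute μ w p).pow_right n).smul_right _
  exact (h μ₀ n.1).mul_right (h μ₁ n.2)

/-- Coefficients of the grand canonical sums, multiplied by a formal power series `U`. -/
noncomputable def normAnnPow (U : ℕ × ℕ → ℂ) (n : ℕ × ℕ) : Module.End ℂ (configFun S) :=
  ∑ x ∈ Finset.HasAntidiagonal.antidiagonal n, U x.1 • annPow μ₀ μ₁ 1 x.2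

/-- The operator form of the **Kirkwood–Salsburg equations**. -/
theorem normAnnPow_mul_mulProd (U : ℕ × ℕ → ℂ) (g : bddMeas S) (n : ℕ × ℕ) :
    normAnnPow μ₀ μ₁ U n * mulProd g = mulProd g *
      ∑ x ∈ Finset.HasAntidiagonal.antidiagonal n,
        annPow μ₀ μ₁ (g - 1) x.1 * normAnnPow μ₀ μ₁ U x.2 := by
  simp only [normAnnPow, Finset.sum_mul, smul_mul_assoc, annPow_mul_mulProd, Finset.mul_sum,
    Finset.smul_sum, mul_smul_comm]
  exact sum_antidiagonal_left_comm n fun a b c =>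
    U a • (mulProd g * (annPow μ₀ μ₁ (g - 1) b * annPow μ₀ μ₁ 1 c))

theorem addParticle_commute_normAnnPow (U : ℕ × ℕ → ℂ) (p : S) (n : ℕ × ℕ) :
    Commute (addParticle p) (normAnnPow μ₀ μ₁ U n) :=
  Commute.sum_right _ _ _ fun x _ => (addParticle_commute_annPow μ₀ μ₁ 1 p x.2).smul_right _

end ConfigurationSpace

theorem norm_prod_map_eq_one {S : Type*} {g : S → ℂ} (hg : ∀ q, ‖g q‖ = 1) (A : Multiset S) :
    ‖(A.map g).prod‖ = 1 := by
  induction A using Multiset.induction with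
  | empty => simp
  | cons q A ih => rw [Multiset.map_cons, Multiset.prod_cons, norm_mul, ih, hg, one_mul]

/-! ### Weights of modulus one -/

section GibbsWeight

variable {S : Type*} [MeasurableSpace S]

theorem Complex.norm_exp_I_mul_ofReal' (x : ℝ) : ‖Complex.exp (Complex.I * x)‖ = 1 := by
  rw [mul_comm, Complex.norm_exp_ofReal_mul_I]

/-- The Boltzmann weight `exp (i ∑_{p, q ∈ A} κ(p, q))` of a configuration with imaginary pair
interaction. -/
noncomputable def phaseWeight (κ : S → S → ℝ) (hκ : Measurable (Function.uncurry κ)) :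
    configFun S :=
  ⟨fun A => Complex.exp (Complex.I * ((A.map fun p => (A.map fun q => κ p q).sum).sum : ℝ)), by
    constructor
    · intro n
      simp only [Multiset.map_coe, Multiset.sum_coe, List.map_ofFn, List.sum_ofFn,
        Function.comp_apply]
      refine Complex.measurable_exp.comp (measurable_const.mul
        (Complex.measurable_ofReal.comp ?_))
      refine Finset.measurable_fun_sum _ fun i _ => Finset.measurable_fun_sum _ fun j _ => ?_
      change Measurable fun v : Fin n → S => Function.uncurry κ (v i, v j)
      exact hκ.comp ((measurable_pi_apply i).prodMk (measurable_pi_apply j))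
    · exact fun n => ⟨1, fun A _ => (Complex.norm_exp_I_mul_ofReal' _).le⟩⟩

/-- The Boltzmann factor of a particle `p` with another particle, as function of the latter. -/
noncomputable def pairFactor (κ : S → S → ℝ) (hκ : Measurable (Function.uncurry κ)) (p : S) :
    bddMeas S :=
  ⟨fun q => Complex.exp (Complex.I * (κ p q + κ q p : ℝ)), by
    constructor
    · refine Complex.measurable_exp.comp (measurable_const.mul
        (Complex.measurable_ofReal.comp (Measurable.add ?_ ?_)))
      · exact hκ.comp (measurable_const.prodMk measurable_id)
      · exact hκ.comp (measurable_id.prodMk measurable_const)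
    · exact ⟨1, fun q => (Complex.norm_exp_I_mul_ofReal' _).le⟩⟩

variable (κ : S → S → ℝ) (hκ : Measurable (Function.uncurry κ))

/-- The double sum splits into the diagonal term at `p`, the row and column of `p`, which form
`pairFactor`, and the double sum over `A`. -/
theorem phaseWeight_cons (p : S) (A : Multiset S) :
    (phaseWeight κ hκ).1 (p ::ₘ A) = Complex.exp (Complex.I * κ p p) *
      ((A.map (pairFactor κ hκ p).1).prod * (phaseWeight κ hκ).1 A) := by
  have hprod : (A.map (pairFactor κ hκ p).1).prod =
      Complex.exp (Complex.I * ((A.map fun q => κ p q + κ q p).sum : ℝ)) := by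
    induction A using Multiset.induction with
    | empty => simp
    | cons q A ih =>
      rw [Multiset.map_cons, Multiset.prod_cons, ih, Multiset.map_cons, Multiset.sum_cons,
        Complex.ofReal_add, mul_add, Complex.exp_add]
      rfl
  rw [hprod]
  simp only [phaseWeight, ← Complex.exp_add, ← mul_add, ← Complex.ofReal_add]
  congr 3
  simp only [Multiset.map_cons, Multiset.sum_cons, Multiset.sum_map_add]
  ring

theorem phaseWeight_empty : (phaseWeight κ hκ).1 0 = 1 := by simp [phaseWeight]

theorem addParticle_phaseWeight (p : S) :
    addParticle p (phaseWeight κ hκ) = Complex.exp (Complex.I * κ p p) •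
      mulProd (pairFactor κ hκ p) (phaseWeight κ hκ) :=
  Subtype.ext (funext fun A => phaseWeight_cons κ hκ p A)

theorem norm_pairFactor (p q : S) : ‖(pairFactor κ hκ p).1 q‖ = 1 :=
  Complex.norm_exp_I_mul_ofReal' _

end GibbsWeight

/-! ### Kirkwood–Salsburg bounds -/

section Bounds

variable {S : Type*} [MeasurableSpace S]

/-- The predicate `P` is carried along because the Mayer constants take suprema only over the
supports of the charge laws; almost every integrated particle satisfies it. -/
theorem norm_annihilation_le (μ : Measure S) [IsFiniteMeasure μ] (w : bddMeas S)
    (P : S → Prop) (hP : ∀ᵐ q ∂μ, P q) (F : configFun S) {C : ℝ} {N : ℕ}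
    (hF : ∀ A, (∀ q ∈ A, P q) → Multiset.card A = N + 1 → ‖F.1 A‖ ≤ C)
    {A : Multiset S} (hA : ∀ q ∈ A, P q) (hN : Multiset.card A = N) :
    ‖(annihilation μ w F).1 A‖ ≤ (∫ q, ‖w.1 q‖ ∂μ) * C := by
  rw [annihilation_apply, ← integral_mul_const]
  obtain ⟨C', hC'⟩ := w.2.2
  refine norm_integral_le_of_norm_le (Integrable.mul_const ?_ _) ?_
  · exact (Integrable.of_bound w.2.1.aestronglyMeasurable C' (.of_forall hC')).norm
  · filter_upwards [hP] with q hq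
    rw [norm_mul]
    refine mul_le_mul_of_nonneg_left (hF _ ?_ (by simp [hN])) (norm_nonneg _)
    simpa [hq] using hA

theorem norm_divPow_annihilation_le (μ : Measure S) [IsFiniteMeasure μ] (w : bddMeas S)
    (P : S → Prop) (hP : ∀ᵐ q ∂μ, P q) (k : ℕ) (F : configFun S) {C : ℝ} {N : ℕ}
    (hF : ∀ A, (∀ q ∈ A, P q) → Multiset.card A = N + k → ‖F.1 A‖ ≤ C)
    {A : Multiset S} (hA : ∀ q ∈ A, P q) (hN : Multiset.card A = N) :
    ‖(divPow (annihilation μ w) k F).1 A‖ ≤ (∫ q, ‖w.1 q‖ ∂μ) ^ k / k.factorial * C := by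
  have h : ∀ (k : ℕ) (F : configFun S) (C : ℝ),
      (∀ A, (∀ q ∈ A, P q) → Multiset.card A = N + k → ‖F.1 A‖ ≤ C) →
      ‖((annihilation μ w ^ k) F).1 A‖ ≤ (∫ q, ‖w.1 q‖ ∂μ) ^ k * C := by
    intro k
    induction k with
    | zero => intro F C hF; simpa using hF A hA hN
    | succ k ih =>
      intro F C hF
      rw [pow_succ, Module.End.mul_apply, pow_succ, mul_assoc]
      exact ih _ _ fun B hB hBN => norm_annihilation_le μ w P hP F hF hB hBN
  have h1 := h k F C hF
  rw [divPow, LinearMap.smul_apply, SetLike.val_smul, Pi.smul_apply, norm_smul, norm_inv,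
    Complex.norm_natCast, div_eq_inv_mul, mul_assoc]
  exact mul_le_mul_of_nonneg_left h1 (by positivity)

variable (μ₀ μ₁ : Measure S) [IsFiniteMeasure μ₀] [IsFiniteMeasure μ₁]

theorem norm_annPow_le (w : bddMeas S) (P : S → Prop) (hP₀ : ∀ᵐ q ∂μ₀, P q)
    (hP₁ : ∀ᵐ q ∂μ₁, P q) (k : ℕ × ℕ) (F : configFun S) {C : ℝ} {N : ℕ}
    (hF : ∀ A, (∀ q ∈ A, P q) → Multiset.card A = N + k.1 + k.2 → ‖F.1 A‖ ≤ C)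
    {A : Multiset S} (hA : ∀ q ∈ A, P q) (hN : Multiset.card A = N) :
    ‖(annPow μ₀ μ₁ w k F).1 A‖ ≤ ((∫ q, ‖w.1 q‖ ∂μ₀) ^ k.1 / k.1.factorial) *
      ((∫ q, ‖w.1 q‖ ∂μ₁) ^ k.2 / k.2.factorial * C) := by
  rw [annPow, Module.End.mul_apply]
  refine norm_divPow_annihilation_le μ₀ w P hP₀ k.1 _ (fun B hB hBN => ?_) hA hN
  exact norm_divPow_annihilation_le μ₁ w P hP₁ k.2 F hF hB hBN

/-- The factor `exp x.1` is the price of `x.1` additional particles in the correlation bound. With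
`R⁻¹ ^ n` taken out, a partial sum of the exponential series of `e R a` remains. -/
theorem sum_antidiagonal_divPow_le {a R : ℝ} (ha : 0 ≤ a) (hR : 0 < R) (n : ℕ) :
    ∑ x ∈ Finset.HasAntidiagonal.antidiagonal n,
      a ^ x.1 / x.1.factorial * (Real.exp x.1 * R⁻¹ ^ x.2) ≤
      R⁻¹ ^ n * Real.exp (Real.exp 1 * (R * a)) := by
  have h : ∀ x ∈ Finset.HasAntidiagonal.antidiagonal n,
      a ^ x.1 / x.1.factorial * (Real.exp x.1 * R⁻¹ ^ x.2) =
      R⁻¹ ^ n * ((Real.exp 1 * (R * a)) ^ x.1 / x.1.factorial) := by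
    intro x hx
    obtain rfl := Finset.HasAntidiagonal.mem_antidiagonal.1 hx
    have : Real.exp x.1 = Real.exp 1 ^ x.1 := by rw [← Real.exp_nat_mul, mul_one]
    have h1 : R⁻¹ ^ x.1 * R ^ x.1 = 1 := by rw [← mul_pow, inv_mul_cancel₀ hR.ne', one_pow]
    rw [this, mul_pow, mul_pow, pow_add]
    linear_combination
      (-(a ^ x.1 / x.1.factorial * Real.exp 1 ^ x.1 * R⁻¹ ^ x.2)) * h1
  rw [Finset.sum_congr rfl h, ← Finset.mul_sum]
  refine mul_le_mul_of_nonneg_left ?_ (by positivity)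
  rw [Finset.Nat.sum_antidiagonal_eq_sum_range_succ_mk]
  exact Real.sum_le_exp_of_nonneg (by positivity) _

theorem sum_antidiagonal_annPow_le {a₀ a₁ R₀ R₁ : ℝ} (ha₀ : 0 ≤ a₀) (ha₁ : 0 ≤ a₁) (hR₀ : 0 < R₀)
    (hR₁ : 0 < R₁) (N : ℝ) (n : ℕ × ℕ) :
    ∑ x ∈ Finset.HasAntidiagonal.antidiagonal n,
      (a₀ ^ x.1.1 / x.1.1.factorial) * (a₁ ^ x.1.2 / x.1.2.factorial *
        (Real.exp (N + x.1.1 + x.1.2) * (R₀⁻¹ ^ x.2.1 * R₁⁻¹ ^ x.2.2))) ≤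
      Real.exp N * (R₀⁻¹ ^ n.1 * R₁⁻¹ ^ n.2) *
        Real.exp (Real.exp 1 * (R₀ * a₀ + R₁ * a₁)) := by
  rw [sum_antidiagonal_prod]
  calc _ = Real.exp N * ((∑ x ∈ Finset.HasAntidiagonal.antidiagonal n.1,
        a₀ ^ x.1 / x.1.factorial * (Real.exp x.1 * R₀⁻¹ ^ x.2)) *
        ∑ x ∈ Finset.HasAntidiagonal.antidiagonal n.2,
        a₁ ^ x.1 / x.1.factorial * (Real.exp x.1 * R₁⁻¹ ^ x.2)) := by
        rw [Finset.sum_mul_sum, Finset.mul_sum]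
        refine Finset.sum_congr rfl fun x _ => ?_
        rw [Finset.mul_sum]
        refine Finset.sum_congr rfl fun y _ => ?_
        rw [Real.exp_add, Real.exp_add]
        ring
    _ ≤ Real.exp N * ((R₀⁻¹ ^ n.1 * Real.exp (Real.exp 1 * (R₀ * a₀))) *
          (R₁⁻¹ ^ n.2 * Real.exp (Real.exp 1 * (R₁ * a₁)))) := by
        refine mul_le_mul_of_nonneg_left ?_ (by positivity)
        refine mul_le_mul (sum_antidiagonal_divPow_le ha₀ hR₀ _)
          (sum_antidiagonal_divPow_le ha₁ hR₁ _) ?_ (by positivity)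
        exact Finset.sum_nonneg fun x _ => by positivity
    _ = _ := by
        rw [mul_add (Real.exp 1), Real.exp_add (Real.exp 1 * (R₀ * a₀))]
        ring

variable (κ : S → S → ℝ) (hκ : Measurable (Function.uncurry κ)) (U : ℕ × ℕ → ℂ)

/-- The Taylor coefficients in the activities of the correlation functions of the gas with
interaction `κ`; `U` is the inverse of the power series of the partition function. -/
noncomputable def corrCoeff (n : ℕ × ℕ) : configFun S :=
  normAnnPow μ₀ μ₁ U n (phaseWeight κ hκ)

/-- Taylor coefficients of the expectation of `A ↦ ∏_{q ∈ A} g(q)`. -/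
noncomputable def corrCoeffProd (g : bddMeas S) (n : ℕ × ℕ) : configFun S :=
  normAnnPow μ₀ μ₁ U n (mulProd g (phaseWeight κ hκ))

theorem corrCoeffProd_apply (g : bddMeas S) (n : ℕ × ℕ) (A : Multiset S) :
    (corrCoeffProd μ₀ μ₁ κ hκ U g n).1 A = (A.map g.1).prod *
      ∑ x ∈ Finset.HasAntidiagonal.antidiagonal n,
        (annPow μ₀ μ₁ (g - 1) x.1 (corrCoeff μ₀ μ₁ κ hκ U x.2)).1 A := by
  rw [corrCoeffProd, ← Module.End.mul_apply, normAnnPow_mul_mulProd, Module.End.mul_apply,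
    mulProd_apply, LinearMap.sum_apply]
  congr 1
  rw [Submodule.coe_sum, Finset.sum_apply]
  rfl

/-- Adding `p` commutes with all integrations and acts on the weight as a multiplicative functional.
Combined with `corrCoeffProd_apply` this is the Kirkwood–Salsburg equation for `p ∪ A`. -/
theorem corrCoeff_cons (p : S) (n : ℕ × ℕ) (A : Multiset S) :
    (corrCoeff μ₀ μ₁ κ hκ U n).1 (p ::ₘ A) = Complex.exp (Complex.I * κ p p) *
      (corrCoeffProd μ₀ μ₁ κ hκ U (pairFactor κ hκ p) n).1 A := by
  have h := congrArg (fun T => (T (phaseWeight κ hκ)).1 A)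
    (addParticle_commute_normAnnPow μ₀ μ₁ U p n).eq
  simp only [Module.End.mul_apply, addParticle_apply, addParticle_phaseWeight, map_smul] at h
  exact h

/-- `U` is the inverse of the formal power series of the partition function. -/
def IsInversePartition : Prop :=
  ∀ n, ∑ x ∈ Finset.HasAntidiagonal.antidiagonal n,
    U x.1 * (annPow μ₀ μ₁ 1 x.2 (phaseWeight κ hκ)).1 0 = if n = 0 then 1 else 0

theorem exists_isInversePartition : ∃ U, IsInversePartition μ₀ μ₁ κ hκ U :=
  exists_antidiagonal_inverse (fun n => (annPow μ₀ μ₁ 1 n (phaseWeight κ hκ)).1 0)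
    (by simp [phaseWeight_empty])

variable {U}

theorem normAnnPow_apply (F : configFun S) (n : ℕ × ℕ) (A : Multiset S) :
    (normAnnPow μ₀ μ₁ U n F).1 A =
      ∑ x ∈ Finset.HasAntidiagonal.antidiagonal n, U x.1 * (annPow μ₀ μ₁ 1 x.2 F).1 A := by
  rw [normAnnPow, LinearMap.sum_apply, Submodule.coe_sum, Finset.sum_apply]
  rfl

variable {μ₀ μ₁ κ hκ}

theorem corrCoeff_empty (hU : IsInversePartition μ₀ μ₁ κ hκ U) (n : ℕ × ℕ) :
    (corrCoeff μ₀ μ₁ κ hκ U n).1 0 = if n = 0 then 1 else 0 := by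
  rw [corrCoeff, normAnnPow_apply]
  exact hU n

/-- The bound on the Taylor coefficients of the correlation functions that follows from the
Kirkwood–Salsburg equations. -/
theorem norm_corrCoeff_le (hU : IsInversePartition μ₀ μ₁ κ hκ U) (P : S → Prop)
    (hP₀ : ∀ᵐ q ∂μ₀, P q) (hP₁ : ∀ᵐ q ∂μ₁, P q) {R₀ R₁ : ℝ} (hR₀ : 0 < R₀) (hR₁ : 0 < R₁)
    (hR : ∀ p, P p → Real.exp 1 * (R₀ * ∫ q, ‖(pairFactor κ hκ p - 1).1 q‖ ∂μ₀ +
      R₁ * ∫ q, ‖(pairFactor κ hκ p - 1).1 q‖ ∂μ₁) ≤ 1)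
    (n : ℕ × ℕ) (A : Multiset S) (hA : ∀ q ∈ A, P q) :
    ‖(corrCoeff μ₀ μ₁ κ hκ U n).1 A‖ ≤
      Real.exp (Multiset.card A) * (R₀⁻¹ ^ n.1 * R₁⁻¹ ^ n.2) := by
  -- On the right of the equation, `k` orders of the activities are exchanged for `k` particles
  -- while `p` is gone, so order plus particle number is exactly one lower.
  induction hM : n.1 + n.2 + Multiset.card A using Nat.strong_induction_on generalizing n A with
  | _ M ih =>
  induction A using Multiset.induction with
  | empty =>
    rw [corrCoeff_empty hU]
    split_ifs with h
    · simp [h]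
    · simpa using by positivity
  | cons p A _ =>
    have hA' : ∀ q ∈ A, P q := fun q hq => hA q (Multiset.mem_cons_of_mem hq)
    rw [corrCoeff_cons, corrCoeffProd_apply, norm_mul, norm_mul,
      Complex.norm_exp_I_mul_ofReal', norm_prod_map_eq_one (norm_pairFactor κ hκ p), one_mul,
      one_mul]
    refine (norm_sum_le _ _).trans ?_
    refine (Finset.sum_le_sum (g := fun x => _) fun x hx => norm_annPow_le μ₀ μ₁ _ P hP₀ hP₁ x.1 _
      (N := Multiset.card A) (C := Real.exp (Multiset.card A + x.1.1 + x.1.2) *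
        (R₀⁻¹ ^ x.2.1 * R₁⁻¹ ^ x.2.2)) (fun B hB hBN => ?_) hA' rfl).trans ?_
    · have hx' := Finset.HasAntidiagonal.mem_antidiagonal.1 hx
      have h1 : x.1.1 + x.2.1 = n.1 := congrArg Prod.fst hx'
      have h2 : x.1.2 + x.2.2 = n.2 := congrArg Prod.snd hx'
      have := ih (x.2.1 + x.2.2 + Multiset.card B)
        (by rw [hBN, ← hM, Multiset.card_cons]; omega) x.2 B hB rfl
      rwa [hBN, Nat.cast_add, Nat.cast_add] at this
    -- By smallness the exponential of the two integrals is at most `e`, which pays for the particle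
    -- `p`.
    · refine (sum_antidiagonal_annPow_le (integral_nonneg fun _ => norm_nonneg _)
        (integral_nonneg fun _ => norm_nonneg _) hR₀ hR₁ _ n).trans ?_
      rw [Multiset.card_cons, Nat.cast_add, Nat.cast_one, Real.exp_add, mul_right_comm]
      exact mul_le_mul_of_nonneg_right (mul_le_mul_of_nonneg_left
        (Real.exp_le_exp.2 (hR p (hA p (Multiset.mem_cons_self _ _)))) (Real.exp_pos _).le)
        (by positivity)

/-- The term without integrations is the coefficient at the empty configuration, that is, the
constant series 1. Removing it also removes the leading term of the exponential bound, so the bound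
vanishes when `g - 1` does; continuity at zero rests on this. -/
theorem norm_corrCoeffProd_sub_le (hU : IsInversePartition μ₀ μ₁ κ hκ U) (P : S → Prop)
    (hP₀ : ∀ᵐ q ∂μ₀, P q) (hP₁ : ∀ᵐ q ∂μ₁, P q) {R₀ R₁ : ℝ} (hR₀ : 0 < R₀) (hR₁ : 0 < R₁)
    (hR : ∀ p, P p → Real.exp 1 * (R₀ * ∫ q, ‖(pairFactor κ hκ p - 1).1 q‖ ∂μ₀ +
      R₁ * ∫ q, ‖(pairFactor κ hκ p - 1).1 q‖ ∂μ₁) ≤ 1) (g : bddMeas S) (n : ℕ × ℕ) :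
    ‖(corrCoeffProd μ₀ μ₁ κ hκ U g n).1 0 - if n = 0 then 1 else 0‖ ≤
      R₀⁻¹ ^ n.1 * R₁⁻¹ ^ n.2 * (Real.exp (Real.exp 1 *
        (R₀ * ∫ q, ‖(g - 1).1 q‖ ∂μ₀ + R₁ * ∫ q, ‖(g - 1).1 q‖ ∂μ₁)) - 1) := by
  have hmem : ((0, n) : (ℕ × ℕ) × (ℕ × ℕ)) ∈ Finset.HasAntidiagonal.antidiagonal n :=
    Finset.HasAntidiagonal.mem_antidiagonal.2 (zero_add n)
  have hsum := sum_antidiagonal_annPow_le (a₀ := ∫ q, ‖(g - 1).1 q‖ ∂μ₀)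
    (a₁ := ∫ q, ‖(g - 1).1 q‖ ∂μ₁) (integral_nonneg fun _ => norm_nonneg _)
    (integral_nonneg fun _ => norm_nonneg _) hR₀ hR₁ 0 n
  rw [← Finset.add_sum_erase _ _ hmem] at hsum
  rw [corrCoeffProd_apply, Multiset.map_zero, Multiset.prod_zero, one_mul,
    ← Finset.add_sum_erase _ _ hmem, annPow_zero, Module.End.one_apply, corrCoeff_empty hU,
    add_sub_cancel_left]
  refine (norm_sum_le _ _).trans ?_
  refine (Finset.sum_le_sum (g := fun x => _) fun x hx => norm_annPow_le μ₀ μ₁ _ P hP₀ hP₁ x.1 _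
    (N := 0) (C := Real.exp (0 + x.1.1 + x.1.2) *
      (R₀⁻¹ ^ x.2.1 * R₁⁻¹ ^ x.2.2)) (fun B hB hBN => ?_) (by simp) rfl).trans ?_
  · have := norm_corrCoeff_le hU P hP₀ hP₁ hR₀ hR₁ hR x.2 B hB
    rwa [hBN, Nat.cast_add, Nat.cast_add, Nat.cast_zero] at this
  · simp only [Prod.fst_zero, Prod.snd_zero, pow_zero, Nat.factorial_zero, Nat.cast_one, div_one,
      one_mul, Nat.cast_zero, add_zero, Real.exp_zero] at hsum
    rw [mul_sub, mul_one]
    linarith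

end Bounds

/-! ### Infinite-volume limit of the coefficients -/

section InfiniteVolume

variable {S : Type*} [MeasurableSpace S] {T : Type*}

/-- Uniform boundedness and pointwise convergence of a net of functions on the configurations of
`N` particles with property `P`. -/
def SectorConvergent (P : S → Prop) (l : Filter T) (N : ℕ) (F : T → configFun S) : Prop :=
  (∃ C, ∀ t A, (∀ q ∈ A, P q) → Multiset.card A = N → ‖(F t).1 A‖ ≤ C) ∧
    ∀ A, (∀ q ∈ A, P q) → Multiset.card A = N → ∃ c, Tendsto (fun t => (F t).1 A) l (𝓝 c)

variable {P : S → Prop} {l : Filter T} [l.IsCountablyGenerated] {K : T → Set S}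

/-- Dominated convergence with majorant `‖w‖ * max C 0`. Integrability of `w` over the unrestricted
measure controls the growing windows, whose indicators are eventually 1 at each point. -/
theorem SectorConvergent.map_annihilation {μ : Measure S} [∀ t, IsFiniteMeasure (μ.restrict (K t))]
    (hK : ∀ t, MeasurableSet (K t)) (hKl : ∀ q, ∀ᶠ t in l, q ∈ K t) (hP : ∀ᵐ q ∂μ, P q)
    {w : bddMeas S} (hw : Integrable w.1 μ) {N : ℕ} {F : T → configFun S}
    (hF : SectorConvergent P l (N + 1) F) :
    SectorConvergent P l N fun t => annihilation (μ.restrict (K t)) w (F t) := by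
  obtain ⟨⟨C, hC⟩, hlim⟩ := hF
  -- The sector may contain no configuration with property `P`, in which case `C` may be negative;
  -- hence `max C 0`.
  refine ⟨⟨(∫ q, ‖w.1 q‖ ∂μ) * max C 0, fun t A hA hN => ?_⟩, fun A hA hN => ?_⟩
  · refine (norm_annihilation_le (μ.restrict (K t)) w P (ae_restrict_of_ae hP) (F t)
      (C := max C 0) (fun B hB hBN => (hC t B hB hBN).trans (le_max_left _ _)) hA hN).trans ?_
    exact mul_le_mul_of_nonneg_right (setIntegral_le_integral hw.norm
      (.of_forall fun _ => norm_nonneg _)) (le_max_right _ _)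
  · classical
    have hcons : ∀ q, P q → ∃ c, Tendsto (fun t => (F t).1 (q ::ₘ A)) l (𝓝 c) := fun q hq =>
      hlim _ (by simpa [hq] using hA) (by simp [hN])
    -- The pointwise limit of the integrand, set to 0 on the null set where `P` fails.
    let f : S → ℂ := fun q => if hq : P q then w.1 q * (hcons q hq).choose else 0
    refine ⟨∫ q, f q ∂μ, ?_⟩
    simp only [annihilation_apply]
    simp_rw [← integral_indicator (hK _)]
    refine tendsto_integral_filter_of_dominated_convergence (fun q => ‖w.1 q‖ * max C 0)
      (.of_forall fun t => ?_) (.of_forall fun t => ?_) (hw.norm.mul_const _) ?_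
    · obtain ⟨n, v, rfl⟩ := A.exists_ofFn
      exact ((w.2.1.mul (configFun.measurable_cons (F t) measurable_id
        measurable_const)).indicator (hK t)).aestronglyMeasurable
    · filter_upwards [hP] with q hq
      refine (norm_indicator_le_norm_self _ _).trans ?_
      rw [norm_mul]
      exact mul_le_mul_of_nonneg_left ((hC t _ (by simpa [hq] using hA) (by simp [hN])).trans
        (le_max_left _ _)) (norm_nonneg _)
    · filter_upwards [hP] with q hq
      have h1 : f q = w.1 q * (hcons q hq).choose := dif_pos hq
      rw [h1]
      refine ((hcons q hq).choose_spec.const_mul (w.1 q)).congr' ?_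
      filter_upwards [hKl q] with t ht
      rw [Set.indicator_of_mem ht]

theorem SectorConvergent.map_divPow {μ : Measure S} [∀ t, IsFiniteMeasure (μ.restrict (K t))]
    (hK : ∀ t, MeasurableSet (K t)) (hKl : ∀ q, ∀ᶠ t in l, q ∈ K t) (hP : ∀ᵐ q ∂μ, P q)
    {w : bddMeas S} (hw : Integrable w.1 μ) {N k : ℕ} {F : T → configFun S}
    (hF : SectorConvergent P l (N + k) F) :
    SectorConvergent P l N fun t => divPow (annihilation (μ.restrict (K t)) w) k (F t) := by
  have h : ∀ (k : ℕ) (F : T → configFun S), SectorConvergent P l (N + k) F →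
      SectorConvergent P l N fun t => (annihilation (μ.restrict (K t)) w ^ k) (F t) := by
    intro k
    induction k with
    | zero => intro F hF; simpa using hF
    | succ k ih =>
      intro F hF
      simp only [pow_succ, Module.End.mul_apply]
      exact ih _ (SectorConvergent.map_annihilation hK hKl hP hw hF)
  obtain ⟨⟨C, hC⟩, hlim⟩ := h k F hF
  refine ⟨⟨‖((k.factorial : ℂ)⁻¹)‖ * C, fun t A hA hN => ?_⟩, fun A hA hN => ?_⟩
  · change ‖(k.factorial : ℂ)⁻¹ * ((annihilation (μ.restrict (K t)) w ^ k) (F t)).1 A‖ ≤ _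
    rw [norm_mul]
    exact mul_le_mul_of_nonneg_left (hC t A hA hN) (norm_nonneg _)
  · obtain ⟨c, hc⟩ := hlim A hA hN
    exact ⟨_, hc.const_mul ((k.factorial : ℂ)⁻¹)⟩

variable {μ₀ μ₁ : Measure S} [∀ t, IsFiniteMeasure (μ₀.restrict (K t))]
  [∀ t, IsFiniteMeasure (μ₁.restrict (K t))]

theorem SectorConvergent.map_annPow (hK : ∀ t, MeasurableSet (K t)) (hKl : ∀ q, ∀ᶠ t in l, q ∈ K t)
    (hP₀ : ∀ᵐ q ∂μ₀, P q) (hP₁ : ∀ᵐ q ∂μ₁, P q) {w : bddMeas S} (hw₀ : Integrable w.1 μ₀)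
    (hw₁ : Integrable w.1 μ₁) {N : ℕ} (k : ℕ × ℕ) {F : T → configFun S}
    (hF : SectorConvergent P l (N + k.1 + k.2) F) :
    SectorConvergent P l N fun t =>
      annPow (μ₀.restrict (K t)) (μ₁.restrict (K t)) w k (F t) :=
  (hF.map_divPow hK hKl hP₁ hw₁).map_divPow hK hKl hP₀ hw₀

variable {κ : S → S → ℝ} {hκ : Measurable (Function.uncurry κ)} {U : T → ℕ × ℕ → ℂ}

/-- The Kirkwood–Salsburg smallness condition for the activity radii `R₀` and `R₁`. -/
structure KirkwoodSalsburgCondition (κ : S → S → ℝ) (hκ : Measurable (Function.uncurry κ))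
    (μ₀ μ₁ : Measure S) (P : S → Prop) (R₀ R₁ : ℝ) : Prop where
  ae₀ : ∀ᵐ q ∂μ₀, P q
  ae₁ : ∀ᵐ q ∂μ₁, P q
  pos₀ : 0 < R₀
  pos₁ : 0 < R₁
  integrable₀ : ∀ p, P p → Integrable (pairFactor κ hκ p - 1).1 μ₀
  integrable₁ : ∀ p, P p → Integrable (pairFactor κ hκ p - 1).1 μ₁
  le_one : ∀ p, P p → Real.exp 1 * (R₀ * ∫ q, ‖(pairFactor κ hκ p - 1).1 q‖ ∂μ₀ +
      R₁ * ∫ q, ‖(pairFactor κ hκ p - 1).1 q‖ ∂μ₁) ≤ 1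

/-- Restriction only decreases the integrals, so the same radii serve every volume. -/
theorem KirkwoodSalsburgCondition.restrict {R₀ R₁ : ℝ}
    (h : KirkwoodSalsburgCondition κ hκ μ₀ μ₁ P R₀ R₁) (A : Set S) :
    KirkwoodSalsburgCondition κ hκ (μ₀.restrict A) (μ₁.restrict A) P R₀ R₁ where
  ae₀ := ae_restrict_of_ae h.ae₀
  ae₁ := ae_restrict_of_ae h.ae₁
  pos₀ := h.pos₀
  pos₁ := h.pos₁
  integrable₀ p hp := (h.integrable₀ p hp).restrict
  integrable₁ p hp := (h.integrable₁ p hp).restrict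
  le_one p hp := by
    refine le_trans (mul_le_mul_of_nonneg_left (add_le_add
      (mul_le_mul_of_nonneg_left ?_ h.pos₀.le) (mul_le_mul_of_nonneg_left ?_ h.pos₁.le))
      (Real.exp_pos 1).le) (h.le_one p hp)
    · exact setIntegral_le_integral (h.integrable₀ p hp).norm (.of_forall fun _ => norm_nonneg _)
    · exact setIntegral_le_integral (h.integrable₁ p hp).norm (.of_forall fun _ => norm_nonneg _)

/-- The induction is that of `norm_corrCoeff_le`: convergence passes through the finitely many terms
of the recursion because `f_p - 1` is integrable, while the bound there is uniform in the window. -/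
theorem corrCoeff_sectorConvergent (hK : ∀ t, MeasurableSet (K t))
    (hKl : ∀ q, ∀ᶠ t in l, q ∈ K t) {R₀ R₁ : ℝ}
    (hR : KirkwoodSalsburgCondition κ hκ μ₀ μ₁ P R₀ R₁)
    (hU : ∀ t, IsInversePartition (μ₀.restrict (K t)) (μ₁.restrict (K t)) κ hκ (U t))
    (n : ℕ × ℕ) (N : ℕ) :
    SectorConvergent P l N fun t =>
      corrCoeff (μ₀.restrict (K t)) (μ₁.restrict (K t)) κ hκ (U t) n := by
  induction hM : n.1 + n.2 + N using Nat.strong_induction_on generalizing n N with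
  | _ M ih =>
  refine ⟨⟨Real.exp N * (R₀⁻¹ ^ n.1 * R₁⁻¹ ^ n.2), fun t A hA hN => ?_⟩, fun A hA hN => ?_⟩
  · have h := hR.restrict (K t)
    have := norm_corrCoeff_le (hU t) P h.ae₀ h.ae₁ h.pos₀ h.pos₁ h.le_one n A hA
    rwa [hN] at this
  · induction A using Multiset.induction with
    | empty => exact ⟨_, by simp only [corrCoeff_empty (hU _)]; exact tendsto_const_nhds⟩
    | cons p A _ =>
      have hA' : ∀ q ∈ A, P q := fun q hq => hA q (Multiset.mem_cons_of_mem hq)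
      have hp : P p := hA p (Multiset.mem_cons_self _ _)
      simp only [corrCoeff_cons, corrCoeffProd_apply]
      have hx : ∀ x ∈ Finset.HasAntidiagonal.antidiagonal n, ∃ c, Tendsto (fun t =>
          (annPow (μ₀.restrict (K t)) (μ₁.restrict (K t)) (pairFactor κ hκ p - 1) x.1
            (corrCoeff (μ₀.restrict (K t)) (μ₁.restrict (K t)) κ hκ (U t) x.2)).1 A) l (𝓝 c) := by
        intro x hx
        have hx' := Finset.HasAntidiagonal.mem_antidiagonal.1 hx
        have h1 : x.1.1 + x.2.1 = n.1 := congrArg Prod.fst hx'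
        have h2 : x.1.2 + x.2.2 = n.2 := congrArg Prod.snd hx'
        rw [Multiset.card_cons] at hN
        refine (SectorConvergent.map_annPow hK hKl hR.ae₀ hR.ae₁ (hR.integrable₀ p hp)
          (hR.integrable₁ p hp) x.1 (ih _ ?_ x.2 _ rfl)).2 A hA' rfl
        omega
      choose! c hc using hx
      exact ⟨_, ((tendsto_finsetSum _ hc).const_mul _).const_mul _⟩

theorem exists_tendsto_corrCoeffProd (hK : ∀ t, MeasurableSet (K t))
    (hKl : ∀ q, ∀ᶠ t in l, q ∈ K t) {R₀ R₁ : ℝ}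
    (hR : KirkwoodSalsburgCondition κ hκ μ₀ μ₁ P R₀ R₁)
    (hU : ∀ t, IsInversePartition (μ₀.restrict (K t)) (μ₁.restrict (K t)) κ hκ (U t))
    (g : bddMeas S) (hg₀ : Integrable (g - 1).1 μ₀) (hg₁ : Integrable (g - 1).1 μ₁) (n : ℕ × ℕ) :
    ∃ c, Tendsto (fun t =>
      (corrCoeffProd (μ₀.restrict (K t)) (μ₁.restrict (K t)) κ hκ (U t) g n).1 0) l (𝓝 c) := by
  simp only [corrCoeffProd_apply]
  have hx : ∀ x ∈ Finset.HasAntidiagonal.antidiagonal n, ∃ c, Tendsto (fun t =>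
      (annPow (μ₀.restrict (K t)) (μ₁.restrict (K t)) (g - 1) x.1
        (corrCoeff (μ₀.restrict (K t)) (μ₁.restrict (K t)) κ hκ (U t) x.2)).1 0) l (𝓝 c) :=
    fun x _ => (SectorConvergent.map_annPow hK hKl hR.ae₀ hR.ae₁ hg₀ hg₁ x.1
      (corrCoeff_sectorConvergent hK hKl hR hU x.2 _)).2 0 (by simp) rfl
  choose! c hc using hx
  exact ⟨_, (tendsto_finsetSum _ hc).const_mul _⟩

end InfiniteVolume

/-! ### Power series in two complex variables -/

section PowerSeriesTwoVariables

theorem AnalyticAt.continuousLinearMap_apply {E F G : Type*} [NormedAddCommGroup E]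
    [NormedSpace ℂ E] [NormedAddCommGroup F] [NormedSpace ℂ F] [NormedAddCommGroup G]
    [NormedSpace ℂ G] {L : E → F →L[ℂ] G} {b : E → F} {p : E} (hL : AnalyticAt ℂ L p)
    (hb : AnalyticAt ℂ b p) : AnalyticAt ℂ (fun x => L x (b x)) p := by
  have h : AnalyticAt ℂ (fun x : (F →L[ℂ] G) × F => x.1 x.2) (L p, b p) :=
    (ContinuousLinearMap.id ℂ (F →L[ℂ] G)).analyticAt_bilinear (L p, b p)
  exact AnalyticAt.comp (f := fun x => (L x, b x)) h (hL.prod hb)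

theorem summable_norm_bivariate {a : ℕ × ℕ → ℂ} {M R₀ R₁ : ℝ} (hR₀ : 0 < R₀) (hR₁ : 0 < R₁)
    (ha : ∀ n, ‖a n‖ ≤ R₀⁻¹ ^ n.1 * R₁⁻¹ ^ n.2 * M) {x y : ℂ} (hx : ‖x‖ < R₀) (hy : ‖y‖ < R₁) :
    Summable fun n : ℕ × ℕ => ‖a n * (x ^ n.1 * y ^ n.2)‖ := by
  have hs : ∀ {z : ℂ} {R : ℝ}, 0 < R → ‖z‖ < R → Summable fun n : ℕ => (‖z‖ / R) ^ n :=
    fun hR hz => summable_geometric_of_lt_one (by positivity) ((div_lt_one hR).2 hz)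
  refine .of_nonneg_of_le (fun _ => norm_nonneg _) (fun n => ?_)
    (((hs hR₀ hx).mul_of_nonneg (hs hR₁ hy) (fun _ => by positivity)
      (fun _ => by positivity)).mul_right M)
  rw [norm_mul, norm_mul, norm_pow, norm_pow]
  refine (mul_le_mul_of_nonneg_right (ha n) (by positivity)).trans (le_of_eq ?_)
  rw [div_pow, div_pow, inv_pow, inv_pow]
  ring

/-- A power series in two complex variables is analytic in its polydisc of convergence. -/
theorem analyticAt_bivariate {a : ℕ × ℕ → ℂ} {M R₀ R₁ : ℝ} (hR₀ : 0 < R₀) (hR₁ : 0 < R₁)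
    (ha : ∀ n, ‖a n‖ ≤ R₀⁻¹ ^ n.1 * R₁⁻¹ ^ n.2 * M) {p : ℂ × ℂ} (hp₀ : ‖p.1‖ < R₀)
    (hp₁ : ‖p.2‖ < R₁) :
    AnalyticAt ℂ (fun p : ℂ × ℂ => ∑' n : ℕ × ℕ, a n * (p.1 ^ n.1 * p.2 ^ n.2)) p := by
  have hM : 0 ≤ M := by simpa using (norm_nonneg _).trans (ha 0)
  obtain ⟨Q₀, hpQ₀, hQR₀⟩ := exists_between hp₀
  obtain ⟨Q₁, hpQ₁, hQR₁⟩ := exists_between hp₁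
  have hQ₀ : 0 < Q₀ := (norm_nonneg _).trans_lt hpQ₀
  have hQ₁ : 0 < Q₁ := (norm_nonneg _).trans_lt hpQ₁
  have hs₀ : Summable fun n : ℕ => (Q₀ / R₀) ^ n :=
    summable_geometric_of_lt_one (by positivity) ((div_lt_one hR₀).2 hQR₀)
  have hs₁ : Summable fun n : ℕ => (Q₁ / R₁) ^ n :=
    summable_geometric_of_lt_one (by positivity) ((div_lt_one hR₁).2 hQR₁)
  have hcoef : ∀ j i, ‖(R₀ : ℂ) ^ i * a (i, j)‖ ≤ R₁⁻¹ ^ j * M := fun j i => by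
    rw [norm_mul, norm_pow, Complex.norm_real, Real.norm_of_nonneg hR₀.le]
    refine (mul_le_mul_of_nonneg_left (ha (i, j)) (by positivity)).trans (le_of_eq ?_)
    have : R₀ ^ i * R₀⁻¹ ^ i = 1 := by rw [← mul_pow, mul_inv_cancel₀ hR₀.ne', one_pow]
    linear_combination R₁⁻¹ ^ j * M * this
  -- The double series is a pairing of two one-variable series: `∑ y ^ j b_j` with values in the
  -- bounded sequences, and `∑ x ^ i R₀⁻ⁱ E_i` with values in their dual. The weight `R₀ ^ i` makes
  -- the coefficient sequences bounded.
  let b : ℕ → BoundedContinuousFunction ℕ ℂ := fun j =>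
    BoundedContinuousFunction.ofNormedAddCommGroupDiscrete (fun i => (R₀ : ℂ) ^ i * a (i, j))
      (R₁⁻¹ ^ j * M) (hcoef j)
  have hb : ∀ j, ‖b j‖ ≤ R₁⁻¹ ^ j * M := fun j =>
    (BoundedContinuousFunction.norm_le (by positivity)).2 (hcoef j)
  let E : ℕ → BoundedContinuousFunction ℕ ℂ →L[ℂ] ℂ := fun i =>
    BoundedContinuousFunction.evalCLM ℂ i
  have hE : ∀ i, ‖E i‖ ≤ 1 := fun i => ContinuousLinearMap.opNorm_le_bound _ zero_le_one fun f => by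
    rw [one_mul]; exact f.norm_coe_le_norm i
  have hbound₁ : ∀ j, ∀ y ∈ Metric.ball (0 : ℂ) Q₁, ‖y ^ j • b j‖ ≤ (Q₁ / R₁) ^ j * M := by
    intro j y hy
    rw [norm_smul, norm_pow, div_pow, div_eq_mul_inv, ← inv_pow, mul_assoc]
    exact mul_le_mul (pow_le_pow_left₀ (norm_nonneg _) ((mem_ball_zero_iff.1 hy).le) _) (hb j)
      (norm_nonneg _) (by positivity)
  have hbound₀ : ∀ i, ∀ x ∈ Metric.ball (0 : ℂ) Q₀,
      ‖x ^ i • ((R₀ : ℂ)⁻¹ ^ i • E i)‖ ≤ (Q₀ / R₀) ^ i := by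
    intro i x hx
    rw [norm_smul, norm_smul, norm_pow, norm_pow, norm_inv, Complex.norm_real,
      Real.norm_of_nonneg hR₀.le, div_pow, div_eq_mul_inv, ← inv_pow]
    refine mul_le_mul (pow_le_pow_left₀ (norm_nonneg _) ((mem_ball_zero_iff.1 hx).le) _) ?_
      (by positivity) (by positivity)
    exact mul_le_of_le_one_right (by positivity) (hE i)
  have hB : DifferentiableOn ℂ (fun y : ℂ => ∑' j, y ^ j • b j) (Metric.ball 0 Q₁) :=
    Complex.differentiableOn_tsum_of_summable_norm (hs₁.mul_right M)
      (fun j => ((differentiable_id.pow j).smul_const (b j)).differentiableOn)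
      Metric.isOpen_ball hbound₁
  have hL : DifferentiableOn ℂ (fun x : ℂ => ∑' i, x ^ i • ((R₀ : ℂ)⁻¹ ^ i • E i))
      (Metric.ball 0 Q₀) :=
    Complex.differentiableOn_tsum_of_summable_norm
      (F := fun (i : ℕ) (x : ℂ) => x ^ i • ((R₀ : ℂ)⁻¹ ^ i • E i)) hs₀
      (fun i => ((differentiable_id.pow i).smul_const ((R₀ : ℂ)⁻¹ ^ i • E i)).differentiableOn)
      Metric.isOpen_ball hbound₀
  have hmem₀ : p.1 ∈ Metric.ball (0 : ℂ) Q₀ := by simpa using hpQ₀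
  have hmem₁ : p.2 ∈ Metric.ball (0 : ℂ) Q₁ := by simpa using hpQ₁
  have hBa : AnalyticAt ℂ (fun p : ℂ × ℂ => ∑' j, p.2 ^ j • b j) p :=
    AnalyticAt.comp (g := fun y : ℂ => ∑' j, y ^ j • b j) (f := fun p : ℂ × ℂ => p.2)
      (hB.analyticAt (Metric.isOpen_ball.mem_nhds hmem₁)) analyticAt_snd
  have hLa : AnalyticAt ℂ (fun p : ℂ × ℂ => ∑' i, p.1 ^ i • ((R₀ : ℂ)⁻¹ ^ i • E i)) p :=
    AnalyticAt.comp (g := fun x : ℂ => ∑' i, x ^ i • ((R₀ : ℂ)⁻¹ ^ i • E i))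
      (f := fun p : ℂ × ℂ => p.1)
      (hL.analyticAt (Metric.isOpen_ball.mem_nhds hmem₀)) analyticAt_fst
  refine (hLa.continuousLinearMap_apply hBa).congr ?_
  have hnhds : ∀ᶠ q : ℂ × ℂ in 𝓝 p, q.1 ∈ Metric.ball (0 : ℂ) Q₀ ∧ q.2 ∈ Metric.ball (0 : ℂ) Q₁ :=
    (continuous_fst.continuousAt.eventually (Metric.isOpen_ball.mem_nhds hmem₀)).and
      (continuous_snd.continuousAt.eventually (Metric.isOpen_ball.mem_nhds hmem₁))
  filter_upwards [hnhds] with q hq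
  have hq₀ : ‖q.1‖ < R₀ := lt_trans (by simpa using hq.1) hQR₀
  have hq₁ : ‖q.2‖ < R₁ := lt_trans (by simpa using hq.2) hQR₁
  have hsumL : Summable fun i => q.1 ^ i • ((R₀ : ℂ)⁻¹ ^ i • E i) :=
    .of_norm_bounded hs₀ fun i => hbound₀ i q.1 hq.1
  have hsumB : Summable fun j => q.2 ^ j • b j :=
    .of_norm_bounded (hs₁.mul_right M) fun j => hbound₁ j q.2 hq.2
  rw [(summable_norm_bivariate hR₀ hR₁ ha hq₀ hq₁).of_norm.tsum_prod]
  rw [← ContinuousLinearMap.apply_apply (𝕜 := ℂ) (∑' j, q.2 ^ j • b j),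
    (ContinuousLinearMap.apply ℂ ℂ (∑' j, q.2 ^ j • b j)).map_tsum hsumL]
  refine tsum_congr fun i => ?_
  rw [ContinuousLinearMap.apply_apply, smul_apply,
    smul_apply, (E i).map_tsum hsumB, smul_eq_mul, smul_eq_mul,
    ← tsum_mul_left, ← tsum_mul_left]
  refine tsum_congr fun j => ?_
  have h1 : E i (q.2 ^ j • b j) = q.2 ^ j * ((R₀ : ℂ) ^ i * a (i, j)) := rfl
  have h2 : (R₀ : ℂ)⁻¹ ^ i * (R₀ : ℂ) ^ i = 1 := by
    rw [← mul_pow, inv_mul_cancel₀ (by exact_mod_cast hR₀.ne'), one_pow]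
  rw [h1]
  linear_combination q.1 ^ i * q.2 ^ j * a (i, j) * h2

/-- The Cauchy product of two power series in two variables. -/
theorem tsum_bivariate_mul {a b : ℕ × ℕ → ℂ} {x y : ℂ}
    (ha : Summable fun n : ℕ × ℕ => ‖a n * (x ^ n.1 * y ^ n.2)‖)
    (hb : Summable fun n : ℕ × ℕ => ‖b n * (x ^ n.1 * y ^ n.2)‖) :
    (∑' n : ℕ × ℕ, a n * (x ^ n.1 * y ^ n.2)) * ∑' n : ℕ × ℕ, b n * (x ^ n.1 * y ^ n.2) =
      ∑' n : ℕ × ℕ, (∑ k ∈ Finset.HasAntidiagonal.antidiagonal n, a k.1 * b k.2) *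
        (x ^ n.1 * y ^ n.2) := by
  have h := Summable.tsum_mul_tsum_eq_tsum_sum_antidiagonal
    (f := fun n : ℕ × ℕ => a n * (x ^ n.1 * y ^ n.2))
    (g := fun n : ℕ × ℕ => b n * (x ^ n.1 * y ^ n.2)) ha.of_norm hb.of_norm
    (summable_mul_of_summable_norm (f := fun n : ℕ × ℕ => a n * (x ^ n.1 * y ^ n.2))
      (g := fun n : ℕ × ℕ => b n * (x ^ n.1 * y ^ n.2)) ha hb)
  rw [h]
  refine tsum_congr fun n => ?_
  rw [Finset.sum_mul]
  refine Finset.sum_congr rfl fun k hk => ?_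
  obtain rfl := Finset.HasAntidiagonal.mem_antidiagonal.1 hk
  simp only [Prod.fst_add, Prod.snd_add, pow_add]
  ring

end PowerSeriesTwoVariables

/-! ### Iterated integrals as powers of annihilation operators -/

section IteratedIntegrals

variable {S : Type*} [MeasurableSpace S]

/-- By Fubini the labelled particles are integrated out one at a time, the first coordinate
innermost. -/
theorem integral_pi_eq_annihilation_pow {α : Type*} [MeasurableSpace α] (m : Measure α)
    [IsFiniteMeasure m] {f : α → S} (hf : Measurable f) (n : ℕ) (F : configFun S) :
    ∫ v, F.1 (List.ofFn fun j => f (v j) : List S) ∂(Measure.pi fun _ : Fin n => m) =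
      ((annihilation (m.map f) 1 ^ n) F).1 0 := by
  induction n generalizing F with
  | zero => simp [Measure.real]
  | succ n ih =>
    have hmp := measurePreserving_piFinSuccAbove (fun _ : Fin (n + 1) => m) 0
    have hcomp : ∀ v : Fin (n + 1) → α, F.1 (List.ofFn fun j => f (v j) : List S) =
        (fun x : α × (Fin n → α) => F.1 (f x.1 ::ₘ (List.ofFn fun j => f (x.2 j) : List S)))
          (MeasurableEquiv.piFinSuccAbove (fun _ : Fin (n + 1) => α) 0 v) := by
      intro v
      change _ = F.1 (f (v 0) ::ₘ (List.ofFn fun j : Fin n => f (v j.succ) : List S))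
      rw [List.ofFn_succ]
      rfl
    simp_rw [hcomp]
    rw [hmp.integral_comp' (g := fun x : α × (Fin n → α) =>
      F.1 (f x.1 ::ₘ (List.ofFn fun j => f (x.2 j) : List S))), integral_prod_symm, pow_succ,
      Module.End.mul_apply, ← ih]
    · refine integral_congr_ae (.of_forall fun v => ?_)
      simp only [annihilation_apply, OneMemClass.coe_one, Pi.one_apply, one_mul]
      rw [integral_map hf.aemeasurable]
      obtain ⟨k, w, hw⟩ := (List.ofFn fun j => f (v j) : Multiset S).exists_ofFn
      rw [hw]
      exact (configFun.measurable_cons F measurable_id measurable_const).aestronglyMeasurable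
    · obtain ⟨C, hC⟩ := F.2.2 (n + 1)
      refine Integrable.of_bound (C := C) ?_ (.of_forall fun x => hC _ (by simp))
      refine (configFun.measurable_cons F (hf.comp measurable_fst) ?_).aestronglyMeasurable
      exact measurable_pi_lambda _ fun j => hf.comp ((measurable_pi_apply j).comp measurable_snd)

/-- Configurations whose weight factorizes over the particles to be integrated out. -/
theorem annihilation_pow_of_factor (μ : Measure S) [IsFiniteMeasure μ] (Q : S → Prop)
    (hQ : ∀ᵐ q ∂μ, Q q) (F : configFun S) (φ : S → Multiset S → ℂ)
    (hF : ∀ q A, Q q → F.1 (q ::ₘ A) = φ q A * F.1 A)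
    (hφ : ∀ q q' A, Q q → Q q' → φ q' (q ::ₘ A) = φ q' A) (j : ℕ) (A : Multiset S) :
    ((annihilation μ 1 ^ j) F).1 A = (∫ q, φ q A ∂μ) ^ j * F.1 A := by
  induction j generalizing A with
  | zero => simp
  | succ j ih =>
    rw [pow_succ', Module.End.mul_apply, annihilation_apply]
    have h : ∀ᵐ q ∂μ, (1 : bddMeas S).1 q * ((annihilation μ 1 ^ j) F).1 (q ::ₘ A) =
        φ q A * ((∫ q, φ q A ∂μ) ^ j * F.1 A) := by
      filter_upwards [hQ] with q hq
      -- The factors of the particles still to be integrated do not see the particle `q` just added.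
      have h1 : ∫ q', φ q' (q ::ₘ A) ∂μ = ∫ q', φ q' A ∂μ := by
        refine integral_congr_ae ?_
        filter_upwards [hQ] with q' hq'
        exact hφ q q' A hq hq'
      rw [ih, h1, hF q A hq, OneMemClass.coe_one, Pi.one_apply]
      ring
    rw [integral_congr_ae h, integral_mul_const, pow_succ]
    ring

theorem annihilation_congr_ae {μ : Measure S} [IsFiniteMeasure μ] {w w' : bddMeas S}
    (h : ∀ᵐ q ∂μ, w.1 q = w'.1 q) : annihilation μ w = annihilation μ w' := by
  refine LinearMap.ext fun F => Subtype.ext (funext fun A => ?_)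
  simp only [annihilation_apply]
  refine integral_congr_ae ?_
  filter_upwards [h] with q hq
  rw [hq]

theorem mulProd_commute_divPow {μ : Measure S} [IsFiniteMeasure μ] {g : bddMeas S}
    (h : ∀ᵐ q ∂μ, g.1 q = 1) (j : ℕ) :
    Commute (mulProd g) (divPow (annihilation μ 1) j) := by
  refine SemiconjBy.divPow_right ?_ j
  have h1 := mulProd_semiconjBy μ g 1
  rwa [one_mul, annihilation_congr_ae (w' := 1) (by simpa using h)] at h1

theorem norm_annPow_apply_empty_le (μ₀ μ₁ : Measure S) [IsFiniteMeasure μ₀] [IsFiniteMeasure μ₁]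
    {F : configFun S} (hF : ∀ A, ‖F.1 A‖ ≤ 1) (n : ℕ × ℕ) :
    ‖(annPow μ₀ μ₁ 1 n F).1 0‖ ≤ μ₀.real Set.univ ^ n.1 / n.1.factorial *
      (μ₁.real Set.univ ^ n.2 / n.2.factorial) := by
  have h := norm_annPow_le μ₀ μ₁ 1 (fun _ => True) (by simp) (by simp) n F (C := 1) (N := 0)
    (fun A _ _ => hF A) (A := 0) (by simp) rfl
  simpa using h

/-- With finite masses and a bounded weight, the factorials make the unnormalized series converge
for all complex activities. -/
theorem summable_norm_annPow (μ₀ μ₁ : Measure S) [IsFiniteMeasure μ₀] [IsFiniteMeasure μ₁]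
    {F : configFun S} (hF : ∀ A, ‖F.1 A‖ ≤ 1) (x y : ℂ) :
    Summable fun n : ℕ × ℕ => ‖(annPow μ₀ μ₁ 1 n F).1 0 * (x ^ n.1 * y ^ n.2)‖ := by
  refine .of_nonneg_of_le (fun _ => norm_nonneg _) (fun n => ?_)
    ((Real.summable_pow_div_factorial (μ₀.real Set.univ * ‖x‖)).mul_of_nonneg
      (Real.summable_pow_div_factorial (μ₁.real Set.univ * ‖y‖)) (fun _ => by positivity)
      (fun _ => by positivity))
  rw [norm_mul, norm_mul, norm_pow, norm_pow]
  refine (mul_le_mul_of_nonneg_right (norm_annPow_apply_empty_le μ₀ μ₁ hF n)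
    (by positivity)).trans (le_of_eq ?_)
  rw [mul_pow, mul_pow]
  ring

theorem sum_antidiagonal_assoc {A M : Type*} [AddCommMonoid A] [AddCommMonoid M]
    [Finset.HasAntidiagonal A] (n : A) (f : A → A → A → M) :
    ∑ x ∈ Finset.HasAntidiagonal.antidiagonal n,
      ∑ y ∈ Finset.HasAntidiagonal.antidiagonal x.2, f x.1 y.1 y.2 =
    ∑ x ∈ Finset.HasAntidiagonal.antidiagonal n,
      ∑ y ∈ Finset.HasAntidiagonal.antidiagonal x.1, f y.1 y.2 x.2 := by
  rw [Finset.sum_sigma', Finset.sum_sigma']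
  refine Finset.sum_nbij' (fun z => ⟨(z.1.1 + z.2.1, z.2.2), (z.1.1, z.2.1)⟩)
    (fun z => ⟨(z.2.1, z.2.2 + z.1.2), (z.2.2, z.1.2)⟩) ?_ ?_ ?_ ?_ ?_
  · rintro ⟨⟨a, b⟩, ⟨c, d⟩⟩ h
    simp only [Finset.mem_sigma, Finset.HasAntidiagonal.mem_antidiagonal] at h ⊢
    exact ⟨by rw [← h.1, ← h.2, add_assoc], trivial⟩
  · rintro ⟨⟨a, b⟩, ⟨c, d⟩⟩ h
    simp only [Finset.mem_sigma, Finset.HasAntidiagonal.mem_antidiagonal] at h ⊢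
    exact ⟨by rw [← h.1, ← h.2, add_assoc], trivial⟩
  · rintro ⟨⟨a, b⟩, ⟨c, d⟩⟩ h
    simp only [Finset.mem_sigma, Finset.HasAntidiagonal.mem_antidiagonal] at h
    simp [h.2]
  · rintro ⟨⟨a, b⟩, ⟨c, d⟩⟩ h
    simp only [Finset.mem_sigma, Finset.HasAntidiagonal.mem_antidiagonal] at h
    simp [h.2]
  · rintro ⟨⟨a, b⟩, ⟨c, d⟩⟩ h
    rfl

/-- The formal power series of an expectation is the one of the partition function times the one of
the normalized expectation. -/
theorem sum_antidiagonal_annPow_mul_corrCoeffProd {μ₀ μ₁ : Measure S} [IsFiniteMeasure μ₀]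
    [IsFiniteMeasure μ₁] {κ : S → S → ℝ} {hκ : Measurable (Function.uncurry κ)} {U : ℕ × ℕ → ℂ}
    (hU : IsInversePartition μ₀ μ₁ κ hκ U) (g : bddMeas S) (n : ℕ × ℕ) :
    ∑ x ∈ Finset.HasAntidiagonal.antidiagonal n, (annPow μ₀ μ₁ 1 x.1 (phaseWeight κ hκ)).1 0 *
      (corrCoeffProd μ₀ μ₁ κ hκ U g x.2).1 0 =
      (annPow μ₀ μ₁ 1 n (mulProd g (phaseWeight κ hκ))).1 0 := by
  set a := fun n => (annPow μ₀ μ₁ 1 n (phaseWeight κ hκ)).1 0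
  set b := fun n => (annPow μ₀ μ₁ 1 n (mulProd g (phaseWeight κ hκ))).1 0
  simp only [corrCoeffProd, normAnnPow_apply, Finset.mul_sum]
  rw [sum_antidiagonal_assoc n fun i j k => a i * (U j * b k)]
  have h : ∀ x ∈ Finset.HasAntidiagonal.antidiagonal n,
      ∑ y ∈ Finset.HasAntidiagonal.antidiagonal x.1, a y.1 * (U y.2 * b x.2) =
        if x.1 = 0 then b x.2 else 0 := by
    intro x _
    simp only [← mul_assoc, ← Finset.sum_mul]
    have h1 : ∑ y ∈ Finset.HasAntidiagonal.antidiagonal x.1, a y.1 * U y.2 =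
        if x.1 = 0 then 1 else 0 := by
      rw [← hU x.1]
      conv_rhs => rw [← Finset.HasAntidiagonal.map_swap_antidiagonal, Finset.sum_map]
      exact Finset.sum_congr rfl fun y _ => mul_comm _ _
    rw [h1]
    split_ifs <;> simp
  rw [Finset.sum_congr rfl h, Finset.sum_eq_single (0, n)]
  · simp [b]
  · rintro ⟨x, y⟩ hx hne
    rw [if_neg]
    rintro rfl
    simp only [Finset.HasAntidiagonal.mem_antidiagonal, zero_add] at hx
    exact hne (by rw [hx])
  · intro h0
    exact absurd (Finset.HasAntidiagonal.mem_antidiagonal.2 (zero_add n)) h0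

end IteratedIntegrals

/-! ### The two-species gas -/

section Model

variable {d : ℕ}

/-- Particles of both species: a position, a charge and a dual charge. -/
abbrev Particle (d : ℕ) : Type := EuclideanSpace ℝ (Fin d) × ℝ × ℝ

/-- The particle of the Poisson noise with given position and charge. -/
def chargeParticle (x : EuclideanSpace ℝ (Fin d) × ℝ) : Particle d := (x.1, x.2, 0)

/-- The dual particle, created by the interaction, with given position and dual charge. -/
def dualParticle (x : EuclideanSpace ℝ (Fin d) × ℝ) : Particle d := (x.1, 0, x.2)

theorem measurable_chargeParticle : Measurable (chargeParticle (d := d)) := by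
  unfold chargeParticle; fun_prop

theorem measurable_dualParticle : Measurable (dualParticle (d := d)) := by
  unfold dualParticle; fun_prop

/-- The intensity measure of the particles of the Poisson noise. -/
noncomputable def chargeMeasure (d : ℕ) (r : Measure ℝ) : Measure (Particle d) :=
  ((volume : Measure (EuclideanSpace ℝ (Fin d))).prod r).map chargeParticle

/-- The intensity measure of the dual particles. -/
noncomputable def dualMeasure (d : ℕ) (ν : Measure ℝ) : Measure (Particle d) :=
  ((volume : Measure (EuclideanSpace ℝ (Fin d))).prod ν).map dualParticle

/-- The particles located in `Λ`. -/
def window (Λ : TopologicalSpace.Compacts (EuclideanSpace ℝ (Fin d))) : Set (Particle d) :=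
  {p | p.1 ∈ Λ}

variable (Λ : TopologicalSpace.Compacts (EuclideanSpace ℝ (Fin d)))

theorem measurableSet_window : MeasurableSet (window Λ) :=
  measurable_fst Λ.isCompact.measurableSet

theorem chargeMeasure_restrict (r : Measure ℝ) [SFinite r] :
    (chargeMeasure d r).restrict (window Λ) =
      ((volume.restrict (Λ : Set (EuclideanSpace ℝ (Fin d)))).prod r).map chargeParticle := by
  rw [chargeMeasure, Measure.restrict_map measurable_chargeParticle (measurableSet_window Λ)]
  congr 1
  nth_rw 2 [← Measure.restrict_univ (μ := r)]
  rw [Measure.prod_restrict]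
  congr 1
  ext x
  simp [window, chargeParticle]

theorem dualMeasure_restrict (ν : Measure ℝ) [SFinite ν] :
    (dualMeasure d ν).restrict (window Λ) =
      ((volume.restrict (Λ : Set (EuclideanSpace ℝ (Fin d)))).prod ν).map dualParticle := by
  rw [dualMeasure, Measure.restrict_map measurable_dualParticle (measurableSet_window Λ)]
  congr 1
  nth_rw 2 [← Measure.restrict_univ (μ := ν)]
  rw [Measure.prod_restrict]
  congr 1
  ext x
  simp [window, dualParticle]

instance isFiniteMeasure_restrict_compacts :
    IsFiniteMeasure ((volume : Measure (EuclideanSpace ℝ (Fin d))).restrict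
      (Λ : Set (EuclideanSpace ℝ (Fin d)))) :=
  isFiniteMeasure_restrict.2 Λ.isCompact.measure_lt_top.ne

instance isFiniteMeasure_chargeMeasure_restrict (r : Measure ℝ) [IsProbabilityMeasure r] :
    IsFiniteMeasure ((chargeMeasure d r).restrict (window Λ)) := by
  rw [chargeMeasure_restrict]; infer_instance

instance isFiniteMeasure_dualMeasure_restrict (ν : Measure ℝ) [IsProbabilityMeasure ν] :
    IsFiniteMeasure ((dualMeasure d ν).restrict (window Λ)) := by
  rw [dualMeasure_restrict]; infer_instance

/-- The phase of a pair of particles; it vanishes unless the first one is a dual particle and the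
second one a particle of the Poisson noise. -/
def pairPhase (G : EuclideanSpace ℝ (Fin d) → ℝ) (p q : Particle d) : ℝ :=
  q.2.1 * p.2.2 * G (p.1 - q.1)

theorem measurable_pairPhase {G : EuclideanSpace ℝ (Fin d) → ℝ} (hG : Measurable G) :
    Measurable (Function.uncurry (pairPhase G)) := by
  unfold pairPhase Function.uncurry
  fun_prop

/-- The field of a unit charge at `y`, tested with `η`. -/
noncomputable def testField (G : EuclideanSpace ℝ (Fin d) → ℝ) (η : FiniteConfig d)
    (y : EuclideanSpace ℝ (Fin d)) : ℝ :=
  η.sum fun x a => a * G (x - y)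

theorem measurable_testField {G : EuclideanSpace ℝ (Fin d) → ℝ} (hG : Measurable G)
    (η : FiniteConfig d) : Measurable (testField G η) :=
  Finset.measurable_fun_sum _ fun _ _ =>
    (hG.comp (measurable_const.sub measurable_id)).const_mul _

/-- The contribution of a single particle to `exp (i ⟨X, η⟩)`. -/
noncomputable def testFactor (G : EuclideanSpace ℝ (Fin d) → ℝ) (hG : Measurable G)
    (η : FiniteConfig d) : bddMeas (Particle d) :=
  ⟨fun p => Complex.exp (Complex.I * (p.2.1 * testField G η p.1 : ℝ)), by
    constructor
    · have := measurable_testField hG η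
      exact Complex.measurable_exp.comp (measurable_const.mul (Complex.measurable_ofReal.comp
        ((measurable_fst.comp measurable_snd).mul (this.comp measurable_fst))))
    · exact ⟨1, fun q => (Complex.norm_exp_I_mul_ofReal' _).le⟩⟩

theorem sum_staticField (G : EuclideanSpace ℝ (Fin d) → ℝ) (η : FiniteConfig d)
    (γ : MarkedConfig d) :
    (η.sum fun x a => a * staticField G γ x) =
      ∑ j : Fin γ.1, (γ.2 j).2 * testField G η (γ.2 j).1 := by
  simp only [Finsupp.sum, staticField, testField, Finset.mul_sum]
  rw [Finset.sum_comm]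
  refine Finset.sum_congr rfl fun j _ => Finset.sum_congr rfl fun x _ => ?_
  ring

/-- The configuration of particles corresponding to a marked configuration. -/
def MarkedConfig.particles (γ : MarkedConfig d) : Multiset (Particle d) :=
  (List.ofFn fun j => chargeParticle (γ.2 j) : List (Particle d))

variable {G : EuclideanSpace ℝ (Fin d) → ℝ} (hG : Measurable G)

theorem prod_testFactor_particles (η : FiniteConfig d) (γ : MarkedConfig d) :
    (γ.particles.map (testFactor G hG η).1).prod =
      Complex.exp (Complex.I * ((η.sum fun x a => a * staticField G γ x : ℝ) : ℂ)) := by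
  rw [sum_staticField, MarkedConfig.particles, Multiset.map_coe, Multiset.prod_coe,
    List.map_ofFn, List.prod_ofFn, Complex.ofReal_sum, Finset.mul_sum, Complex.exp_sum]
  rfl

theorem phaseWeight_particles (γ : MarkedConfig d) :
    (phaseWeight (pairPhase G) (measurable_pairPhase hG)).1 γ.particles = 1 := by
  simp only [phaseWeight, MarkedConfig.particles, Multiset.map_coe, Multiset.sum_coe,
    List.map_ofFn, List.sum_ofFn, Function.comp_apply]
  simp [pairPhase, chargeParticle]

/-- Dual particles do not interact with each other, so over a fixed background of charges their
integrals factorize. Summed over `j` with weights `β ^ j / j!`, the powers give an exponential. -/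
theorem annihilation_pow_dual_particles (μ : Measure (Particle d)) [IsFiniteMeasure μ]
    (hμ : ∀ᵐ q ∂μ, q.2.1 = 0) (j : ℕ) (γ : MarkedConfig d) :
    ((annihilation μ 1 ^ j) (phaseWeight (pairPhase G) (measurable_pairPhase hG))).1 γ.particles =
      (∫ q, Complex.exp (Complex.I * (q.2.2 * staticField G γ q.1 : ℝ)) ∂μ) ^ j := by
  rw [annihilation_pow_of_factor μ (fun q => q.2.1 = 0) hμ
    (phaseWeight (pairPhase G) (measurable_pairPhase hG)) (fun q A => Complex.exp (Complex.I *
    ((A.map fun p => p.2.1 * q.2.2 * G (q.1 - p.1)).sum : ℝ)))]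
  · rw [phaseWeight_particles hG, mul_one]
    congr 2
    funext q
    congr 3
    rw [MarkedConfig.particles, Multiset.map_coe, Multiset.sum_coe, List.map_ofFn, List.sum_ofFn,
      staticField, Finset.mul_sum]
    refine Finset.sum_congr rfl fun j _ => ?_
    simp only [Function.comp_apply, chargeParticle]
    ring
  · intro q A hq
    rw [phaseWeight_cons]
    have h1 : pairPhase G q q = 0 := by simp [pairPhase, hq]
    rw [h1, Complex.ofReal_zero, mul_zero, Complex.exp_zero, one_mul]
    congr 1
    have h2 : ∀ p : Particle d, pairPhase G q p + pairPhase G p q =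
        p.2.1 * q.2.2 * G (q.1 - p.1) := fun p => by simp [pairPhase, hq]
    induction A using Multiset.induction with
    | empty => simp
    | cons p A ih =>
      rw [Multiset.map_cons, Multiset.prod_cons, ih, Multiset.map_cons, Multiset.sum_cons,
        Complex.ofReal_add, mul_add, Complex.exp_add, ← h2]
      rfl
  · intro q q' A hq _
    simp [hq]

theorem ae_dualMeasure_restrict (ν : Measure ℝ) [SFinite ν] :
    ∀ᵐ q ∂(dualMeasure d ν).restrict (window Λ), q.2.1 = 0 := by
  rw [dualMeasure_restrict]
  refine (ae_map_iff measurable_dualParticle.aemeasurable ?_).2 (.of_forall fun x => rfl)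
  exact (measurableSet_singleton (0 : ℝ)).preimage (measurable_fst.comp measurable_snd)

theorem norm_one_sub_exp_le (x : ℝ) : ‖1 - Complex.exp (Complex.I * x)‖ ≤ 2 := by
  refine (norm_sub_le _ _).trans ?_
  rw [Complex.norm_exp_I_mul_ofReal', norm_one]; norm_num

theorem abs_trigEnergy_le (ν : Measure ℝ) [IsProbabilityMeasure ν] (t : ℝ) :
    |trigEnergy ν t| ≤ 2 := by
  refine (Complex.abs_re_le_norm _).trans ?_
  refine (norm_integral_le_of_norm_le_const (C := 2) (.of_forall fun α => ?_)).trans (by simp)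
  simpa [mul_assoc] using norm_one_sub_exp_le (α * t)

theorem measurable_trigEnergy (ν : Measure ℝ) [SFinite ν] : Measurable (trigEnergy ν) := by
  refine Complex.measurable_re.comp ?_
  have : Measurable fun x : ℝ × ℝ => 1 - Complex.exp (Complex.I * x.2 * x.1) := by fun_prop
  exact this.stronglyMeasurable.integral_prod_right'.measurable

include hG in
theorem measurable_staticField_mk (n : ℕ) :
    Measurable fun x : (Fin n → EuclideanSpace ℝ (Fin d) × ℝ) × EuclideanSpace ℝ (Fin d) =>
      staticField G ⟨n, x.1⟩ x.2 := by
  change Measurable fun x : (Fin n → EuclideanSpace ℝ (Fin d) × ℝ) × EuclideanSpace ℝ (Fin d) =>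
    ∑ j : Fin n, (x.1 j).2 * G (x.2 - (x.1 j).1)
  refine Finset.measurable_fun_sum _ fun j _ => ?_
  have h1 : Measurable fun x : (Fin n → EuclideanSpace ℝ (Fin d) × ℝ) ×
      EuclideanSpace ℝ (Fin d) => x.1 j := (measurable_pi_apply j).comp measurable_fst
  fun_prop

theorem abs_interaction_le (ν : Measure ℝ) [IsProbabilityMeasure ν] (γ : MarkedConfig d) :
    |interaction G ν Λ γ| ≤ 2 * volume.real (Λ : Set (EuclideanSpace ℝ (Fin d))) := by
  rw [interaction, ← Real.norm_eq_abs]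
  refine (norm_integral_le_of_norm_le_const (C := 2)
    (.of_forall fun x => abs_trigEnergy_le ν _)).trans ?_
  simp

include hG in
/-- The dual representation of the interaction. -/
theorem coe_interaction (ν : Measure ℝ) [IsProbabilityMeasure ν]
    (hν : ν.map (fun α => -α) = ν) (γ : MarkedConfig d) :
    (interaction G ν Λ γ : ℂ) = volume.real (Λ : Set (EuclideanSpace ℝ (Fin d))) -
      ∫ q, Complex.exp (Complex.I * (q.2.2 * staticField G γ q.1 : ℝ))
        ∂(dualMeasure d ν).restrict (window Λ) := by
  have hm : Measurable fun q : Particle d =>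
      Complex.exp (Complex.I * (q.2.2 * staticField G γ q.1 : ℝ)) := by
    have h1 : Measurable fun q : Particle d => staticField G γ q.1 :=
      (measurable_staticField_mk hG γ.1).comp (measurable_const.prodMk measurable_fst)
    fun_prop
  have hint : Integrable (fun x : EuclideanSpace ℝ (Fin d) × ℝ =>
      Complex.exp (Complex.I * (x.2 * staticField G γ x.1 : ℝ)))
      ((volume.restrict (Λ : Set (EuclideanSpace ℝ (Fin d)))).prod ν) :=
    Integrable.of_bound (C := 1) (hm.comp measurable_dualParticle).aestronglyMeasurable
      (.of_forall fun x => (Complex.norm_exp_I_mul_ofReal' _).le)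
  rw [dualMeasure_restrict, integral_map measurable_dualParticle.aemeasurable
    hm.aestronglyMeasurable]
  change _ = _ - ∫ x : EuclideanSpace ℝ (Fin d) × ℝ,
    Complex.exp (Complex.I * (x.2 * staticField G γ x.1 : ℝ)) ∂_
  rw [integral_prod _ hint, interaction, ← integral_complex_ofReal]
  have hv : ∀ x, (trigEnergy ν (staticField G γ x) : ℂ) =
      1 - ∫ α, Complex.exp (Complex.I * (α * staticField G γ x : ℝ)) ∂ν := by
    intro x
    rw [coe_trigEnergy ν hν, integral_sub (integrable_const _)]
    · simp [mul_assoc]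
    · refine Integrable.of_bound (C := 1) (by fun_prop) (.of_forall fun α => ?_)
      have := (Complex.norm_exp_I_mul_ofReal' (α * staticField G γ x)).le
      simpa [mul_assoc] using this
  simp_rw [hv]
  rw [integral_sub (integrable_const _) hint.integral_prod_left]
  simp

end Model

/-! ### Expansion of Poisson expectations -/

section PoissonExpectation

theorem annihilation_congr_measure {S : Type*} [MeasurableSpace S] {μ μ' : Measure S}
    [IsFiniteMeasure μ] [IsFiniteMeasure μ'] (h : μ = μ') (w : bddMeas S) :
    annihilation μ w = annihilation μ' w := by
  subst h; rfl

variable {d : ℕ} (Λ : TopologicalSpace.Compacts (EuclideanSpace ℝ (Fin d)))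

/-- A set of marked configurations is measurable exactly when its section in each particle number
is. -/
theorem MarkedConfig.measurable_of_mk {β : Type*} [MeasurableSpace β] {f : MarkedConfig d → β}
    (h : ∀ n, Measurable fun v : Fin n → EuclideanSpace ℝ (Fin d) × ℝ => f ⟨n, v⟩) :
    Measurable f := fun s hs => by
  change MeasurableSet[⨅ n, MeasurableSpace.map (Sigma.mk n) inferInstance] (f ⁻¹' s)
  rw [MeasurableSpace.measurableSet_iInf]
  exact fun n => h n hs

theorem MarkedConfig.measurable_mk (n : ℕ) :
    Measurable fun v : Fin n → EuclideanSpace ℝ (Fin d) × ℝ => (⟨n, v⟩ : MarkedConfig d) :=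
  fun s hs => by
    change MeasurableSet[⨅ n, MeasurableSpace.map (Sigma.mk n) inferInstance] s at hs
    rw [MeasurableSpace.measurableSet_iInf] at hs
    exact hs n

theorem charFunctional_eq_div (z β : ℝ) (r ν : Measure ℝ)
    (G : EuclideanSpace ℝ (Fin d) → ℝ) (η : FiniteConfig d) :
    charFunctional z β r ν G Λ η =
      (∫ γ, Complex.exp (Complex.I * ((η.sum fun x a => a * staticField G γ x : ℝ) : ℂ)) *
        Complex.exp (-β * interaction G ν Λ γ) ∂poissonNoiseLaw z r Λ) /
      ((∫ γ, Real.exp (-β * interaction G ν Λ γ) ∂poissonNoiseLaw z r Λ : ℝ) : ℂ) := by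
  rw [charFunctional, interactingLaw, integral_tilted, ← integral_div]
  refine integral_congr_ae (.of_forall fun γ => ?_)
  simp only [Complex.real_smul, Complex.ofReal_div, Complex.ofReal_exp, Complex.ofReal_mul,
    Complex.ofReal_neg]
  ring

variable (z : ℝ) (r : Measure ℝ) [IsProbabilityMeasure r]

theorem hasSum_poisson_weight (x : ℝ) :
    HasSum (fun n : ℕ => Real.exp (-x) * (x ^ n / n.factorial)) 1 := by
  have h := (NormedSpace.expSeries_div_hasSum_exp x).mul_left (Real.exp (-x))
  rwa [← Real.exp_eq_exp_ℝ, ← Real.exp_add, neg_add_cancel, Real.exp_zero] at h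

theorem isProbabilityMeasure_poissonNoiseLaw (hz : 0 ≤ z) :
    IsProbabilityMeasure (poissonNoiseLaw z r Λ) := by
  constructor
  set L := volume.real (Λ : Set (EuclideanSpace ℝ (Fin d))) with hL
  have hL0 : 0 ≤ L := measureReal_nonneg
  have hLe : volume (Λ : Set (EuclideanSpace ℝ (Fin d))) = ENNReal.ofReal L :=
    (ENNReal.ofReal_toReal Λ.isCompact.measure_lt_top.ne).symm
  have hterm : ∀ n : ℕ, (ENNReal.ofReal (Real.exp (-(z * L)) * (z ^ n / (n.factorial : ℝ))) •
      (Measure.pi fun _ : Fin n =>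
        (volume.restrict (Λ : Set (EuclideanSpace ℝ (Fin d)))).prod r).map
          fun v => (⟨n, v⟩ : MarkedConfig d)) Set.univ =
      ENNReal.ofReal (Real.exp (-(z * L)) * ((z * L) ^ n / (n.factorial : ℝ))) := by
    intro n
    rw [Measure.smul_apply, Measure.map_apply (MarkedConfig.measurable_mk n) .univ,
      Set.preimage_univ, Measure.pi_univ, smul_eq_mul]
    simp only [← Set.univ_prod_univ, Measure.prod_prod, measure_univ, mul_one,
      Measure.restrict_apply_univ, Finset.prod_const, Finset.card_univ, Fintype.card_fin]
    rw [hLe, ← ENNReal.ofReal_pow hL0, ← ENNReal.ofReal_mul (by positivity)]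
    congr 1
    rw [mul_pow]
    ring
  rw [poissonNoiseLaw, Measure.sum_apply _ .univ]
  refine (tsum_congr hterm).trans ?_
  rw [← ENNReal.ofReal_tsum_of_nonneg (fun n => by positivity) (hasSum_poisson_weight _).summable,
    (hasSum_poisson_weight _).tsum_eq, ENNReal.ofReal_one]

theorem integral_poissonNoiseLaw (hz : 0 ≤ z) {f : MarkedConfig d → ℂ} (hf : Measurable f)
    {C : ℝ} (hC : ∀ γ, ‖f γ‖ ≤ C) :
    ∫ γ, f γ ∂poissonNoiseLaw z r Λ = ∑' n : ℕ,
      ((Real.exp (-(z * volume.real (Λ : Set (EuclideanSpace ℝ (Fin d))))) *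
        (z ^ n / n.factorial) : ℝ) : ℂ) *
      ∫ v, f ⟨n, v⟩ ∂(Measure.pi fun _ : Fin n =>
        (volume.restrict (Λ : Set (EuclideanSpace ℝ (Fin d)))).prod r) := by
  have := isProbabilityMeasure_poissonNoiseLaw Λ z r hz
  have hint : Integrable f (poissonNoiseLaw z r Λ) :=
    Integrable.of_bound (C := C) hf.aestronglyMeasurable (.of_forall hC)
  rw [poissonNoiseLaw] at hint ⊢
  rw [integral_sum_measure hint]
  refine tsum_congr fun n => ?_
  rw [integral_smul_measure, integral_map (MarkedConfig.measurable_mk n).aemeasurable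
    hf.aestronglyMeasurable, ENNReal.toReal_ofReal (by positivity)]
  exact Complex.real_smul

variable {G : EuclideanSpace ℝ (Fin d) → ℝ} (hG : Measurable G) (ν : Measure ℝ)
  [IsProbabilityMeasure ν]

include hG in
theorem measurable_interaction : Measurable (interaction G ν Λ) := by
  refine MarkedConfig.measurable_of_mk fun n => ?_
  have h := (measurable_trigEnergy ν).comp (measurable_staticField_mk hG n)
  exact h.stronglyMeasurable.integral_prod_right'.measurable

include hG in
theorem measurable_staticField (x : EuclideanSpace ℝ (Fin d)) :
    Measurable fun γ => staticField G γ x :=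
  MarkedConfig.measurable_of_mk fun n =>
    (measurable_staticField_mk hG n).comp (measurable_id.prodMk measurable_const)

include hG in
theorem measurable_sum_staticField (η : FiniteConfig d) :
    Measurable fun γ => η.sum fun x a => a * staticField G γ x :=
  Finset.measurable_fun_sum _ fun x _ => (measurable_staticField hG x).const_mul _

variable (β : ℝ)

theorem exp_interaction_le (γ : MarkedConfig d) :
    Real.exp (-β * interaction G ν Λ γ) ≤
      Real.exp (|β| * (2 * volume.real (Λ : Set (EuclideanSpace ℝ (Fin d))))) := by
  refine Real.exp_le_exp.2 ((le_abs_self _).trans ?_)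
  rw [abs_mul, abs_neg]
  exact mul_le_mul_of_nonneg_left (abs_interaction_le Λ ν γ) (abs_nonneg _)

include hG in
theorem integrable_exp_interaction (hz : 0 ≤ z) :
    Integrable (fun γ => Real.exp (-β * interaction G ν Λ γ)) (poissonNoiseLaw z r Λ) := by
  have := isProbabilityMeasure_poissonNoiseLaw Λ z r hz
  refine Integrable.of_bound
    (Real.measurable_exp.comp ((measurable_interaction Λ hG ν).const_mul _)).aestronglyMeasurable
    (Real.exp (|β| * (2 * volume.real (Λ : Set (EuclideanSpace ℝ (Fin d))))))
    (.of_forall fun γ => ?_)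
  rw [Real.norm_of_nonneg (Real.exp_pos _).le]
  exact exp_interaction_le Λ ν β γ

include hG in
theorem isProbabilityMeasure_interactingLaw (hz : 0 ≤ z) :
    IsProbabilityMeasure (interactingLaw z β r ν G Λ) := by
  have := isProbabilityMeasure_poissonNoiseLaw Λ z r hz
  exact isProbabilityMeasure_tilted (integrable_exp_interaction Λ z r hG ν β hz)

/-- Expansion of the grand canonical expectation in the number of particles of both species. -/
theorem integral_exp_interaction_eq (hν : ν.map (fun α => -α) = ν) (hz : 0 ≤ z)
    (η : FiniteConfig d) :
    ∫ γ, Complex.exp (Complex.I * ((η.sum fun x a => a * staticField G γ x : ℝ) : ℂ)) *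
        Complex.exp (-β * interaction G ν Λ γ) ∂poissonNoiseLaw z r Λ =
      Complex.exp (-((z + β) * volume.real (Λ : Set (EuclideanSpace ℝ (Fin d))))) *
      ∑' n : ℕ × ℕ, (annPow ((chargeMeasure d r).restrict (window Λ))
        ((dualMeasure d ν).restrict (window Λ)) 1 n (mulProd (testFactor G hG η)
          (phaseWeight (pairPhase G) (measurable_pairPhase hG)))).1 0 *
        ((z : ℂ) ^ n.1 * (β : ℂ) ^ n.2) := by
  set L := volume.real (Λ : Set (EuclideanSpace ℝ (Fin d)))
  set μ₀ := (chargeMeasure d r).restrict (window Λ) with hμ₀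
  set μ₁ := (dualMeasure d ν).restrict (window Λ)
  set W := phaseWeight (pairPhase G) (measurable_pairPhase hG)
  set g := testFactor G hG η
  set m := (volume.restrict (Λ : Set (EuclideanSpace ℝ (Fin d)))).prod r
  have hg : ∀ q, ‖g.1 q‖ = 1 := fun q => Complex.norm_exp_I_mul_ofReal' _
  have hW : ∀ A, ‖(mulProd g W).1 A‖ ≤ 1 := fun A => by
    rw [mulProd_apply, norm_mul, norm_prod_map_eq_one hg, one_mul]
    exact (Complex.norm_exp_I_mul_ofReal' _).le
  have hμ₁ : ∀ᵐ q ∂μ₁, q.2.1 = 0 := ae_dualMeasure_restrict Λ ν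
  have hg₁ : ∀ᵐ q ∂μ₁, g.1 q = 1 := by
    filter_upwards [hμ₁] with q hq
    simp [g, testFactor, hq]
  -- The dual particles are integrated out first, at a fixed configuration of charges.
  let F : ℕ → configFun (Particle d) := fun j => divPow (annihilation μ₁ 1) j (mulProd g W)
  have hF : ∀ j A, ‖(F j).1 A‖ ≤ μ₁.real Set.univ ^ j / j.factorial := by
    intro j A
    have := norm_divPow_annihilation_le μ₁ 1 (fun _ => True) (by simp) j (mulProd g W) (C := 1)
      (N := Multiset.card A) (fun B _ _ => hW B) (A := A) (by simp) rfl
    simpa using this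
  -- the integrand as a series in `β`
  have hseries : ∀ γ : MarkedConfig d,
      Complex.exp (Complex.I * ((η.sum fun x a => a * staticField G γ x : ℝ) : ℂ)) *
        Complex.exp (-β * interaction G ν Λ γ) =
      Complex.exp (-(β * L)) * ∑' j : ℕ, (β : ℂ) ^ j * (F j).1 γ.particles := by
    intro γ
    set Q := ∫ q, Complex.exp (Complex.I * (q.2.2 * staticField G γ q.1 : ℝ)) ∂μ₁
    have h1 : ∀ j, (F j).1 γ.particles =
        Complex.exp (Complex.I * ((η.sum fun x a => a * staticField G γ x : ℝ) : ℂ)) *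
          (Q ^ j / j.factorial) := by
      intro j
      have h2 : F j = mulProd g (divPow (annihilation μ₁ 1) j W) := by
        have := congrArg (fun T => T W) (mulProd_commute_divPow hg₁ j).eq
        exact this.symm
      have h3 : (divPow (annihilation μ₁ 1) j W).1 γ.particles =
          (j.factorial : ℂ)⁻¹ * ((annihilation μ₁ 1 ^ j) W).1 γ.particles := rfl
      rw [h2, mulProd_apply, prod_testFactor_particles, h3,
        annihilation_pow_dual_particles hG μ₁ hμ₁ j γ, div_eq_inv_mul]
    have h4 : ∑' j : ℕ, (β : ℂ) ^ j * (F j).1 γ.particles =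
        Complex.exp (Complex.I * ((η.sum fun x a => a * staticField G γ x : ℝ) : ℂ)) *
          Complex.exp (β * Q) := by
      rw [Complex.exp_eq_exp_ℂ, ← (NormedSpace.expSeries_div_hasSum_exp ((β : ℂ) * Q)).tsum_eq,
        ← tsum_mul_left]
      refine tsum_congr fun j => ?_
      rw [h1, mul_pow, ← Complex.exp_eq_exp_ℂ]
      ring
    -- Hence `exp (-β V_Λ) = exp (-β L) exp (β Q)`: the constant part of `v` gives the prefactor,
    -- the Fourier part a dual gas with activity `β`.
    have hQ : (interaction G ν Λ γ : ℂ) = L - Q := coe_interaction Λ hG ν hν γ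
    have hexp : -(β : ℂ) * (L - Q) = -(β * L) + β * Q := by ring
    rw [h4, hQ, hexp, Complex.exp_add]
    ring
  have hmeas : Measurable fun γ : MarkedConfig d =>
      Complex.exp (Complex.I * ((η.sum fun x a => a * staticField G γ x : ℝ) : ℂ)) *
        Complex.exp (-β * interaction G ν Λ γ) := by
    have h1 := measurable_sum_staticField hG η
    have h2 := measurable_interaction Λ hG ν
    fun_prop
  have hbound : ∀ γ : MarkedConfig d,
      ‖Complex.exp (Complex.I * ((η.sum fun x a => a * staticField G γ x : ℝ) : ℂ)) *
        Complex.exp (-β * interaction G ν Λ γ)‖ ≤ Real.exp (|β| * (2 * L)) := by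
    intro γ
    rw [norm_mul, Complex.norm_exp_I_mul_ofReal', one_mul]
    have : (-β * interaction G ν Λ γ : ℂ) = ((-β * interaction G ν Λ γ : ℝ) : ℂ) := by
      push_cast; ring
    rw [this, Complex.norm_exp_ofReal]
    exact exp_interaction_le Λ ν β γ
  rw [integral_poissonNoiseLaw Λ z r hz hmeas hbound,
    (summable_norm_annPow μ₀ μ₁ hW z β).of_norm.tsum_prod, ← tsum_mul_left]
  refine tsum_congr fun n => ?_
  have hint : ∀ j : ℕ, ∫ v, (F j).1 (MarkedConfig.particles ⟨n, v⟩) ∂(Measure.pi fun _ : Fin n => m)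
      = ((annihilation μ₀ 1 ^ n) (F j)).1 0 := by
    intro j
    have h := integral_pi_eq_annihilation_pow m (measurable_chargeParticle (d := d)) n (F j)
    refine h.trans ?_
    rw [annihilation_congr_measure (chargeMeasure_restrict Λ r).symm]
  have hFm : ∀ j, Measurable fun v : Fin n → EuclideanSpace ℝ (Fin d) × ℝ =>
      (F j).1 (MarkedConfig.particles ⟨n, v⟩) := fun j =>
    ((F j).2.1 n).comp (measurable_pi_lambda _ fun i =>
      measurable_chargeParticle.comp (measurable_pi_apply i))
  have hb : ∀ j (v : Fin n → EuclideanSpace ℝ (Fin d) × ℝ),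
      ‖(β : ℂ) ^ j * (F j).1 (MarkedConfig.particles ⟨n, v⟩)‖ ≤
        (|β| * μ₁.real Set.univ) ^ j / j.factorial := by
    intro j v
    rw [norm_mul, norm_pow, Complex.norm_real, Real.norm_eq_abs, mul_pow, mul_div_assoc]
    exact mul_le_mul_of_nonneg_left (hF j _) (by positivity)
  have hFi : ∀ j, Integrable (fun v : Fin n → EuclideanSpace ℝ (Fin d) × ℝ =>
      (β : ℂ) ^ j * (F j).1 (MarkedConfig.particles ⟨n, v⟩)) (Measure.pi fun _ : Fin n => m) :=
    fun j => Integrable.of_bound ((hFm j).const_mul _).aestronglyMeasurable _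
      (.of_forall (hb j))
  -- The sum over dual particles is exchanged with the integral over the charges, the bounds `hb`
  -- being summable in `j`.
  have hswap : ∫ v, Complex.exp (Complex.I *
        ((η.sum fun x a => a * staticField G ⟨n, v⟩ x : ℝ) : ℂ)) *
        Complex.exp (-β * interaction G ν Λ ⟨n, v⟩) ∂(Measure.pi fun _ : Fin n => m) =
      Complex.exp (-(β * L)) * ∑' j : ℕ, (β : ℂ) ^ j * ((annihilation μ₀ 1 ^ n) (F j)).1 0 := by
    simp_rw [hseries]
    rw [integral_const_mul]
    congr 1
    rw [← integral_tsum_of_summable_integral_norm hFi]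
    · refine tsum_congr fun j => ?_
      rw [integral_const_mul, hint j]
    · refine .of_nonneg_of_le (fun j => integral_nonneg fun _ => norm_nonneg _) (fun j => ?_)
        ((Real.summable_pow_div_factorial (|β| * μ₁.real Set.univ)).mul_right
          ((Measure.pi fun _ : Fin n => m).real Set.univ))
      refine (integral_mono (hFi j).norm (integrable_const _) (hb j)).trans (le_of_eq ?_)
      rw [integral_const, smul_eq_mul, mul_comm]
  rw [hswap, ← tsum_mul_left, ← tsum_mul_left, ← tsum_mul_left]
  refine tsum_congr fun j => ?_
  have hann : (annPow μ₀ μ₁ 1 (n, j) (mulProd g W)).1 0 =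
      (n.factorial : ℂ)⁻¹ * ((annihilation μ₀ 1 ^ n) (F j)).1 0 := rfl
  rw [hann]
  push_cast
  have hexp : Complex.exp (-((z + β) * L : ℂ)) =
      Complex.exp (-(z * L)) * Complex.exp (-(β * L)) := by
    rw [← Complex.exp_add]; congr 1; ring
  have hL : volume.real (Λ : Set (EuclideanSpace ℝ (Fin d))) = L := rfl
  rw [hexp, hL]
  ring

end PoissonExpectation

/-! ### Bounds on the coefficients of expectations -/

section CorrelationSeries

variable {S : Type*} [MeasurableSpace S] {μ₀ μ₁ : Measure S} [IsFiniteMeasure μ₀]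
  [IsFiniteMeasure μ₁] {κ : S → S → ℝ} {hκ : Measurable (Function.uncurry κ)} {U : ℕ × ℕ → ℂ}
  {P : S → Prop} {R₀ R₁ : ℝ}

theorem norm_ite_eq_zero_le (hR₀ : 0 < R₀) (hR₁ : 0 < R₁) (n : ℕ × ℕ) :
    ‖(if n = 0 then 1 else 0 : ℂ)‖ ≤ R₀⁻¹ ^ n.1 * R₁⁻¹ ^ n.2 := by
  split_ifs with h
  · simp [h]
  · simpa using by positivity

theorem KirkwoodSalsburgCondition.norm_corrCoeffProd_le
    (h : KirkwoodSalsburgCondition κ hκ μ₀ μ₁ P R₀ R₁) (hU : IsInversePartition μ₀ μ₁ κ hκ U)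
    (g : bddMeas S) (n : ℕ × ℕ) :
    ‖(corrCoeffProd μ₀ μ₁ κ hκ U g n).1 0‖ ≤ R₀⁻¹ ^ n.1 * R₁⁻¹ ^ n.2 * Real.exp (Real.exp 1 *
        (R₀ * ∫ q, ‖(g - 1).1 q‖ ∂μ₀ + R₁ * ∫ q, ‖(g - 1).1 q‖ ∂μ₁)) := by
  have h1 := norm_corrCoeffProd_sub_le hU P h.ae₀ h.ae₁ h.pos₀ h.pos₁ h.le_one g n
  have h2 := norm_ite_eq_zero_le h.pos₀ h.pos₁ n
  have h3 := norm_le_norm_sub_add ((corrCoeffProd μ₀ μ₁ κ hκ U g n).1 0) (if n = 0 then 1 else 0)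
  rw [mul_sub, mul_one] at h1
  linarith

end CorrelationSeries

/-! ### Series for the finite-volume characteristic functional -/

section FiniteVolume

variable {d : ℕ} (Λ : TopologicalSpace.Compacts (EuclideanSpace ℝ (Fin d)))
  (z : ℝ) (r : Measure ℝ) [IsProbabilityMeasure r]
  {G : EuclideanSpace ℝ (Fin d) → ℝ} (hG : Measurable G) (ν : Measure ℝ)
  [IsProbabilityMeasure ν] (β : ℝ)

theorem mulProd_testFactor_zero (F : configFun (Particle d)) :
    mulProd (testFactor G hG 0) F = F := by
  refine Subtype.ext (funext fun A => ?_)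
  rw [mulProd_apply]
  have : ∀ q ∈ A, (testFactor G hG 0).1 q = 1 := fun q _ => by simp [testFactor, testField]
  rw [Multiset.map_congr rfl this]
  simp

/-- The Mayer type expansion of the finite-volume characteristic functional. -/
theorem charFunctional_eq_tsum (hν : ν.map (fun α => -α) = ν) (hz : 0 ≤ z) (η : FiniteConfig d)
    {U : ℕ × ℕ → ℂ} (hU : IsInversePartition ((chargeMeasure d r).restrict (window Λ))
      ((dualMeasure d ν).restrict (window Λ)) (pairPhase G) (measurable_pairPhase hG) U)
    {P : Particle d → Prop} {R₀ R₁ : ℝ}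
    (hR : KirkwoodSalsburgCondition (pairPhase G) (measurable_pairPhase hG)
      ((chargeMeasure d r).restrict (window Λ)) ((dualMeasure d ν).restrict (window Λ)) P R₀ R₁)
    (hzR : |z| < R₀) (hβR : |β| < R₁) :
    charFunctional z β r ν G Λ η = ∑' n : ℕ × ℕ,
      (corrCoeffProd ((chargeMeasure d r).restrict (window Λ))
        ((dualMeasure d ν).restrict (window Λ)) (pairPhase G) (measurable_pairPhase hG) U
        (testFactor G hG η) n).1 0 * ((z : ℂ) ^ n.1 * (β : ℂ) ^ n.2) := by
  have hΞ : 0 < ∫ γ, Real.exp (-β * interaction G ν Λ γ) ∂poissonNoiseLaw z r Λ := by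
    have := isProbabilityMeasure_poissonNoiseLaw Λ z r hz
    exact integral_exp_pos (integrable_exp_interaction Λ z r hG ν β hz)
  -- The partition function is the unnormalized expectation for `η = 0`, so the same expansion
  -- applies to it.
  have hΞ0 : ((∫ γ, Real.exp (-β * interaction G ν Λ γ) ∂poissonNoiseLaw z r Λ : ℝ) : ℂ) =
      ∫ γ, Complex.exp (Complex.I * (((0 : FiniteConfig d).sum fun x a =>
        a * staticField G γ x : ℝ) : ℂ)) *
        Complex.exp (-β * interaction G ν Λ γ) ∂poissonNoiseLaw z r Λ := by
    rw [← integral_complex_ofReal]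
    simp
  have hΞ' := Complex.ofReal_ne_zero.2 hΞ.ne'
  -- The quotient is checked in the form numerator = series times partition function, by a Cauchy
  -- product. Only positivity of the partition function at the given real `z` and `β` is needed, not
  -- convergence of the formal inverse `U`.
  rw [charFunctional_eq_div, div_eq_iff hΞ', hΞ0,
    integral_exp_interaction_eq Λ z r hG ν β hν hz, integral_exp_interaction_eq Λ z r hG ν β hν hz,
    mulProd_testFactor_zero, mul_left_comm,
    mul_comm (∑' n : ℕ × ℕ, (corrCoeffProd _ _ _ _ _ _ _).1 0 * _), tsum_bivariate_mul]
  · simp_rw [sum_antidiagonal_annPow_mul_corrCoeffProd hU]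
  · exact summable_norm_annPow _ _ (fun A => (Complex.norm_exp_I_mul_ofReal' _).le) _ _
  · exact summable_norm_bivariate hR.pos₀ hR.pos₁ (hR.norm_corrCoeffProd_le hU _)
      (by simpa using hzR) (by simpa using hβR)

end FiniteVolume

/-! ### From the Mayer constants to the radii -/

section MayerConstants

theorem measurable_bddMeas {S : Type*} [MeasurableSpace S] (w : bddMeas S) : Measurable w.1 := w.2.1

/-- A radius strictly above `x` leaves room for a geometric series. The bound is a product, so that
`C = 0` needs no separate treatment. -/
theorem exists_radius_of_lt_convRadius {C : ENNReal} {x : ENNReal} (h : x < convRadius C) :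
    ∃ R : ℝ, 0 < R ∧ x < ENNReal.ofReal R ∧
      ENNReal.ofReal (Real.exp 1) * (ENNReal.ofReal R * C) ≤ 1 := by
  obtain ⟨R, hxR, hR⟩ := ENNReal.lt_iff_exists_nnreal_btwn.1 h
  refine ⟨R, ?_, by simpa using hxR, ?_⟩
  · exact_mod_cast (zero_le (a := x)).trans_lt hxR
  · have := ENNReal.mul_le_of_le_div hR.le
    rw [ENNReal.ofReal_coe_nnreal]
    calc _ = (R : ENNReal) * (ENNReal.ofReal (Real.exp 1) * C) := by ring
      _ ≤ 1 := this

theorem toReal_radius_mul_le {C x : ENNReal} {R : ℝ} (hR : 0 < R) (hx : x ≤ C)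
    (h : ENNReal.ofReal (Real.exp 1) * (ENNReal.ofReal R * C) ≤ 1) :
    Real.exp 1 * (R * x.toReal) ≤ 1 ∧ x < ⊤ := by
  have h1 : ENNReal.ofReal (Real.exp 1) * (ENNReal.ofReal R * x) ≤ 1 := le_trans (by gcongr) h
  constructor
  · have := ENNReal.toReal_mono ENNReal.one_ne_top h1
    simpa [ENNReal.toReal_mul, hR.le, (Real.exp_pos 1).le] using this
  · by_contra hx'
    rw [not_lt, top_le_iff] at hx'
    rw [hx', ENNReal.mul_top (by simpa using hR), ENNReal.mul_top (by simpa using Real.exp_pos 1)]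
      at h1
    exact absurd h1 (by simp)

variable {d : ℕ} {r ν : Measure ℝ} [IsProbabilityMeasure r] [IsProbabilityMeasure ν]
  {G : EuclideanSpace ℝ (Fin d) → ℝ} (hG : Measurable G)

theorem lintegral_chargeMeasure (r : Measure ℝ) [SFinite r] {f : Particle d → ENNReal}
    (hf : Measurable f) : ∫⁻ q, f q ∂chargeMeasure d r = ∫⁻ y, ∫⁻ s, f (y, s, 0) ∂r := by
  rw [chargeMeasure, lintegral_map hf measurable_chargeParticle,
    lintegral_prod (fun x => f (chargeParticle x))
      (hf.comp measurable_chargeParticle).aemeasurable]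
  rfl

theorem lintegral_dualMeasure (ν : Measure ℝ) [SFinite ν] {f : Particle d → ENNReal}
    (hf : Measurable f) : ∫⁻ q, f q ∂dualMeasure d ν = ∫⁻ y, ∫⁻ α, f (y, 0, α) ∂ν := by
  rw [dualMeasure, lintegral_map hf measurable_dualParticle,
    lintegral_prod (fun x => f (dualParticle x))
      (hf.comp measurable_dualParticle).aemeasurable]
  rfl

theorem measurable_enorm_sub_one (w : bddMeas (Particle d)) :
    Measurable fun q => ‖(w - 1).1 q‖ₑ := (w - 1).2.1.enorm

theorem lintegral_pairFactor_charge_self {p : Particle d} (hp : p.2.2 = 0) :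
    ∫⁻ q, ‖(pairFactor (pairPhase G) (measurable_pairPhase hG) p - 1).1 q‖ₑ
      ∂chargeMeasure d r = 0 := by
  rw [lintegral_chargeMeasure r (measurable_enorm_sub_one _)]
  simp [pairFactor, pairPhase, hp]

theorem lintegral_pairFactor_dual_self {p : Particle d} (hp : p.2.1 = 0) :
    ∫⁻ q, ‖(pairFactor (pairPhase G) (measurable_pairPhase hG) p - 1).1 q‖ₑ
      ∂dualMeasure d ν = 0 := by
  rw [lintegral_dualMeasure ν (measurable_enorm_sub_one _)]
  simp [pairFactor, pairPhase, hp]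

omit [IsProbabilityMeasure r] in
-- The dual particle carries the first argument of the phase, so the kernel is `G (y - p.1)` and not
-- `G (y₀ - y)` as in `mayerConst`; translation and reflection invariance of Lebesgue measure
-- identify the integrals, here with base point 0.
theorem lintegral_pairFactor_charge_le {p : Particle d} (hp : p.2.2 = 0) (hs : p.2.1 ∈ r.support) :
    ∫⁻ q, ‖(pairFactor (pairPhase G) (measurable_pairPhase hG) p - 1).1 q‖ₑ
      ∂dualMeasure d ν ≤ mayerConst G r ν := by
  rw [lintegral_dualMeasure ν (measurable_enorm_sub_one _), mayerConst]
  refine le_trans (le_of_eq ?_) (le_iSup₂_of_le (0 : EuclideanSpace ℝ (Fin d)) p.2.1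
    (le_iSup_of_le hs le_rfl))
  have h := lintegral_sub_right_eq_self (μ := (volume : Measure (EuclideanSpace ℝ (Fin d))))
    (fun y => ∫⁻ α : ℝ, ‖Complex.exp (Complex.I * ((p.2.1 * α * G y : ℝ) : ℂ)) - 1‖ₑ ∂ν) p.1
  have h' := lintegral_sub_left_eq_self (μ := (volume : Measure (EuclideanSpace ℝ (Fin d))))
    (fun y => ∫⁻ α : ℝ, ‖Complex.exp (Complex.I * ((p.2.1 * α * G y : ℝ) : ℂ)) - 1‖ₑ ∂ν) 0
  rw [h', ← h]
  simp [pairFactor, pairPhase, hp]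

omit [IsProbabilityMeasure ν] in
theorem lintegral_pairFactor_dual_le {p : Particle d} (hp : p.2.1 = 0) (hs : p.2.2 ∈ ν.support) :
    ∫⁻ q, ‖(pairFactor (pairPhase G) (measurable_pairPhase hG) p - 1).1 q‖ₑ
      ∂chargeMeasure d r ≤ mayerConst G ν r := by
  rw [lintegral_chargeMeasure r (measurable_enorm_sub_one _), mayerConst]
  refine le_trans (le_of_eq ?_) (le_iSup₂_of_le p.1 p.2.2 (le_iSup_of_le hs le_rfl))
  simp [pairFactor, pairPhase, hp, mul_comm]

/-- The set of particles of either species with charges in the supports of the charge laws. -/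
def IsAdmissible (r ν : Measure ℝ) (p : Particle d) : Prop :=
  (p.2.2 = 0 ∧ p.2.1 ∈ r.support) ∨ (p.2.1 = 0 ∧ p.2.2 ∈ ν.support)

theorem measurableSet_isAdmissible (r ν : Measure ℝ) :
    MeasurableSet {p : Particle d | IsAdmissible r ν p} := by
  have h1 : Measurable fun p : Particle d => p.2.1 := by fun_prop
  have h2 : Measurable fun p : Particle d => p.2.2 := by fun_prop
  exact ((h2 (measurableSet_singleton 0)).inter (h1 r.isClosed_support.measurableSet)).union
    ((h1 (measurableSet_singleton 0)).inter (h2 ν.isClosed_support.measurableSet))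

omit [IsProbabilityMeasure r] [IsProbabilityMeasure ν] in
theorem ae_chargeMeasure_isAdmissible : ∀ᵐ p ∂chargeMeasure d r, IsAdmissible r ν p := by
  refine (ae_map_iff measurable_chargeParticle.aemeasurable (measurableSet_isAdmissible r ν)).2 ?_
  have h : ∀ᵐ x ∂((volume : Measure (EuclideanSpace ℝ (Fin d))).prod r), x.2 ∈ r.support :=
    Measure.quasiMeasurePreserving_snd.ae Measure.support_mem_ae
  filter_upwards [h] with x hx
  exact .inl ⟨rfl, hx⟩

omit [IsProbabilityMeasure r] [IsProbabilityMeasure ν] in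
theorem ae_dualMeasure_isAdmissible : ∀ᵐ p ∂dualMeasure d ν, IsAdmissible r ν p := by
  refine (ae_map_iff measurable_dualParticle.aemeasurable (measurableSet_isAdmissible r ν)).2 ?_
  have h : ∀ᵐ x ∂((volume : Measure (EuclideanSpace ℝ (Fin d))).prod ν), x.2 ∈ ν.support :=
    Measure.quasiMeasurePreserving_snd.ae Measure.support_mem_ae
  filter_upwards [h] with x hx
  exact .inr ⟨rfl, hx⟩

/-- For a charge the integral over charges vanishes and the other is at most `mayerConst G r ν`; for
a dual particle the roles are exchanged. So the smallness condition decouples into one condition on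
each radius. -/
theorem kirkwoodSalsburgCondition_isAdmissible {R₀ R₁ : ℝ} (hR₀ : 0 < R₀) (hR₁ : 0 < R₁)
    (h₀ : ENNReal.ofReal (Real.exp 1) * (ENNReal.ofReal R₀ * mayerConst G ν r) ≤ 1)
    (h₁ : ENNReal.ofReal (Real.exp 1) * (ENNReal.ofReal R₁ * mayerConst G r ν) ≤ 1) :
    KirkwoodSalsburgCondition (pairPhase G) (measurable_pairPhase hG) (chargeMeasure d r)
      (dualMeasure d ν) (IsAdmissible r ν) R₀ R₁ where
  ae₀ := ae_chargeMeasure_isAdmissible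
  ae₁ := ae_dualMeasure_isAdmissible
  pos₀ := hR₀
  pos₁ := hR₁
  integrable₀ p hp := by
    refine ⟨(measurable_bddMeas _).aestronglyMeasurable, ?_⟩
    rw [HasFiniteIntegral]
    rcases hp with ⟨hp, hs⟩ | ⟨hp, hs⟩
    · rw [lintegral_pairFactor_charge_self hG hp]; exact ENNReal.zero_lt_top
    · exact (toReal_radius_mul_le hR₀ (lintegral_pairFactor_dual_le hG hp hs) h₀).2
  integrable₁ p hp := by
    refine ⟨(measurable_bddMeas _).aestronglyMeasurable, ?_⟩
    rw [HasFiniteIntegral]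
    rcases hp with ⟨hp, hs⟩ | ⟨hp, hs⟩
    · exact (toReal_radius_mul_le hR₁ (lintegral_pairFactor_charge_le hG hp hs) h₁).2
    · rw [lintegral_pairFactor_dual_self hG hp]; exact ENNReal.zero_lt_top
  le_one p hp := by
    rw [integral_norm_eq_lintegral_enorm (measurable_bddMeas _).aestronglyMeasurable,
      integral_norm_eq_lintegral_enorm (measurable_bddMeas _).aestronglyMeasurable]
    rcases hp with ⟨hp, hs⟩ | ⟨hp, hs⟩
    · rw [lintegral_pairFactor_charge_self hG hp]
      simpa using (toReal_radius_mul_le hR₁ (lintegral_pairFactor_charge_le hG hp hs) h₁).1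
    · rw [lintegral_pairFactor_dual_self hG hp]
      simpa using (toReal_radius_mul_le hR₀ (lintegral_pairFactor_dual_le hG hp hs) h₀).1

end MayerConstants

/-! ### Integrability of the test factor -/

section TestFactor

variable {d : ℕ} {G : EuclideanSpace ℝ (Fin d) → ℝ} (hG : Measurable G) (η : FiniteConfig d)

theorem testFactor_ae_dualMeasure (ν : Measure ℝ) [SFinite ν] :
    (testFactor G hG η - 1).1 =ᵐ[dualMeasure d ν] 0 := by
  refine (ae_map_iff measurable_dualParticle.aemeasurable ?_).2 (.of_forall fun x => ?_)
  · exact (Subtype.prop (testFactor G hG η - 1)).1 (measurableSet_singleton 0)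
  · simp [testFactor, dualParticle]

include hG in
theorem lintegral_testField_le :
    ∫⁻ y, ‖testField G η y‖ₑ ≤ (∑ x ∈ η.support, ‖η x‖ₑ) * ∫⁻ y, ‖G y‖ₑ := by
  have h : ∀ x, Measurable fun y => ‖G (x - y)‖ₑ := fun x =>
    (hG.comp (measurable_const.sub measurable_id)).enorm
  calc ∫⁻ y, ‖testField G η y‖ₑ ≤ ∫⁻ y, ∑ x ∈ η.support, ‖η x‖ₑ * ‖G (x - y)‖ₑ := by
        refine lintegral_mono fun y => ?_
        refine (enorm_sum_le _ _).trans (le_of_eq ?_)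
        simp [enorm_mul]
    _ = ∑ x ∈ η.support, ‖η x‖ₑ * ∫⁻ y, ‖G y‖ₑ := by
        rw [lintegral_finsetSum' _ fun x _ => (h x).const_mul _ |>.aemeasurable]
        refine Finset.sum_congr rfl fun x _ => ?_
        rw [lintegral_const_mul _ (h x), lintegral_sub_left_eq_self (fun y => ‖G y‖ₑ)]
    _ = _ := by rw [Finset.sum_mul]

variable {r : Measure ℝ} [IsProbabilityMeasure r] {c : ℝ} (hr : r (Set.Icc (-c) c)ᶜ = 0)

include hr in
-- From `|exp (i t) - 1| ≤ |t|` and `|s| ≤ c` almost surely. Here the bounded support of the Lévy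
-- measure and `G ∈ L¹` enter.
theorem lintegral_testFactor_le :
    ∫⁻ q, ‖(testFactor G hG η - 1).1 q‖ₑ ∂chargeMeasure d r ≤
      ENNReal.ofReal c * ((∑ x ∈ η.support, ‖η x‖ₑ) * ∫⁻ y, ‖G y‖ₑ) := by
  rw [lintegral_chargeMeasure r (measurable_enorm_sub_one _)]
  calc _ ≤ ∫⁻ y, ENNReal.ofReal c * ‖testField G η y‖ₑ := by
        refine lintegral_mono fun y => ?_
        have hae : ∀ᵐ s ∂r, s ∈ Set.Icc (-c) c := hr
        calc _ ≤ ∫⁻ _ : ℝ, ENNReal.ofReal c * ‖testField G η y‖ₑ ∂r := by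
              refine lintegral_mono_ae ?_
              filter_upwards [hae] with s hs
              have h1 : ‖(testFactor G hG η - 1).1 (y, s, 0)‖ ≤ c * ‖testField G η y‖ := by
                refine (Real.norm_exp_I_mul_ofReal_sub_one_le (x := s * testField G η y)).trans ?_
                rw [norm_mul]
                exact mul_le_mul_of_nonneg_right (abs_le.2 hs) (norm_nonneg _)
              have hc : 0 ≤ c := by linarith [hs.1, hs.2]
              rw [← ofReal_norm, ← ofReal_norm, ← ENNReal.ofReal_mul hc]
              exact ENNReal.ofReal_le_ofReal h1
          _ = _ := by simp
    _ = ENNReal.ofReal c * ∫⁻ y, ‖testField G η y‖ₑ :=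
        lintegral_const_mul _ (measurable_testField hG η).enorm
    _ ≤ _ := by gcongr; exact lintegral_testField_le hG η

variable (hGi : Integrable G)

include hr hGi in
theorem integrable_testFactor_sub_one :
    Integrable (testFactor G hG η - 1).1 (chargeMeasure d r) := by
  refine ⟨(measurable_bddMeas _).aestronglyMeasurable, ?_⟩
  refine (lintegral_testFactor_le hG η hr).trans_lt ?_
  have h1 : ∫⁻ y, ‖G y‖ₑ < ⊤ := hGi.2
  have h2 : ∑ x ∈ η.support, ‖η x‖ₑ < ⊤ := ENNReal.sum_lt_top.2 fun x _ => enorm_lt_top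
  exact ENNReal.mul_lt_top ENNReal.ofReal_lt_top (ENNReal.mul_lt_top h2 h1)

include hr hGi in
theorem integral_testFactor_sub_one_le :
    ∫ q, ‖(testFactor G hG η - 1).1 q‖ ∂chargeMeasure d r ≤
      max c 0 * ((∑ x ∈ η.support, |η x|) * ∫ y, |G y|) := by
  have h1 : ∫⁻ y, ‖G y‖ₑ < ⊤ := hGi.2
  have h2 : ∑ x ∈ η.support, ‖η x‖ₑ < ⊤ := ENNReal.sum_lt_top.2 fun x _ => enorm_lt_top
  have h := ENNReal.toReal_mono (ENNReal.mul_lt_top ENNReal.ofReal_lt_top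
    (ENNReal.mul_lt_top h2 h1)).ne (lintegral_testFactor_le hG η hr)
  rw [integral_norm_eq_lintegral_enorm (measurable_bddMeas _).aestronglyMeasurable]
  refine h.trans (le_of_eq ?_)
  rw [ENNReal.toReal_mul, ENNReal.toReal_mul, ENNReal.toReal_ofReal',
    ENNReal.toReal_sum fun x _ => enorm_ne_top]
  simp only [← Real.norm_eq_abs]
  rw [integral_norm_eq_lintegral_enorm hGi.1]
  simp

end TestFactor

/-! ### Exhaustion by compact balls -/

section CompactExhaustion

variable {E : Type*} [PseudoMetricSpace E] [ProperSpace E]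

/-- The closed ball of radius `n` as compact set. -/
def compactBall (x : E) (n : ℕ) : TopologicalSpace.Compacts E :=
  ⟨Metric.closedBall x n, isCompact_closedBall x n⟩

theorem exists_le_compactBall (x : E) (K : TopologicalSpace.Compacts E) :
    ∃ n, K ≤ compactBall x n := by
  obtain ⟨R, hR⟩ := K.isCompact.isBounded.subset_closedBall x
  obtain ⟨n, hn⟩ := exists_nat_ge R
  exact ⟨n, hR.trans (Metric.closedBall_subset_closedBall hn)⟩

theorem tendsto_compactBall (x : E) : Tendsto (compactBall x) atTop atTop :=
  tendsto_atTop_atTop_of_monotone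
    (fun _ _ h => Metric.closedBall_subset_closedBall (by exact_mod_cast h))
    (exists_le_compactBall x)

/-- Balls of integer radius are cofinal. Dominated convergence along the directed set of compact
sets requires a countably generated filter. -/
instance isCountablyGenerated_atTop_compacts [Nonempty E] :
    (atTop : Filter (TopologicalSpace.Compacts E)).IsCountablyGenerated := by
  obtain ⟨x⟩ := ‹Nonempty E›
  have h : (atTop : Filter (TopologicalSpace.Compacts E)) =
      ⨅ n : ℕ, 𝓟 (Set.Ici (compactBall x n)) := by
    refine le_antisymm (le_iInf fun n => le_principal_iff.2 (Ici_mem_atTop _))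
      (le_iInf fun K => ?_)
    obtain ⟨n, hn⟩ := exists_le_compactBall x K
    exact iInf_le_of_le n (principal_mono.2 (Set.Ici_subset_Ici.2 hn))
  rw [h]
  infer_instance

end CompactExhaustion

/-! ### The limiting characteristic functional -/

section InfiniteVolumeLimit

variable {d : ℕ}

theorem eventually_mem_window (q : Particle d) :
    ∀ᶠ Λ in (atTop : Filter (TopologicalSpace.Compacts (EuclideanSpace ℝ (Fin d)))),
      q ∈ window Λ := by
  filter_upwards [Ici_mem_atTop (⟨{q.1}, isCompact_singleton⟩ :
    TopologicalSpace.Compacts (EuclideanSpace ℝ (Fin d)))] with Λ hΛ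
  exact hΛ (Set.mem_singleton q.1)

variable (r ν : Measure ℝ) [IsProbabilityMeasure r] [IsProbabilityMeasure ν]
  {G : EuclideanSpace ℝ (Fin d) → ℝ} (hG : Measurable G) (η : FiniteConfig d)

/-- The Taylor coefficients in `z` and `β` of the finite-volume characteristic functional. -/
noncomputable def finiteVolumeCoeff (Λ : TopologicalSpace.Compacts (EuclideanSpace ℝ (Fin d)))
    (n : ℕ × ℕ) : ℂ :=
  (corrCoeffProd ((chargeMeasure d r).restrict (window Λ)) ((dualMeasure d ν).restrict (window Λ))
    (pairPhase G) (measurable_pairPhase hG) (exists_isInversePartition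
      ((chargeMeasure d r).restrict (window Λ)) ((dualMeasure d ν).restrict (window Λ))
      (pairPhase G) (measurable_pairPhase hG)).choose (testFactor G hG η) n).1 0

/-- The Taylor coefficients in `z` and `β` of the infinite-volume characteristic functional. -/
noncomputable def infiniteVolumeCoeff (n : ℕ × ℕ) : ℂ :=
  limUnder atTop fun Λ => finiteVolumeCoeff r ν hG η Λ n

variable {r ν} {c : ℝ} (hr : r (Set.Icc (-c) c)ᶜ = 0) (hGi : Integrable G) {R₀ R₁ : ℝ}
  (hR : KirkwoodSalsburgCondition (pairPhase G) (measurable_pairPhase hG) (chargeMeasure d r)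
    (dualMeasure d ν) (IsAdmissible r ν) R₀ R₁)

include hr hGi hR in
theorem tendsto_finiteVolumeCoeff (n : ℕ × ℕ) :
    Tendsto (fun Λ => finiteVolumeCoeff r ν hG η Λ n) atTop
      (𝓝 (infiniteVolumeCoeff r ν hG η n)) := by
  obtain ⟨c, hc⟩ := exists_tendsto_corrCoeffProd (l := atTop)
    (K := fun Λ : TopologicalSpace.Compacts (EuclideanSpace ℝ (Fin d)) => window Λ)
    measurableSet_window eventually_mem_window hR
    (fun Λ => (exists_isInversePartition
      ((chargeMeasure d r).restrict (window Λ)) ((dualMeasure d ν).restrict (window Λ))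
      (pairPhase G) (measurable_pairPhase hG)).choose_spec)
    (testFactor G hG η) (integrable_testFactor_sub_one hG η hr hGi)
    ((integrable_zero _ _ _).congr (testFactor_ae_dualMeasure hG η ν).symm) n
  exact tendsto_nhds_limUnder ⟨c, hc⟩

include hr hGi hR in
theorem norm_finiteVolumeCoeff_sub_le (Λ : TopologicalSpace.Compacts (EuclideanSpace ℝ (Fin d)))
    (n : ℕ × ℕ) :
    ‖finiteVolumeCoeff r ν hG η Λ n - if n = 0 then 1 else 0‖ ≤
      R₀⁻¹ ^ n.1 * R₁⁻¹ ^ n.2 * (Real.exp (Real.exp 1 * (R₀ *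
        (max c 0 * ((∑ x ∈ η.support, |η x|) * ∫ y, |G y|)))) - 1) := by
  have h := hR.restrict (window Λ)
  have hpos := hR.pos₀
  have hpos' := hR.pos₁
  refine (norm_corrCoeffProd_sub_le (exists_isInversePartition
      ((chargeMeasure d r).restrict (window Λ)) ((dualMeasure d ν).restrict (window Λ))
      (pairPhase G) (measurable_pairPhase hG)).choose_spec (IsAdmissible r ν) h.ae₀ h.ae₁ h.pos₀
      h.pos₁ h.le_one (testFactor G hG η) n).trans ?_
  refine mul_le_mul_of_nonneg_left (sub_le_sub_right (Real.exp_le_exp.2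
    (mul_le_mul_of_nonneg_left ?_ (Real.exp_pos 1).le)) _) (by positivity)
  have h1 : ∫ q, ‖(testFactor G hG η - 1).1 q‖ ∂(dualMeasure d ν).restrict (window Λ) = 0 := by
    rw [← integral_zero (Particle d) ℝ]
    refine integral_congr_ae ?_
    filter_upwards [ae_restrict_of_ae (testFactor_ae_dualMeasure hG η ν)] with q hq
    rw [hq]
    simp
  rw [h1, mul_zero, add_zero]
  refine mul_le_mul_of_nonneg_left ?_ hR.pos₀.le
  exact (setIntegral_le_integral (integrable_testFactor_sub_one hG η hr hGi).norm
    (.of_forall fun _ => norm_nonneg _)).trans (integral_testFactor_sub_one_le hG η hr hGi)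

include hr hGi hR in
theorem norm_finiteVolumeCoeff_le (Λ : TopologicalSpace.Compacts (EuclideanSpace ℝ (Fin d)))
    (n : ℕ × ℕ) :
    ‖finiteVolumeCoeff r ν hG η Λ n‖ ≤
      R₀⁻¹ ^ n.1 * R₁⁻¹ ^ n.2 * Real.exp (Real.exp 1 * (R₀ *
        (max c 0 * ((∑ x ∈ η.support, |η x|) * ∫ y, |G y|)))) := by
  have h1 := norm_finiteVolumeCoeff_sub_le hG η hr hGi hR Λ n
  have h2 := norm_ite_eq_zero_le hR.pos₀ hR.pos₁ n
  have h3 := norm_le_norm_sub_add (finiteVolumeCoeff r ν hG η Λ n) (if n = 0 then 1 else 0)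
  rw [mul_sub, mul_one] at h1
  linarith

include hr hGi hR in
theorem norm_infiniteVolumeCoeff_le (n : ℕ × ℕ) :
    ‖infiniteVolumeCoeff r ν hG η n‖ ≤
      R₀⁻¹ ^ n.1 * R₁⁻¹ ^ n.2 * Real.exp (Real.exp 1 * (R₀ *
        (max c 0 * ((∑ x ∈ η.support, |η x|) * ∫ y, |G y|)))) :=
  le_of_tendsto (tendsto_finiteVolumeCoeff hG η hr hGi hR n).norm
    (.of_forall fun Λ => norm_finiteVolumeCoeff_le hG η hr hGi hR Λ n)

variable {z β : ℝ} (hν : ν.map (fun α => -α) = ν) (hz : 0 ≤ z) (hzR : |z| < R₀) (hβR : |β| < R₁)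

include hR hν hz hzR hβR in
theorem charFunctional_eq_tsum_finiteVolumeCoeff
    (Λ : TopologicalSpace.Compacts (EuclideanSpace ℝ (Fin d))) :
    charFunctional z β r ν G Λ η = ∑' n : ℕ × ℕ,
      finiteVolumeCoeff r ν hG η Λ n * ((z : ℂ) ^ n.1 * (β : ℂ) ^ n.2) :=
  charFunctional_eq_tsum Λ z r hG ν β hν hz η (exists_isInversePartition
      ((chargeMeasure d r).restrict (window Λ)) ((dualMeasure d ν).restrict (window Λ))
      (pairPhase G) (measurable_pairPhase hG)).choose_spec (hR.restrict (window Λ)) hzR hβR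

theorem summable_bivariate_bound {x y R₀ R₁ : ℝ} (hx : |x| < R₀) (hy : |y| < R₁) (M : ℝ) :
    Summable fun n : ℕ × ℕ => R₀⁻¹ ^ n.1 * R₁⁻¹ ^ n.2 * M * (|x| ^ n.1 * |y| ^ n.2) := by
  have hR₀ : 0 < R₀ := (abs_nonneg _).trans_lt hx
  have hR₁ : 0 < R₁ := (abs_nonneg _).trans_lt hy
  have h := summable_norm_bivariate (a := fun n => ((R₀⁻¹ ^ n.1 * R₁⁻¹ ^ n.2 * |M| : ℝ) : ℂ))
    (M := |M|) hR₀ hR₁ (x := x) (y := y) (fun n => ?_) (by simpa using hx) (by simpa using hy)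
  · refine Summable.of_norm (h.congr fun n => ?_)
    simp only [norm_mul, norm_pow, Complex.norm_real, Real.norm_eq_abs, abs_abs]
  · rw [Complex.norm_real, Real.norm_of_nonneg (by positivity)]

include hr hGi hR hν hz hzR hβR in
/-- Existence of the infinite-volume limit. -/
theorem tendsto_charFunctional_tsum :
    Tendsto (fun Λ => charFunctional z β r ν G Λ η) atTop (𝓝 (∑' n : ℕ × ℕ,
      infiniteVolumeCoeff r ν hG η n * ((z : ℂ) ^ n.1 * (β : ℂ) ^ n.2))) := by
  simp_rw [charFunctional_eq_tsum_finiteVolumeCoeff hG η hR hν hz hzR hβR]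
  refine tendsto_tsum_of_dominated_convergence (summable_bivariate_bound hzR hβR
    (Real.exp (Real.exp 1 * (R₀ * (max c 0 * ((∑ x ∈ η.support, |η x|) * ∫ y, |G y|))))))
    (fun n => (tendsto_finiteVolumeCoeff hG η hr hGi hR n).mul_const _)
    (.of_forall fun Λ n => ?_)
  rw [norm_mul]
  refine mul_le_mul (norm_finiteVolumeCoeff_le hG η hr hGi hR Λ n) ?_ (norm_nonneg _)
    ((norm_nonneg _).trans (norm_finiteVolumeCoeff_le hG η hr hGi hR Λ n))
  simp

include hr hGi hR hν hz hzR hβR in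
theorem charFunctionalLimit_eq_tsum :
    charFunctionalLimit z β r ν G η = ∑' n : ℕ × ℕ,
      infiniteVolumeCoeff r ν hG η n * ((z : ℂ) ^ n.1 * (β : ℂ) ^ n.2) :=
  (tendsto_charFunctional_tsum hG η hr hGi hR hν hz hzR hβR).limUnder_eq

include hr hGi hR hν hz hzR hβR in
-- The constant 1 is subtracted coefficientwise as the series with a single nonzero coefficient at
-- `n = 0`. The bound is independent of `Λ` and passes to the limit.
theorem norm_charFunctional_sub_one_le
    (Λ : TopologicalSpace.Compacts (EuclideanSpace ℝ (Fin d))) :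
    ‖charFunctional z β r ν G Λ η - 1‖ ≤
      (∑' n : ℕ × ℕ, R₀⁻¹ ^ n.1 * R₁⁻¹ ^ n.2 * 1 * (|z| ^ n.1 * |β| ^ n.2)) *
      (Real.exp (Real.exp 1 * (R₀ *
        (max c 0 * ((∑ x ∈ η.support, |η x|) * ∫ y, |G y|)))) - 1) := by
  have hone : HasSum (fun n : ℕ × ℕ => (if n = 0 then 1 else 0 : ℂ) *
      ((z : ℂ) ^ n.1 * (β : ℂ) ^ n.2)) 1 := by
    convert hasSum_ite_eq (0 : ℕ × ℕ) (1 : ℂ) using 2 with n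
    split_ifs with h
    · simp [h]
    · simp
  have hs : Summable fun n : ℕ × ℕ =>
      finiteVolumeCoeff r ν hG η Λ n * ((z : ℂ) ^ n.1 * (β : ℂ) ^ n.2) :=
    (summable_norm_bivariate hR.pos₀ hR.pos₁ (norm_finiteVolumeCoeff_le hG η hr hGi hR Λ)
      (by simpa using hzR) (by simpa using hβR)).of_norm
  rw [charFunctional_eq_tsum_finiteVolumeCoeff hG η hR hν hz hzR hβR, ← hone.tsum_eq,
    ← hs.tsum_sub hone.summable, ← tsum_mul_right]
  refine tsum_of_norm_bounded ((summable_bivariate_bound hzR hβR 1).mul_right _).hasSum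
    fun n => ?_
  rw [← sub_mul, norm_mul]
  refine (mul_le_mul_of_nonneg_right (norm_finiteVolumeCoeff_sub_le hG η hr hGi hR Λ n)
    (norm_nonneg _)).trans (le_of_eq ?_)
  simp only [norm_mul, norm_pow, Complex.norm_real, Real.norm_eq_abs]
  ring

include hr hGi hR hν hz hzR hβR in
theorem norm_charFunctionalLimit_sub_one_le :
    ‖charFunctionalLimit z β r ν G η - 1‖ ≤
      (∑' n : ℕ × ℕ, R₀⁻¹ ^ n.1 * R₁⁻¹ ^ n.2 * 1 * (|z| ^ n.1 * |β| ^ n.2)) *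
      (Real.exp (Real.exp 1 * (R₀ *
        (max c 0 * ((∑ x ∈ η.support, |η x|) * ∫ y, |G y|)))) - 1) := by
  rw [charFunctionalLimit_eq_tsum hG η hr hGi hR hν hz hzR hβR]
  exact le_of_tendsto
    ((tendsto_charFunctional_tsum hG η hr hGi hR hν hz hzR hβR).sub_const 1).norm
    (.of_forall fun Λ => norm_charFunctional_sub_one_le hG η hr hGi hR hν hz hzR hβR Λ)

include hG hr hGi hR hν hz hzR hβR in
/-- Continuity at zero of the infinite-volume characteristic functional. -/
theorem tendsto_charFunctionalLimit_one {ι : Type*} [Fintype ι]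
    (x : ι → EuclideanSpace ℝ (Fin d)) :
    Tendsto (fun α : ι → ℝ =>
      charFunctionalLimit z β r ν G (∑ l, Finsupp.single (x l) (α l))) (𝓝 0) (𝓝 1) := by
  rw [tendsto_iff_norm_sub_tendsto_zero]
  set K := ∑' n : ℕ × ℕ, R₀⁻¹ ^ n.1 * R₁⁻¹ ^ n.2 * 1 * (|z| ^ n.1 * |β| ^ n.2)
  have hK : 0 ≤ K := by
    have := hR.pos₀
    have := hR.pos₁
    exact tsum_nonneg fun n => by positivity
  have hR₀ := hR.pos₀
  have hI : 0 ≤ ∫ y, |G y| := integral_nonneg fun _ => abs_nonneg _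
  refine squeeze_zero (g := fun α : ι → ℝ => K * (Real.exp (Real.exp 1 * (R₀ *
        (max c 0 * ((∑ l, |α l|) * ∫ y, |G y|)))) - 1)) (fun _ => norm_nonneg _) (fun α => ?_) ?_
  · refine (norm_charFunctionalLimit_sub_one_le hG _ hr hGi hR hν hz hzR hβR).trans ?_
    refine mul_le_mul_of_nonneg_left (sub_le_sub_right (Real.exp_le_exp.2
      (mul_le_mul_of_nonneg_left (mul_le_mul_of_nonneg_left (mul_le_mul_of_nonneg_left
      (mul_le_mul_of_nonneg_right ?_ hI) (le_max_right _ _)) hR₀.le) (Real.exp_pos 1).le)) _) hK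
    -- The points `x l` may coincide, so the masses of `η` are sums of the `α l`; the triangle
    -- inequality still bounds its total mass by `∑ |α l|`.
    set η : FiniteConfig d := ∑ l, Finsupp.single (x l) (α l)
    have h1 : ∀ y, |η y| ≤ ∑ l, |Finsupp.single (x l) (α l) y| := fun y => by
      simp only [η, Finsupp.coe_finsetSum, Finset.sum_apply]
      exact Finset.abs_sum_le_sum_abs _ _
    refine (Finset.sum_le_sum fun y _ => h1 y).trans ?_
    rw [Finset.sum_comm]
    refine Finset.sum_le_sum fun l _ => ?_
    classical
    simp only [Finsupp.single_apply, apply_ite abs, abs_zero]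
    rw [Finset.sum_ite_eq]
    split_ifs
    · exact le_rfl
    · exact abs_nonneg _
  · have hcont : Continuous fun α : ι → ℝ => K * (Real.exp (Real.exp 1 * (R₀ *
        (max c 0 * ((∑ l, |α l|) * ∫ y, |G y|)))) - 1) := by fun_prop
    simpa using hcont.tendsto 0

end InfiniteVolumeLimit

/-! ### Independence of the representative of `G` -/

section KernelCongr

variable {d : ℕ} {G G' : EuclideanSpace ℝ (Fin d) → ℝ} (h : G =ᵐ[volume] G')

include h in
theorem ae_sub_eq (x : EuclideanSpace ℝ (Fin d)) : ∀ᵐ y, G (x - y) = G' (x - y) :=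
  (quasiMeasurePreserving_sub_left volume x).ae h

include h in
theorem mayerConst_congr_ae (ρ μ : Measure ℝ) : mayerConst G ρ μ = mayerConst G' ρ μ := by
  refine iSup_congr fun y => iSup_congr fun s => iSup_congr fun _ => lintegral_congr_ae ?_
  filter_upwards [ae_sub_eq h y] with y' hy'
  rw [hy']

include h in
theorem interaction_congr_ae (ν : Measure ℝ)
    (Λ : TopologicalSpace.Compacts (EuclideanSpace ℝ (Fin d))) :
    interaction G ν Λ = interaction G' ν Λ := by
  funext γ
  refine integral_congr_ae (ae_restrict_of_ae ?_)
  have hj : ∀ᵐ x, ∀ j : Fin γ.1, G (x - (γ.2 j).1) = G' (x - (γ.2 j).1) :=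
    ae_all_iff.2 fun j => (measurePreserving_sub_right volume (γ.2 j).1).quasiMeasurePreserving.ae h
  filter_upwards [hj] with x hx
  simp only [staticField, hx]

include h in
-- The field at `x` involves point values of `G`, but the particle positions have an absolutely
-- continuous law, so almost surely no `x - yⱼ` falls into the null set where the two kernels
-- differ.
theorem ae_staticField_eq (z : ℝ) (r : Measure ℝ) [IsProbabilityMeasure r]
    (Λ : TopologicalSpace.Compacts (EuclideanSpace ℝ (Fin d))) (x : EuclideanSpace ℝ (Fin d)) :
    ∀ᵐ γ ∂poissonNoiseLaw z r Λ, staticField G γ x = staticField G' γ x := by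
  obtain ⟨N, hsub, hN, hN0⟩ := exists_measurable_superset_of_null (ae_iff.1 h)
  have hNc : ∀ᵐ y : EuclideanSpace ℝ (Fin d), y ∉ N := measure_eq_zero_iff_ae_notMem.1 hN0
  suffices hae : ∀ᵐ γ ∂poissonNoiseLaw z r Λ, ∀ j : Fin γ.1, x - (γ.2 j).1 ∉ N by
    filter_upwards [hae] with γ hγ
    refine Finset.sum_congr rfl fun j _ => ?_
    rw [not_not.1 fun hne => hγ j (hsub hne)]
  rw [poissonNoiseLaw, Measure.ae_sum_iff]
  intro n
  refine Measure.ae_smul_measure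
    ((ae_map_iff (MarkedConfig.measurable_mk n).aemeasurable ?_).2 ?_) _
  · change MeasurableSet[⨅ n, MeasurableSpace.map (Sigma.mk n) inferInstance] _
    rw [MeasurableSpace.measurableSet_iInf]
    intro m
    change MeasurableSet {v : Fin m → EuclideanSpace ℝ (Fin d) × ℝ | ∀ j, x - (v j).1 ∉ N}
    rw [Set.ofPred_forall]
    refine MeasurableSet.iInter fun j => ?_
    have hm : Measurable fun v : Fin m → EuclideanSpace ℝ (Fin d) × ℝ => x - (v j).1 :=
      measurable_const.sub (measurable_fst.comp (measurable_pi_apply j))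
    exact hm hN.compl
  · change ∀ᵐ v : Fin n → EuclideanSpace ℝ (Fin d) × ℝ ∂_, ∀ j, x - (v j).1 ∉ N
    refine ae_all_iff.2 fun j => ?_
    have h1 : ∀ᵐ y ∂(volume.restrict (Λ : Set (EuclideanSpace ℝ (Fin d)))), x - y ∉ N :=
      ae_restrict_of_ae ((quasiMeasurePreserving_sub_left volume x).ae hNc)
    have h2 : ∀ᵐ y ∂(volume.restrict (Λ : Set (EuclideanSpace ℝ (Fin d)))).prod r,
        x - y.1 ∉ N := Measure.quasiMeasurePreserving_fst.ae h1
    exact (Measure.quasiMeasurePreserving_eval (μ := fun _ : Fin n =>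
      (volume.restrict (Λ : Set (EuclideanSpace ℝ (Fin d)))).prod r) j).ae h2

include h in
theorem charFunctional_congr_ae (z β : ℝ) (r ν : Measure ℝ) [IsProbabilityMeasure r] :
    charFunctional z β r ν G = charFunctional z β r ν G' := by
  funext Λ η
  rw [charFunctional, charFunctional, interactingLaw, interactingLaw, interaction_congr_ae h]
  refine integral_congr_ae ((tilted_absolutelyContinuous _ _).ae_le ?_)
  have hx : ∀ᵐ γ ∂poissonNoiseLaw z r Λ, ∀ x ∈ η.support, staticField G γ x = staticField G' γ x :=
    (ae_ball_iff η.support.countable_toSet).2 fun x _ => ae_staticField_eq h z r Λ x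
  filter_upwards [hx] with γ hγ
  rw [Finsupp.sum, Finsupp.sum, Finset.sum_congr rfl fun x hxs => by rw [hγ x hxs]]

include h in
theorem charFunctionalLimit_congr_ae (z β : ℝ) (r ν : Measure ℝ) [IsProbabilityMeasure r] :
    charFunctionalLimit z β r ν G = charFunctionalLimit z β r ν G' := by
  funext η
  rw [charFunctionalLimit, charFunctionalLimit, charFunctional_congr_ae h]

end KernelCongr

/-! ### Finite-dimensional laws and the canonical measure -/

section FiniteDimensionalLaws

theorem Finsupp.sum_mul_finsetSum_single {ι J : Type*} [Fintype J] (x : J → ι) (α : J → ℝ)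
    (ω : ι → ℝ) :
    ((∑ j, Finsupp.single (x j) (α j) : ι →₀ ℝ).sum fun y a => a * ω y) =
      ∑ j, α j * ω (x j) := by
  have h : ∀ η : ι →₀ ℝ, (η.sum fun y a => a * ω y) = Finsupp.linearCombination ℝ ω η :=
    fun η => rfl
  rw [h, map_sum]
  simp

theorem Finsupp.finsetSum_single_coe {ι : Type*} {J : Finset ι} {η : ι →₀ ℝ}
    (h : η.support ⊆ J) : ∑ j : J, Finsupp.single (j : ι) (η j) = η := by
  rw [Finset.sum_coe_sort J fun j => Finsupp.single j (η j)]
  conv_rhs => rw [← Finsupp.sum_single η]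
  rw [Finsupp.sum_of_support_subset _ h _ (by simp)]

theorem Finsupp.sum_mul_eq_sum_coe {ι : Type*} {J : Finset ι} {η : ι →₀ ℝ}
    (h : η.support ⊆ J) (ω : ι → ℝ) :
    (η.sum fun y a => a * ω y) = ∑ j : J, η j * ω j := by
  conv_lhs => rw [← Finsupp.finsetSum_single_coe h]
  rw [Finsupp.sum_mul_finsetSum_single]

theorem measurable_exp_sum {J : Type*} [Fintype J] (α : J → ℝ) : Measurable fun ω : J → ℝ =>
    Complex.exp (Complex.I * ((∑ j, α j * ω j : ℝ) : ℂ)) := by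
  fun_prop

theorem integral_exp_sum_eq_charFun {J : Type*} [Fintype J] (μ : Measure (J → ℝ)) (α : J → ℝ) :
    ∫ ω : J → ℝ, Complex.exp (Complex.I * ((∑ j, α j * ω j : ℝ) : ℂ)) ∂μ =
      charFun (μ.map (WithLp.toLp 2)) (WithLp.toLp 2 α) := by
  rw [charFun_apply, integral_map (by fun_prop) (by fun_prop)]
  refine integral_congr_ae (.of_forall fun ω => ?_)
  simp only [PiLp.inner_apply, RCLike.inner_apply, conj_trivial]
  rw [mul_comm]

theorem ext_of_integral_exp_sum {J : Type*} [Fintype J] {μ μ' : Measure (J → ℝ)}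
    [IsFiniteMeasure μ] [IsFiniteMeasure μ']
    (h : ∀ α : J → ℝ, ∫ ω : J → ℝ, Complex.exp (Complex.I * ((∑ j, α j * ω j : ℝ) : ℂ)) ∂μ =
      ∫ ω : J → ℝ, Complex.exp (Complex.I * ((∑ j, α j * ω j : ℝ) : ℂ)) ∂μ') : μ = μ' := by
  have h1 : μ.map (WithLp.toLp 2) = μ'.map (WithLp.toLp 2) := by
    refine Measure.ext_of_charFun (funext fun t => ?_)
    have := h t.ofLp
    rwa [integral_exp_sum_eq_charFun, integral_exp_sum_eq_charFun] at this
  have h2 := congrArg (Measure.map WithLp.ofLp) h1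
  rw [Measure.map_map (by fun_prop) (by fun_prop),
    Measure.map_map (by fun_prop) (by fun_prop)] at h2
  simpa [Function.comp_def] using h2

variable {d : ℕ} {C : FiniteConfig d → ℂ}

theorem IsFiniteDimLaws.integral_exp_eq
    {P : (J : Finset (EuclideanSpace ℝ (Fin d))) → Measure (J → ℝ)} (hP : IsFiniteDimLaws C P)
    {J : Finset (EuclideanSpace ℝ (Fin d))} {η : FiniteConfig d} (h : η.support ⊆ J) :
    ∫ ω : J → ℝ, Complex.exp (Complex.I * ((∑ j : J, η j * ω j : ℝ) : ℂ)) ∂(P J) = C η := by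
  rw [hP.charFun_eq J fun j => η j, Finsupp.finsetSum_single_coe h]

theorem IsFiniteDimLaws.unique
    {P P' : (J : Finset (EuclideanSpace ℝ (Fin d))) → Measure (J → ℝ)}
    (hP : IsFiniteDimLaws C P) (hP' : IsFiniteDimLaws C P') : P' = P := by
  funext J
  have := hP.isProbabilityMeasure J
  have := hP'.isProbabilityMeasure J
  exact ext_of_integral_exp_sum fun α => by rw [hP.charFun_eq, hP'.charFun_eq]

/-- The law on `I` and the marginal of the law on `J ⊇ I` have the same characteristic function,
since both evaluate `C` at one and the same signed measure supported in `I`. -/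
theorem isProjectiveMeasureFamily_of_charFun_eq
    {P : (J : Finset (EuclideanSpace ℝ (Fin d))) → Measure (J → ℝ)}
    (hP : ∀ J, IsProbabilityMeasure (P J))
    (hC : ∀ (J : Finset (EuclideanSpace ℝ (Fin d))) (α : J → ℝ),
      ∫ ω : J → ℝ, Complex.exp (Complex.I * ((∑ j, α j * ω j : ℝ) : ℂ)) ∂(P J) =
        C (∑ j : J, Finsupp.single (j : EuclideanSpace ℝ (Fin d)) (α j))) :
    IsProjectiveMeasureFamily (ι := EuclideanSpace ℝ (Fin d)) (α := fun _ => ℝ) P := by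
  classical
  intro J I hIJ
  have hm : Measurable (Finset.restrict₂ (π := fun _ : EuclideanSpace ℝ (Fin d) => ℝ) hIJ) :=
    Finset.measurable_restrict₂ hIJ
  have := Measure.isProbabilityMeasure_map (μ := P J) hm.aemeasurable
  refine ext_of_integral_exp_sum fun α => ?_
  rw [hC, integral_map hm.aemeasurable (measurable_exp_sum α).aestronglyMeasurable]
  set η : FiniteConfig d := ∑ i : I, Finsupp.single (i : EuclideanSpace ℝ (Fin d)) (α i) with hη
  have hsupp : η.support ⊆ J := by
    refine (Finsupp.support_finsetSum).trans (Finset.biUnion_subset.2 fun i _ => ?_)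
    exact Finsupp.support_single_subset.trans (Finset.singleton_subset_iff.2 (hIJ i.2))
  rw [← Finsupp.finsetSum_single_coe hsupp, ← hC J fun j => η j]
  refine integral_congr_ae (.of_forall fun ω => ?_)
  let ω' : EuclideanSpace ℝ (Fin d) → ℝ := fun x => if hx : x ∈ J then ω ⟨x, hx⟩ else 0
  have h1 : ∀ j : J, ω j = ω' j := fun j => by simp [ω']
  have h2 : ∀ i : I, Finset.restrict₂ (π := fun _ => ℝ) hIJ ω i = ω' i := fun i => by
    simp [ω', Finset.restrict₂, hIJ i.2]
  simp only [h1, h2]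
  rw [← Finsupp.sum_mul_eq_sum_coe hsupp, hη, Finsupp.sum_mul_finsetSum_single]

/-- Existence of the finite-dimensional laws, by Lévy's continuity theorem. -/
theorem exists_isFiniteDimLaws {Ω : Type*} [MeasurableSpace Ω] (μ : ℕ → Measure Ω)
    [∀ n, IsProbabilityMeasure (μ n)] {X : Ω → EuclideanSpace ℝ (Fin d) → ℝ}
    (hX : ∀ x, Measurable fun ω => X ω x)
    (hC : ∀ η, Tendsto (fun n => ∫ ω, Complex.exp (Complex.I *
      ((η.sum fun x a => a * X ω x : ℝ) : ℂ)) ∂μ n) atTop (𝓝 (C η)))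
    (h0 : ∀ J : Finset (EuclideanSpace ℝ (Fin d)), Tendsto (fun α : J → ℝ =>
      C (∑ j : J, Finsupp.single (j : EuclideanSpace ℝ (Fin d)) (α j))) (𝓝 0) (𝓝 1)) :
    ∃ P, IsFiniteDimLaws C P := by
  -- Lévy's theorem needs continuity at zero towards the value of the limit there, while `h0`
  -- provides the limit 1.
  have hone : C 0 = 1 := tendsto_nhds_unique (hC 0) (by simp)
  have key : ∀ J : Finset (EuclideanSpace ℝ (Fin d)), ∃ P : Measure (J → ℝ),
      IsProbabilityMeasure P ∧ ∀ α : J → ℝ,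
        ∫ ω : J → ℝ, Complex.exp (Complex.I * ((∑ j, α j * ω j : ℝ) : ℂ)) ∂P =
          C (∑ j : J, Finsupp.single (j : EuclideanSpace ℝ (Fin d)) (α j)) := by
    intro J
    have hm : Measurable fun ω => (WithLp.toLp 2 fun j : J => X ω j : EuclideanSpace ℝ J) :=
      (by fun_prop : Measurable (WithLp.toLp 2 : (J → ℝ) → EuclideanSpace ℝ J)).comp
        (measurable_pi_lambda _ fun j => hX j)
    have hprob : ∀ n, IsProbabilityMeasure ((μ n).map
        fun ω => (WithLp.toLp 2 fun j : J => X ω j : EuclideanSpace ℝ J)) :=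
      fun n => Measure.isProbabilityMeasure_map hm.aemeasurable
    let f : EuclideanSpace ℝ J → ℂ := fun t =>
      C (∑ j : J, Finsupp.single (j : EuclideanSpace ℝ (Fin d)) (t j))
    have hf : ContinuousAt f 0 := by
      have h := (h0 J).comp ((by fun_prop : Continuous
        (WithLp.ofLp : EuclideanSpace ℝ J → J → ℝ)).tendsto 0)
      rw [ContinuousAt]
      simpa [f, Function.comp_def, hone] using h
    have hlim : ∀ t, Tendsto (fun n => charFun ((μ n).map
        fun ω => (WithLp.toLp 2 fun j : J => X ω j : EuclideanSpace ℝ J)) t) atTop (𝓝 (f t)) := by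
      intro t
      refine (hC _).congr fun n => ?_
      rw [charFun_apply, integral_map hm.aemeasurable (by fun_prop)]
      refine integral_congr_ae (.of_forall fun ω => ?_)
      simp only [PiLp.inner_apply, RCLike.inner_apply, conj_trivial]
      rw [Finsupp.sum_mul_finsetSum_single, mul_comm]
    obtain ⟨μ₀, hμ₀⟩ := exists_charFun_eq_of_tendsto
      (fun n => (⟨_, hprob n⟩ : ProbabilityMeasure (EuclideanSpace ℝ J))) hf hlim
    refine ⟨(μ₀ : Measure (EuclideanSpace ℝ J)).map WithLp.ofLp,
      Measure.isProbabilityMeasure_map (by fun_prop), fun α => ?_⟩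
    rw [integral_exp_sum_eq_charFun, Measure.map_map (by fun_prop) (by fun_prop)]
    have := congrFun hμ₀ (WithLp.toLp 2 α)
    simpa [f, Function.comp_def] using this
  choose P hP hPC using key
  exact ⟨P, hP, hPC, isProjectiveMeasureFamily_of_charFun_eq hP hPC⟩

/-- Kolmogorov's theorem applies, and the functional at `η` depends only on the coordinates in the
support of `η`, so it is computed from one marginal. -/
theorem IsFiniteDimLaws.exists_canonical
    {P : (J : Finset (EuclideanSpace ℝ (Fin d))) → Measure (J → ℝ)} (hP : IsFiniteDimLaws C P) :
    ∃ Pcan : Measure (EuclideanSpace ℝ (Fin d) → ℝ),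
      IsProbabilityMeasure Pcan ∧
      IsProjectiveLimit (α := fun _ => ℝ) Pcan P ∧
      (∀ Q : Measure (EuclideanSpace ℝ (Fin d) → ℝ),
        IsProjectiveLimit (α := fun _ => ℝ) Q P → Q = Pcan) ∧
      ∀ η : FiniteConfig d,
        ∫ ω, Complex.exp (Complex.I * ((η.sum fun x a => a * ω x : ℝ) : ℂ)) ∂Pcan = C η := by
  have := hP.isProbabilityMeasure
  obtain ⟨Pcan, hlim⟩ := exists_isProjectiveLimit hP.projective
  refine ⟨Pcan, hlim.isProbabilityMeasure, hlim, fun Q hQ => hQ.unique hlim, fun η => ?_⟩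
  rw [← hP.integral_exp_eq (J := η.support) subset_rfl, ← hlim η.support,
    integral_map (by fun_prop) (measurable_exp_sum _).aestronglyMeasurable]
  refine integral_congr_ae (.of_forall fun ω => ?_)
  simp only [Finsupp.sum_mul_eq_sum_coe (J := η.support) subset_rfl]
  rfl

end FiniteDimensionalLaws

/-! ### The main theorem -/

theorem exists_kirkwoodSalsburgCondition {d : ℕ} {G : EuclideanSpace ℝ (Fin d) → ℝ}
    (hG : Measurable G) {r ν : Measure ℝ} [IsProbabilityMeasure r] [IsProbabilityMeasure ν]
    {z β : ENNReal} (hz : z < convRadius (mayerConst G ν r))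
    (hβ : β < convRadius (mayerConst G r ν)) :
    ∃ R₀ R₁ : ℝ, KirkwoodSalsburgCondition (pairPhase G) (measurable_pairPhase hG)
      (chargeMeasure d r) (dualMeasure d ν) (IsAdmissible r ν) R₀ R₁ ∧
      z < ENNReal.ofReal R₀ ∧ β < ENNReal.ofReal R₁ := by
  obtain ⟨R₀, hR₀, hz, h₀⟩ := exists_radius_of_lt_convRadius hz
  obtain ⟨R₁, hR₁, hβ, h₁⟩ := exists_radius_of_lt_convRadius hβ
  exact ⟨R₀, R₁, kirkwoodSalsburgCondition_isAdmissible hG hR₀ hR₁ h₀ h₁, hz, hβ⟩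

theorem norm_lt_of_enorm_lt_ofReal {F : Type*} [SeminormedAddGroup F] {x : F} {R : ℝ}
    (h : ‖x‖ₑ < ENNReal.ofReal R) : ‖x‖ < R := by
  rw [← ofReal_norm] at h
  exact (ENNReal.ofReal_lt_ofReal_iff_of_nonneg (norm_nonneg x)).1 h

theorem corollary6p1 (d : ℕ) (hd : 1 ≤ d)
    -- the kernel
    (G : EuclideanSpace ℝ (Fin d) → ℝ) (hG : Integrable G)
    -- the Lévy measure and the interaction measure
    (r ν : Measure ℝ) [IsProbabilityMeasure r] [IsProbabilityMeasure ν]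
    (c : ℝ) (hr : r (Set.Icc (-c) c)ᶜ = 0) (hr0 : r {0} = 0) (hrs : r.map (fun s => -s) = r)
    (c' : ℝ) (hν : ν (Set.Icc (-c') c')ᶜ = 0) (hνs : ν.map (fun α => -α) = ν)
    (C₁ C₂ : ENNReal) (hC₁ : C₁ = mayerConst G r ν) (hC₂ : C₂ = mayerConst G ν r) :
    -- (i) existence of the infinite-volume limit
    (∀ z β : ℝ, 0 ≤ z → ‖z‖ₑ < convRadius C₂ → ‖β‖ₑ < convRadius C₁ →
      ∀ η : FiniteConfig d,
        Tendsto (fun Λ => charFunctional z β r ν G Λ η) atTop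
          (𝓝 (charFunctionalLimit z β r ν G η))) ∧
    -- (i) analyticity in `z` and `β`, on the whole complex polydisc
    (∀ η : FiniteConfig d, ∃ Φ : ℂ × ℂ → ℂ,
      AnalyticOnNhd ℂ Φ {p | ‖p.1‖ₑ < convRadius C₂ ∧ ‖p.2‖ₑ < convRadius C₁} ∧
      ∀ z β : ℝ, 0 ≤ z → ‖z‖ₑ < convRadius C₂ → ‖β‖ₑ < convRadius C₁ →
        charFunctionalLimit z β r ν G η = Φ ((z : ℂ), (β : ℂ))) ∧
    ∀ z β : ℝ, 0 ≤ z → ‖z‖ₑ < convRadius C₂ → ‖β‖ₑ < convRadius C₁ →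
      -- (ii) continuity at zero
      (∀ (n : ℕ) (x : Fin n → EuclideanSpace ℝ (Fin d)),
        Tendsto
          (fun α : Fin n → ℝ =>
            charFunctionalLimit z β r ν G (∑ l, Finsupp.single (x l) (α l)))
          (𝓝 0) (𝓝 1)) ∧
      -- (iii) the projective family of finite-dimensional laws
      ∃ P : (J : Finset (EuclideanSpace ℝ (Fin d))) → Measure (J → ℝ),
        IsFiniteDimLaws (charFunctionalLimit z β r ν G) P ∧
        (∀ P', IsFiniteDimLaws (charFunctionalLimit z β r ν G) P' → P' = P) ∧
        -- (iv) the canonical measure on functions `ω : ℝᵈ → ℝ`, with process `X̃(x)(ω) = ω(x)`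
        ∃ Pcan : Measure (EuclideanSpace ℝ (Fin d) → ℝ),
          IsProbabilityMeasure Pcan ∧
          IsProjectiveLimit (α := fun _ => ℝ) Pcan P ∧
          (∀ Q : Measure (EuclideanSpace ℝ (Fin d) → ℝ), IsProjectiveLimit (α := fun _ => ℝ) Q P → Q = Pcan) ∧
          ∀ η : FiniteConfig d,
            ∫ ω, Complex.exp (Complex.I * ((η.sum fun x a => a * ω x : ℝ) : ℂ)) ∂Pcan =
              charFunctionalLimit z β r ν G η := by
  -- All quantities depend only on the almost everywhere class of `G`, which may therefore be taken
  -- Borel measurable.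
  have hGG := hG.1.ae_eq_mk
  have hGm : Measurable (hG.1.mk G) := hG.1.stronglyMeasurable_mk.measurable
  have hGi : Integrable (hG.1.mk G) := hG.congr hGG
  simp only [charFunctionalLimit_congr_ae hGG, charFunctional_congr_ae hGG]
  rw [mayerConst_congr_ae hGG] at hC₁ hC₂
  generalize hG.1.mk G = G' at *
  subst hC₁ hC₂
  have hlim : ∀ z β : ℝ, 0 ≤ z → ‖z‖ₑ < convRadius (mayerConst G' ν r) →
      ‖β‖ₑ < convRadius (mayerConst G' r ν) → ∀ η : FiniteConfig d,
        Tendsto (fun Λ => charFunctional z β r ν G' Λ η) atTop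
          (𝓝 (charFunctionalLimit z β r ν G' η)) := by
    intro z β hz hzC hβC η
    obtain ⟨R₀, R₁, hR, hzR, hβR⟩ := exists_kirkwoodSalsburgCondition hGm hzC hβC
    exact tendsto_nhds_limUnder ⟨_, tendsto_charFunctional_tsum hGm η hr hGi hR hνs hz
      (norm_lt_of_enorm_lt_ofReal hzR) (norm_lt_of_enorm_lt_ofReal hβR)⟩
  -- The coefficients do not involve the radii, so a single series serves the whole polydisc; radii
  -- are chosen anew around each point.
  refine ⟨hlim, fun η => ⟨fun p => ∑' n : ℕ × ℕ,
    infiniteVolumeCoeff r ν hGm η n * (p.1 ^ n.1 * p.2 ^ n.2), ?_, ?_⟩, ?_⟩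
  · rintro p ⟨hp₀, hp₁⟩
    obtain ⟨R₀, R₁, hR, hzR, hβR⟩ := exists_kirkwoodSalsburgCondition hGm hp₀ hp₁
    exact analyticAt_bivariate hR.pos₀ hR.pos₁ (norm_infiniteVolumeCoeff_le hGm η hr hGi hR)
      (norm_lt_of_enorm_lt_ofReal hzR) (norm_lt_of_enorm_lt_ofReal hβR)
  · intro z β hz hzC hβC
    obtain ⟨R₀, R₁, hR, hzR, hβR⟩ := exists_kirkwoodSalsburgCondition hGm hzC hβC
    exact charFunctionalLimit_eq_tsum hGm η hr hGi hR hνs hz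
      (norm_lt_of_enorm_lt_ofReal hzR) (norm_lt_of_enorm_lt_ofReal hβR)
  · intro z β hz hzC hβC
    obtain ⟨R₀, R₁, hR, hzR, hβR⟩ := exists_kirkwoodSalsburgCondition hGm hzC hβC
    have hzR' := norm_lt_of_enorm_lt_ofReal hzR
    have hβR' := norm_lt_of_enorm_lt_ofReal hβR
    refine ⟨fun n x => tendsto_charFunctionalLimit_one hGm hr hGi hR hνs hz hzR' hβR' x, ?_⟩
    have hprob : ∀ n, IsProbabilityMeasure (interactingLaw z β r ν G' (compactBall 0 n)) :=
      fun n => isProbabilityMeasure_interactingLaw _ z r hGm ν β hz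
    -- Lévy's theorem is applied along the sequence of closed balls, which is cofinal among the
    -- compact sets.
    obtain ⟨P, hP⟩ := exists_isFiniteDimLaws (C := charFunctionalLimit z β r ν G')
      (fun n => interactingLaw z β r ν G' (compactBall 0 n)) (X := staticField G')
      (measurable_staticField hGm)
      (fun η => (hlim z β hz hzC hβC η).comp (tendsto_compactBall 0))
      (fun J => tendsto_charFunctionalLimit_one hGm hr hGi hR hνs hz hzR' hβR' Subtype.val)
    exact ⟨P, hP, fun P' hP' => hP.unique hP', hP.exists_canonical⟩
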